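/- **Setting.** Let $\hat n=\{0,\dots,n\}$, $\Delta=\{x\in\mathbb R^{n+1}: x_i\ge 0,\ \sum x_i=1\}$, and $\mathbb T^n=(\mathbb R/2\pi\mathbb Z)^{n+1}/(\mathbb R/2\pi\mathbb Z)$ (quotient by the diagonal) with coordinates $[\theta_0,\dots,\theta_n]$. For $J\subseteq\hat n$ let $\Delta_J=\{x\in\Delta: x_j=0 \text{ for } j\notin J\}$. For $I\subseteq J\subseteq \hat n$ with $|I|\ge 2$ let $H_{IJ}\subset\Delta_J$ be the set of $x\in\Delta_J$ with $x_i=x_{i'}\ge x_k$ for all $i,i'\in I$, $k\notin I$, and let $\mathcal C^I\subset\mathbb T^n$ be the closure of $\{[\arg z_0,\dots,\arg z_n]: z\in(\mathbb C^*)^{n+1},\ \sum_{i\in I}z_i=0\}$. The phase tropical pair-of-pants is $\mathcal P=\bigcup_{I\subseteq J,\,|I|\ge2}H_{IJ}\times\mathcal C^I\subset\Delta\times\mathbb T^n$. Let $\sigma=\langle I_0,\dots,I_{k-1}\rangle$ be a cyclic partition of $\hat n$ into $k$ nonempty parts, and $\Delta_\sigma=\{\alpha\in\mathbb R^k:\alpha_s\ge0,\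 \sum\alpha_s=2\pi\}$, mapped to $\mathbb T^n$ by $\theta_i=\alpha_0+\dots+\alpha_{s-1}$ for $i\in I_s$ (so $\alpha_s$ is the difference of the arguments of $I_{s+1}$ and $I_s$). Let $J\subseteq\hat n$ be divided by $\sigma$, i.e. $J$ meets at least two parts of $\sigma$. Let $\mathcal P_{\sigma,J}\subset\Delta_J\times\Delta_\sigma$ be the set of points whose image in $\Delta\times\mathbb T^n$ lies in $\mathcal P$. For a polyhedral set $S$ and a point $p$ the local fan of $S$ at $p$ is the set of $\xi$ with $p+\varepsilon\xi\in S$ for all sufficiently small $\varepsilon>0$. **Lemma.** (1) The pair $(\Delta_J\times\Delta_\sigma,\mathcal P_{\sigma,J})$ is locally flat in the PL category: with $q=\dim(\Delta_J\times\Delta_\sigma)=|J|+k-2$, every point of $\Delta_J\times\Delta_\sigma$ has a neighborhood $N$ such that the pair $(N,N\cap\mathcal P_{\sigma,J})$ is PL homeomorphic to the pair cut out of the standard pair $([-1,1]^q,\{(0,0)\}\times[-1,1]^{q-2})$ by a neighborhood of the image of the point. (2) Let $K\subseteq J$, let $v$ be the midpoint of the edge of $\Delta_\sigma$ joining its vertices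 $s<t$ (that is, $v_s=v_t=\pi$ and all other $v_r=0$), put $I_+=I_{s+1}\cup\dots\cup I_t$, $I_-=\hat n\setminus I_+$ and $K_\pm=K\cap I_\pm$, and assume that $K_+$ and $K_-$ are nonempty. Then $(\hat\Delta_K,v)$, where $\hat\Delta_K$ is the barycenter of $\Delta_K$, belongs to $\mathcal P_{\sigma,J}$. Let $\mathcal P^v$ be the local fan of $\mathcal P_{\sigma,J}$ at $(\hat\Delta_K,v)$, let $H_v$ be its projection to the $\Delta_J$-factor, and let $T_v$ be the local fan of $\Delta_\sigma$ at $v$, so that $\mathcal P^v\subseteq H_v\times T_v$. Let $$V=\mathbb R^{K_+}/\mathbb R(1,\dots,1)\times\mathbb R^{K_-}/\mathbb R(1,\dots,1)\times[0,\infty)^{J\setminus K}.$$ Then the linear projection to $V$ restricts to a PL homeomorphism $\pi:H_v\to V$. Moreover let $w=e_s-e_t\in\mathbb R^k$, and let $\lambda$ be any vector in $\mathbb R^{K_+}/\mathbb R(1,\dots,1)\times\mathbb R^{K_-}/\mathbb R(1,\dots,1)$ such that $\lambda_i<\lambda_j$ whenever $i,j\in K_+$ and the part of $i$ precedes the part of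 $j$ in the order $I_{s+1},\dots,I_t$, and $\lambda_i>\lambda_j$ whenever $i,j\in K_-$ and the part of $i$ precedes the part of $j$ in the order $I_{t+1},\dots,I_{k-1},I_0,\dots,I_s$. Then $$\mathcal P^v\times\mathbb R\to V\times T_v,\qquad ((u,\beta),\tau)\mapsto(\pi(u)+\tau\lambda,\ \beta+\tau w)$$ is a PL homeomorphism. That is, after $H_v$ is identified with $V$, the direction $w+\lambda$ exhibits the codimension one pair $(H_v\times T_v,\mathcal P^v)$ as the product pair $(\mathcal P^v\times\mathbb R,\mathcal P^v\times\{0\})$. -/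

import Mathlib

open Set Filter Topology

noncomputable section

namespace PhaseTropical

/-! ### Piecewise linear topology -/

section PL

variable {E F : Type*} [AddCommGroup E] [Module ℝ E] [AddCommGroup F] [Module ℝ F]

/-- A (closed, possibly unbounded) convex polyhedron: a finite intersection of half-spaces. -/
def IsConvexPolyhedron (C : Set E) : Prop :=
  ∃ A : Finset ((E →ₗ[ℝ] ℝ) × ℝ), C = {x | ∀ a ∈ A, a.1 x ≤ a.2}

/-- `f` is piecewise linear on `S`: the set `S` is a finite union of convex polyhedra, on each of
which `f` is affine. The pieces are closed, so in finite dimension `f` is continuous on `S`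
(see `IsPLOn.continuousOn`). -/
def IsPLOn (f : E → F) (S : Set E) : Prop :=
  ∃ 𝒞 : Set (Set E), 𝒞.Finite ∧ S = ⋃₀ 𝒞 ∧
    ∀ C ∈ 𝒞, IsConvexPolyhedron C ∧ ∃ A : E →ᵃ[ℝ] F, EqOn f A C

/-- `f` restricts to a piecewise linear homeomorphism from `S` onto `T`. -/
def IsPLHomeo (f : E → F) (S : Set E) (T : Set F) : Prop :=
  IsPLOn f S ∧ MapsTo f S T ∧ ∃ g : F → E, IsPLOn g T ∧ MapsTo g T S ∧ InvOn g f S T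

end PL

/-- The cube `[-1,1]^q`. -/
def stdCube (q : ℕ) : Set (Fin q → ℝ) := {y | ∀ i, -1 ≤ y i ∧ y i ≤ 1}

/-- The codimension two subcube `{(0,0)} × [-1,1]^(q-2)` of `[-1,1]^q`. -/
def stdSubcube (q : ℕ) : Set (Fin q → ℝ) := {y ∈ stdCube q | ∀ i : Fin q, i.val < 2 → y i = 0}

/-- The codimension two pair `(X, Y)` is locally flat, in the PL category, in dimension `q`:
every point `x` of `X` has a neighbourhood `N` in `X` such that the pair `(N, N ∩ Y)` is PL
homeomorphic to the pair cut out of the standard pair `([-1,1]^q, {(0,0)} × [-1,1]^(q-2))` by a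
neighbourhood `N'` in `[-1,1]^q` of the image of `x`. -/
def IsLocallyFlat {E : Type*} [AddCommGroup E] [Module ℝ E] [TopologicalSpace E]
    (q : ℕ) (X Y : Set E) : Prop :=
  ∀ x ∈ X, ∃ (N : Set E) (N' : Set (Fin q → ℝ)) (f : E → (Fin q → ℝ)),
    N ⊆ X ∧ N ∈ 𝓝[X] x ∧ N' ⊆ stdCube q ∧ N' ∈ 𝓝[stdCube q] (f x) ∧
    IsPLHomeo f N N' ∧ f '' (N ∩ Y) = N' ∩ stdSubcube q

/-- The local fan of a polyhedral set `S` at the point `p`: the directions `ξ` such that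
`p + ε ξ` lies in `S` for all sufficiently small `ε > 0`. -/
def localFan {E : Type*} [AddCommGroup E] [Module ℝ E] (S : Set E) (p : E) : Set E :=
  {ξ | ∀ᶠ ε in 𝓝[>] (0 : ℝ), p + ε • ξ ∈ S}

theorem IsConvexPolyhedron.isClosed {E : Type*} [NormedAddCommGroup E] [NormedSpace ℝ E]
    [FiniteDimensional ℝ E] {C : Set E} (h : IsConvexPolyhedron C) : IsClosed C := by
  obtain ⟨A, rfl⟩ := h
  simp only [Set.ofPred_forall]
  exact isClosed_biInter fun a _ =>
    isClosed_le (LinearMap.continuous_of_finiteDimensional a.1) continuous_const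

theorem IsPLOn.continuousOn {E F : Type*} [NormedAddCommGroup E] [NormedSpace ℝ E]
    [FiniteDimensional ℝ E] [NormedAddCommGroup F] [NormedSpace ℝ F]
    {f : E → F} {S : Set E} (h : IsPLOn f S) : ContinuousOn f S := by
  obtain ⟨𝒞, hfin, rfl, hC⟩ := h
  rw [sUnion_eq_iUnion]
  have : Finite 𝒞 := hfin
  refine LocallyFinite.continuousOn_iUnion (locallyFinite_of_finite _)
    (fun C => (hC C C.2).1.isClosed) fun C => ?_
  obtain ⟨-, A, hA⟩ := hC C C.2
  exact (AffineMap.continuous_of_finiteDimensional A).continuousOn.congr hA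

/-! ### The phase tropical pair-of-pants in `Δ × 𝕋ⁿ`

The index set `{0, …, n}` is `Fin (n + 1)`. -/

/-- The diagonal circle in `(ℝ/2πℤ)^(n+1)`. -/
def diagCircle (n : ℕ) : AddSubgroup (Fin (n + 1) → Real.Angle) :=
  (Pi.constAddMonoidHom (Fin (n + 1)) Real.Angle).range

/-- The torus `𝕋ⁿ = (ℝ/2πℤ)^(n+1) / (ℝ/2πℤ)`, with homogeneous coordinates `[θ₀, …, θₙ]`. -/
abbrev Torus (n : ℕ) : Type := (Fin (n + 1) → Real.Angle) ⧸ diagCircle n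

/-- The class `[θ₀, …, θₙ]` in the torus. -/
def Torus.mk {n : ℕ} (θ : Fin (n + 1) → Real.Angle) : Torus n := QuotientAddGroup.mk θ

/-- The face `Δ_J` of the standard simplex `Δ`. -/
def face {n : ℕ} (J : Finset (Fin (n + 1))) : Set (Fin (n + 1) → ℝ) :=
  {x ∈ stdSimplex ℝ (Fin (n + 1)) | ∀ j, j ∉ J → x j = 0}

/-- The cubical face `H_{IJ}` of the spine: `x_i = x_{i'} ≥ x_k` for `i, i' ∈ I`, `k ∉ I`, and
`x_j = 0` for `j ∉ J`. -/
def spineFace {n : ℕ} (I J : Finset (Fin (n + 1))) : Set (Fin (n + 1) → ℝ) :=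
  {x ∈ stdSimplex ℝ (Fin (n + 1)) | (∀ i ∈ I, ∀ i' ∈ I, x i = x i') ∧
    (∀ i ∈ I, ∀ k, k ∉ I → x k ≤ x i) ∧ ∀ j, j ∉ J → x j = 0}

/-- The partial coamoeba `𝒞^I`: the closure in `𝕋ⁿ` of the arguments of the points of the
hypersurface `∑_{i ∈ I} z_i = 0` in `(ℂ^*)^(n+1) / ℂ^*`. -/
def partialCoamoeba {n : ℕ} (I : Finset (Fin (n + 1))) : Set (Torus n) :=
  closure {θ | ∃ z : Fin (n + 1) → ℂ, (∀ i, z i ≠ 0) ∧ ∑ i ∈ I, z i = 0 ∧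
    θ = Torus.mk fun i => ((z i).arg : Real.Angle)}

/-- The phase tropical pair-of-pants `𝒫 = ⋃ H_{IJ} × 𝒞^I` over `I ⊆ J` with `|I| ≥ 2`. -/
def phaseTropicalPants (n : ℕ) : Set ((Fin (n + 1) → ℝ) × Torus n) :=
  ⋃ (I : Finset (Fin (n + 1))) (J : Finset (Fin (n + 1))) (_ : I ⊆ J) (_ : 2 ≤ I.card),
    spineFace I J ×ˢ partialCoamoeba I

/-! ### Cyclic partitions and the strata -/

/-- A cyclic partition `⟨I_0, …, I_{k-1}⟩` of `{0, …, n}` into `k` nonempty parts, labelled by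
`Fin k` compatibly with the cyclic order: `part i = s` means `i ∈ I_s`, and `I_{s+1}` follows `I_s`,
with `I_0` following `I_{k-1}`. -/
structure CyclicPartition (n k : ℕ) where
  part : Fin (n + 1) → Fin k
  surj : Function.Surjective part

/-- `σ` divides `J` if `J` has elements in at least two parts of `σ`. -/
def CyclicPartition.Divides {n k : ℕ} (σ : CyclicPartition n k) (J : Finset (Fin (n + 1))) : Prop :=
  ∃ i ∈ J, ∃ j ∈ J, σ.part i ≠ σ.part j

/-- The simplex `Δ_σ = {α : α_s ≥ 0, ∑ α_s = 2π}`, for a partition with `k` parts. -/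
def gapSimplex (k : ℕ) : Set (Fin k → ℝ) :=
  {α | (∀ s, 0 ≤ α s) ∧ ∑ s, α s = 2 * Real.pi}

/-- The map `Δ_σ → 𝕋ⁿ` onto the closed stratum of `σ`, for which `α_s` is the difference between
the argument of the part `I_{s+1}` and that of the part `I_s`: up to a common rotation the argument
of the part `I_s` is `α_0 + ⋯ + α_{s-1}`. -/
def CyclicPartition.toTorus {n k : ℕ} (σ : CyclicPartition n k) (α : Fin k → ℝ) : Torus n :=
  Torus.mk fun i => ((∑ r ∈ Finset.univ.filter (fun r => r < σ.part i), α r : ℝ) : Real.Angle)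

/-- The ambient ball `Δ_J × Δ_σ`. -/
def ambientCell {n : ℕ} (k : ℕ) (J : Finset (Fin (n + 1))) :
    Set ((Fin (n + 1) → ℝ) × (Fin k → ℝ)) :=
  face J ×ˢ gapSimplex k

/-- The stratum `𝒫_{σ,J}`, viewed inside `Δ_J × Δ_σ`. -/
def pantsCell {n k : ℕ} (σ : CyclicPartition n k) (J : Finset (Fin (n + 1))) :
    Set ((Fin (n + 1) → ℝ) × (Fin k → ℝ)) :=
  {y ∈ ambientCell k J | (y.1, σ.toTorus y.2) ∈ phaseTropicalPants n}

/-! ### The local structure at a vertex -/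

/-- The barycenter of the face `Δ_K`. -/
def baryc {n : ℕ} (K : Finset (Fin (n + 1))) : Fin (n + 1) → ℝ :=
  fun i => if i ∈ K then (K.card : ℝ)⁻¹ else 0

/-- The midpoint of the edge of `Δ_σ` joining its vertices `s` and `t`. -/
def chordVertex {k : ℕ} (s t : Fin k) : Fin k → ℝ :=
  fun r => if r = s ∨ r = t then Real.pi else 0

/-- The vector `w`, parallel to the edge of `Δ_σ` joining the vertices `s` and `t`. -/
def edgeVector {k : ℕ} (s t : Fin k) : Fin k → ℝ := Pi.single s 1 - Pi.single t 1

/-- One side `I_+` of the 2-partition `⟨I_-, I_+⟩` obtained from `σ` by keeping only its vertices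
`s < t`: the union of the parts `I_{s+1}, …, I_t`. The other side `I_-` is its complement. -/
def upperSide {n k : ℕ} (σ : CyclicPartition n k) (s t : Fin k) : Finset (Fin (n + 1)) :=
  Finset.univ.filter fun i => s < σ.part i ∧ σ.part i ≤ t

/-- The position of the part `m` in the cyclic order cut open at the vertex `s`, that is in
`I_{s+1}, …, I_{k-1}, I_0, …, I_s`. -/
def position {k : ℕ} (s m : Fin k) : ℕ := if m ≤ s then m.val + k else m.val

/-- The product `ℝ^{K ∩ U} / ℝ(1,…,1) × ℝ^{K \ U} / ℝ(1,…,1)` of the ambient spaces of the normal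
fans to the simplices `Δ_{K ∩ U}` and `Δ_{K \ U}`, times the simplicial cone on `J \ K`. The two
quotients are represented by the vectors with coordinate sum zero. -/
def normalFanProduct {n : ℕ} (J K U : Finset (Fin (n + 1))) : Set (Fin (n + 1) → ℝ) :=
  {y | ∑ i ∈ K ∩ U, y i = 0 ∧ ∑ i ∈ K \ U, y i = 0 ∧
    (∀ j, j ∉ K → 0 ≤ y j) ∧ ∀ j, j ∉ J → y j = 0}

/-- The linear projection modulo the vectors `(1,…,1)` of `ℝ^{K ∩ U}` and of `ℝ^{K \ U}`, with the
quotients represented by vectors with coordinate sum zero. -/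
def centering {n : ℕ} (K U : Finset (Fin (n + 1))) (u : Fin (n + 1) → ℝ) : Fin (n + 1) → ℝ :=
  fun i =>
    if i ∈ K ∩ U then u i - (∑ j ∈ K ∩ U, u j) / ((K ∩ U).card : ℝ)
    else if i ∈ K \ U then u i - (∑ j ∈ K \ U, u j) / ((K \ U).card : ℝ)
    else u i

/-- `λ` is a vector in the product of the normal fans to `Δ_{K ∩ I_+}` and `Δ_{K ∩ I_-}` which
as a linear functional orders the vertices of both simplices from right to left, where
the circle is drawn with the chord `s t` horizontal and `I_+` on top: counterclockwise on
`I_+` and clockwise on `I_-`. Elements in the same part of `σ` may come in any order. -/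
def IsOrderVector {n k : ℕ} (σ : CyclicPartition n k) (K : Finset (Fin (n + 1))) (s t : Fin k)
    (lam : Fin (n + 1) → ℝ) : Prop :=
  lam ∈ normalFanProduct K K (upperSide σ s t) ∧
  (∀ i ∈ K ∩ upperSide σ s t, ∀ j ∈ K ∩ upperSide σ s t,
    position s (σ.part i) < position s (σ.part j) → lam i < lam j) ∧
  (∀ i ∈ K \ upperSide σ s t, ∀ j ∈ K \ upperSide σ s t,
    position s (σ.part i) < position s (σ.part j) → lam j < lam i)

/-- The local fan `𝒫^v_{σ,J}` of `𝒫_{σ,J}` at its vertex (barycenter of `Δ_K`, `v`), where `v` is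
the midpoint of the edge `s t` of `Δ_σ`. -/
def pantsFan {n k : ℕ} (σ : CyclicPartition n k) (J K : Finset (Fin (n + 1))) (s t : Fin k) :
    Set ((Fin (n + 1) → ℝ) × (Fin k → ℝ)) :=
  localFan (pantsCell σ J) (baryc K, chordVertex s t)

/-- The codimension one fan `H_{v,J}`: the projection of `𝒫^v_{σ,J}` to the `Δ_J` factor. -/
def spineFan {n k : ℕ} (σ : CyclicPartition n k) (J K : Finset (Fin (n + 1))) (s t : Fin k) :
    Set (Fin (n + 1) → ℝ) :=
  Prod.fst '' pantsFan σ J K s t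

end PhaseTropical

end

open PhaseTropical

open Set Filter Topology

noncomputable section

namespace PhaseTropical

/-! ### Polyhedra and piecewise linear maps. -/

section PLTheory

variable {E F G : Type*} [AddCommGroup E] [Module ℝ E] [AddCommGroup F] [Module ℝ F]
  [AddCommGroup G] [Module ℝ G]

/-! A point of the torus lies in the partial coamoeba of `I` exactly when its arguments over `I` lie
in no open half circle, that is, when `0` is a convex combination of the corresponding unit vectors
(`mem_partialCoamoeba_iff`). This condition is monotone in `I`, so the union defining the pants
collapses: `(x, α)` is in the stratum iff the arguments at the maximal coordinates of `x` lie in no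
open half circle (`mem_pantsCell_iff`).

In the star of the vertex `(baryc K, chordVertex s t)` the arguments lie in two arcs shorter than
`π`, one for `I_+` and one for `I_-`. The half circle condition then says that some pair of maxima,
one from each side, is at angle at least `π`, and some such pair at angle at most `π`
(`surrounds_angle_iff`). Hence the stratum is locally a translate of `pantsCone`: the maxima over
`K_+` and `K_-` agree (`heightGap` is zero), and the deviation of the angle from `π` takes both weak
signs on pairs of maxima.

The equality of the two maxima is a graph over `V`: a vector of the fan of `Δ_J` is determined by
its class in `V` and its height gap, and both are arbitrary (`bijOn_centering`). The sign condition
cuts out a hypersurface in `V × T_v` that every line in the direction `w + λ` crosses exactly once.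
Indeed, moving backwards along such a line, the maxima on each side pass to smaller values of `λ`,
which by the choice of `λ` never decreases the angle from `I_+` to `I_-`, while `w` makes it grow at
unit speed (`existsUnique_balanced_time`, `bijOn_product`). The resulting bijection is linear on a
polyhedral set, and a PL bijection has a PL inverse (`IsPLOn.isPLHomeo`).

For local flatness, a point of the stratum has no gap above `π`, hence lies in the star of some
vertex (`exists_star`). There the height gap and the crossing time are two coordinates whose common
zero set is the stratum, and they extend to a chart onto an orthant (`bijOn_flatCoords`). At the
remaining points the stratum, being closed, is absent nearby, and a corner chart of the product of
simplices avoiding the subcube suffices. -/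

theorem isConvexPolyhedron_univ : IsConvexPolyhedron (univ : Set E) :=
  ⟨∅, by simp⟩

theorem isConvexPolyhedron_empty : IsConvexPolyhedron (∅ : Set E) :=
  ⟨{(0, -1)}, by ext; simp⟩

theorem isConvexPolyhedron_le {f g : E → ℝ} (hf : IsLinearMap ℝ f) (hg : IsLinearMap ℝ g) :
    IsConvexPolyhedron {x | f x ≤ g x} :=
  ⟨{(hf.mk' - hg.mk', 0)}, by ext; simp⟩

theorem isConvexPolyhedron_le_const {f : E → ℝ} (hf : IsLinearMap ℝ f) (c : ℝ) :
    IsConvexPolyhedron {x | f x ≤ c} :=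
  ⟨{(hf.mk', c)}, by ext; simp⟩

theorem IsConvexPolyhedron.inter {C D : Set E} (hC : IsConvexPolyhedron C)
    (hD : IsConvexPolyhedron D) : IsConvexPolyhedron (C ∩ D) := by
  classical
  obtain ⟨A, rfl⟩ := hC
  obtain ⟨B, rfl⟩ := hD
  refine ⟨A ∪ B, ?_⟩
  ext x
  simp only [mem_inter_iff, mem_ofPred_eq, Finset.mem_union]
  exact ⟨fun h a ha => ha.elim (h.1 a) (h.2 a),
    fun h => ⟨fun a ha => h a (Or.inl ha), fun a ha => h a (Or.inr ha)⟩⟩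

theorem isConvexPolyhedron_eq {f g : E → ℝ} (hf : IsLinearMap ℝ f) (hg : IsLinearMap ℝ g) :
    IsConvexPolyhedron {x | f x = g x} := by
  have : {x | f x = g x} = {x | f x ≤ g x} ∩ {x | g x ≤ f x} := by
    ext x; simp [le_antisymm_iff]
  rw [this]
  exact (isConvexPolyhedron_le hf hg).inter (isConvexPolyhedron_le hg hf)

theorem IsConvexPolyhedron.and {p q : E → Prop} (hp : IsConvexPolyhedron {x | p x})
    (hq : IsConvexPolyhedron {x | q x}) : IsConvexPolyhedron {x | p x ∧ q x} :=
  hp.inter hq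

theorem IsConvexPolyhedron.imp {p : Prop} {q : E → Prop}
    (hq : p → IsConvexPolyhedron {x | q x}) : IsConvexPolyhedron {x | p → q x} := by
  by_cases hp : p
  · simpa [hp] using hq hp
  · simpa [hp] using isConvexPolyhedron_univ

theorem IsConvexPolyhedron.forall {ι : Type*} [Finite ι] {p : ι → E → Prop}
    (h : ∀ i, IsConvexPolyhedron {x | p i x}) : IsConvexPolyhedron {x | ∀ i, p i x} := by
  classical
  have := Fintype.ofFinite ι
  choose A hA using h
  refine ⟨Finset.univ.biUnion A, ?_⟩
  ext x
  have h' : ∀ i, p i x ↔ ∀ a ∈ A i, a.1 x ≤ a.2 := fun i => by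
    have := congrArg (fun s => x ∈ s) (hA i)
    simpa using this
  simp only [mem_ofPred_eq, Finset.mem_biUnion, Finset.mem_univ, true_and, h']
  exact ⟨fun h a ⟨i, hi⟩ => h i a hi, fun h i a ha => h a ⟨i, ha⟩⟩

theorem IsConvexPolyhedron.preimage {C : Set F} (hC : IsConvexPolyhedron C) (f : E →ᵃ[ℝ] F) :
    IsConvexPolyhedron (f ⁻¹' C) := by
  classical
  obtain ⟨A, rfl⟩ := hC
  refine ⟨A.image fun a => (a.1 ∘ₗ f.linear, a.2 - a.1 (f 0)), ?_⟩
  ext x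
  have hx : f x = f.linear x + f 0 := by
    have := f.map_vadd 0 x
    simpa using this
  simp only [mem_preimage, mem_ofPred_eq, hx, Finset.forall_mem_image, map_add,
    LinearMap.comp_apply, le_sub_iff_add_le]

theorem IsConvexPolyhedron.convex {C : Set E} (hC : IsConvexPolyhedron C) : Convex ℝ C := by
  obtain ⟨A, rfl⟩ := hC
  intro x hx y hy a b ha hb hab c hc
  have h1 := mul_le_mul_of_nonneg_left (hx c hc) ha
  have h2 := mul_le_mul_of_nonneg_left (hy c hc) hb
  have h3 : a * c.2 + b * c.2 = c.2 := by rw [← add_mul, hab, one_mul]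
  simp only [map_add, map_smul, smul_eq_mul]
  linarith

/-- A polyhedral set: a finite union of convex polyhedra. -/
def IsPolyhedral (S : Set E) : Prop :=
  ∃ 𝒞 : Set (Set E), 𝒞.Finite ∧ S = ⋃₀ 𝒞 ∧ ∀ C ∈ 𝒞, IsConvexPolyhedron C

theorem IsConvexPolyhedron.isPolyhedral {C : Set E} (hC : IsConvexPolyhedron C) :
    IsPolyhedral C :=
  ⟨{C}, finite_singleton C, by simp, by simpa using hC⟩

theorem IsPolyhedral.exists {ι : Type*} [Finite ι] {p : ι → E → Prop}
    (h : ∀ i, IsPolyhedral {x | p i x}) : IsPolyhedral {x | ∃ i, p i x} := by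
  choose 𝒞 hfin hS hC using h
  refine ⟨⋃ i, 𝒞 i, finite_iUnion hfin, ?_, fun C hC' => ?_⟩
  · rw [sUnion_iUnion, ← iUnion_congr hS]
    ext; simp
  · obtain ⟨i, hi⟩ := mem_iUnion.1 hC'
    exact hC i C hi

theorem IsPolyhedral.inter {S T : Set E} (hS : IsPolyhedral S) (hT : IsPolyhedral T) :
    IsPolyhedral (S ∩ T) := by
  obtain ⟨𝒞, h𝒞, rfl, hC⟩ := hS
  obtain ⟨𝒟, h𝒟, rfl, hD⟩ := hT
  refine ⟨image2 (· ∩ ·) 𝒞 𝒟, h𝒞.image2 _ h𝒟, ?_, ?_⟩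
  · ext x
    simp only [mem_inter_iff, mem_sUnion, mem_image2]
    exact ⟨fun ⟨⟨C, hC, hx⟩, D, hD, hy⟩ => ⟨_, ⟨C, hC, D, hD, rfl⟩, hx, hy⟩,
      fun ⟨_, ⟨C, hC, D, hD, h⟩, hx⟩ => by subst h; exact ⟨⟨C, hC, hx.1⟩, D, hD, hx.2⟩⟩
  · rintro _ ⟨C, hC', D, hD', rfl⟩
    exact (hC C hC').inter (hD D hD')

theorem IsPolyhedral.and {p q : E → Prop} (hp : IsPolyhedral {x | p x})
    (hq : IsPolyhedral {x | q x}) : IsPolyhedral {x | p x ∧ q x} :=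
  hp.inter hq

theorem IsPolyhedral.preimage {S : Set F} (hS : IsPolyhedral S) (f : E →ᵃ[ℝ] F) :
    IsPolyhedral (f ⁻¹' S) := by
  obtain ⟨𝒞, h𝒞, rfl, hC⟩ := hS
  refine ⟨Set.preimage f '' 𝒞, h𝒞.image _, ?_, ?_⟩
  · ext x; simp
  · rintro _ ⟨C, hC', rfl⟩
    exact (hC C hC').preimage f

theorem IsPolyhedral.isPLOn {S : Set E} (hS : IsPolyhedral S) (f : E →ᵃ[ℝ] F) :
    IsPLOn f S := by
  obtain ⟨𝒞, h𝒞, h, hC⟩ := hS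
  exact ⟨𝒞, h𝒞, h, fun C hC' => ⟨hC C hC', f, fun _ _ => rfl⟩⟩

theorem IsPolyhedral.isPLOn_of_isLinearMap {S : Set E} (hS : IsPolyhedral S) {f : E → F}
    (hf : IsLinearMap ℝ f) : IsPLOn f S :=
  hS.isPLOn hf.mk'.toAffineMap

theorem IsPLOn.isPolyhedral {S : Set E} {f : E → F} (hf : IsPLOn f S) : IsPolyhedral S := by
  obtain ⟨𝒞, h𝒞, h, hC⟩ := hf
  exact ⟨𝒞, h𝒞, h, fun C hC' => (hC C hC').1⟩

theorem IsPLOn.comp {S : Set E} {T : Set F} {f : E → F} {g : F → G} (hg : IsPLOn g T)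
    (hf : IsPLOn f S) (h : MapsTo f S T) : IsPLOn (g ∘ f) S := by
  obtain ⟨𝒞, h𝒞, rfl, hC⟩ := hf
  obtain ⟨𝒟, h𝒟, rfl, hD⟩ := hg
  refine ⟨image2 (fun C D => C ∩ f ⁻¹' D) 𝒞 𝒟, h𝒞.image2 _ h𝒟, ?_, ?_⟩
  · ext x
    simp only [mem_sUnion, mem_image2]
    constructor
    · rintro ⟨C, hC', hx⟩
      obtain ⟨D, hD', hy⟩ := h ⟨C, hC', hx⟩
      exact ⟨_, ⟨C, hC', D, hD', rfl⟩, hx, hy⟩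
    · rintro ⟨_, ⟨C, hC', D, hD', rfl⟩, hx⟩
      exact ⟨C, hC', hx.1⟩
  · rintro _ ⟨C, hC', D, hD', rfl⟩
    obtain ⟨hCp, A, hA⟩ := hC C hC'
    obtain ⟨hDp, B, hB⟩ := hD D hD'
    refine ⟨?_, B.comp A, fun x hx => ?_⟩
    · show IsConvexPolyhedron (C ∩ f ⁻¹' D)
      have : C ∩ f ⁻¹' D = C ∩ A ⁻¹' D := by
        ext x
        simp only [mem_inter_iff, mem_preimage]
        exact and_congr_right fun hx => by rw [hA hx]
      rw [this]
      exact hCp.inter (hDp.preimage A)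
    · rw [Function.comp_apply, hB hx.2, hA hx.1, AffineMap.comp_apply]

theorem IsPLOn.inter_preimage {S : Set E} {T : Set F} {f : E → F} (hf : IsPLOn f S)
    (hT : IsPolyhedral T) : IsPLOn f (S ∩ f ⁻¹' T) := by
  obtain ⟨𝒞, h𝒞, rfl, hC⟩ := hf
  obtain ⟨𝒟, h𝒟, rfl, hD⟩ := hT
  refine ⟨image2 (fun C D => C ∩ f ⁻¹' D) 𝒞 𝒟, h𝒞.image2 _ h𝒟, ?_, ?_⟩
  · ext x
    simp only [mem_sUnion, mem_image2, mem_inter_iff, mem_preimage]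
    exact ⟨fun ⟨⟨C, hC, hx⟩, D, hD, hy⟩ => ⟨_, ⟨C, hC, D, hD, rfl⟩, hx, hy⟩,
      fun ⟨_, ⟨C, hC, D, hD, h⟩, hx⟩ => by subst h; exact ⟨⟨C, hC, hx.1⟩, D, hD, hx.2⟩⟩
  · rintro _ ⟨C, hC', D, hD', rfl⟩
    obtain ⟨hCp, A, hA⟩ := hC C hC'
    refine ⟨?_, A, fun x hx => hA hx.1⟩
    show IsConvexPolyhedron (C ∩ f ⁻¹' D)
    have : C ∩ f ⁻¹' D = C ∩ A ⁻¹' D := by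
      ext x
      simp only [mem_inter_iff, mem_preimage]
      exact and_congr_right fun hx => by rw [hA hx]
    rw [this]
    exact hCp.inter ((hD D hD').preimage A)

theorem IsPLOn.prodMk {S : Set E} {f : E → F} {g : E → G} (hf : IsPLOn f S)
    (hg : IsPLOn g S) : IsPLOn (fun x => (f x, g x)) S := by
  obtain ⟨𝒞, h𝒞, rfl, hC⟩ := hf
  obtain ⟨𝒟, h𝒟, h, hD⟩ := hg
  refine ⟨image2 (· ∩ ·) 𝒞 𝒟, h𝒞.image2 _ h𝒟, ?_, ?_⟩
  · ext x
    constructor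
    · intro hx
      obtain ⟨D, hD', hy⟩ := h ▸ hx
      obtain ⟨C, hC', hx⟩ := hx
      exact ⟨_, ⟨C, hC', D, hD', rfl⟩, hx, hy⟩
    · rintro ⟨_, ⟨C, hC', D, hD', rfl⟩, hx⟩
      exact ⟨C, hC', hx.1⟩
  · rintro _ ⟨C, hC', D, hD', rfl⟩
    obtain ⟨hCp, A, hA⟩ := hC C hC'
    obtain ⟨hDp, B, hB⟩ := hD D hD'
    exact ⟨hCp.inter hDp, A.prod B, fun x hx => by simp [hA hx.1, hB hx.2]⟩

theorem IsPLOn.affine_comp {S : Set E} {f : E → F} (hf : IsPLOn f S) (A : F →ᵃ[ℝ] G) :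
    IsPLOn (fun x => A (f x)) S :=
  (isConvexPolyhedron_univ.isPolyhedral.isPLOn A).comp hf (mapsTo_univ _ _)

/-- An affine map which is injective on a convex set has an affine left inverse there. -/
theorem exists_affine_leftInvOn {C : Set E} (hC : Convex ℝ C) (A : E →ᵃ[ℝ] F)
    (hA : InjOn A C) : ∃ B : F →ᵃ[ℝ] E, LeftInvOn B A C := by
  rcases C.eq_empty_or_nonempty with rfl | ⟨x₀, hx₀⟩
  · exact ⟨AffineMap.const ℝ F 0, by simp [LeftInvOn]⟩
  -- The direction space of `C`. Convexity makes nonnegative multiples of differences closed under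
  -- addition, and injectivity of `A` on `C` makes its linear part injective on this space, so
  -- linear algebra supplies the left inverse.
  let V : Submodule ℝ E :=
    { carrier := {d | ∃ r : ℝ, 0 ≤ r ∧ ∃ x ∈ C, ∃ y ∈ C, d = r • (x - y)}
      zero_mem' := ⟨0, le_rfl, x₀, hx₀, x₀, hx₀, by simp⟩
      add_mem' := by
        rintro _ _ ⟨a, ha, x, hx, y, hy, rfl⟩ ⟨b, hb, z, hz, w, hw, rfl⟩
        rcases (add_nonneg ha hb).eq_or_lt with h | h
        · have ha0 : a = 0 := by linarith
          have hb0 : b = 0 := by linarith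
          exact ⟨0, le_rfl, x, hx, y, hy, by simp [ha0, hb0]⟩
        · have hab : a / (a + b) + b / (a + b) = 1 := by field_simp
          have h1 : (a + b) * (a / (a + b)) = a := by field_simp
          have h2 : (a + b) * (b / (a + b)) = b := by field_simp
          refine ⟨a + b, h.le, _, hC hx hz (by positivity) (by positivity) hab, _,
            hC hy hw (by positivity) (by positivity) hab, ?_⟩
          simp only [smul_sub, smul_add, smul_smul, h1, h2]
          abel
      smul_mem' := by
        rintro c _ ⟨a, ha, x, hx, y, hy, rfl⟩
        rcases le_total 0 c with hc | hc
        · exact ⟨c * a, mul_nonneg hc ha, x, hx, y, hy, by rw [smul_smul]⟩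
        · exact ⟨-c * a, mul_nonneg (neg_nonneg.2 hc) ha, y, hy, x, hx, by
            rw [← neg_sub x y, smul_neg, smul_smul, neg_mul, neg_smul, neg_neg]⟩ }
  have hker : LinearMap.ker (A.linear.domRestrict V) = ⊥ := by
    rw [LinearMap.ker_eq_bot']
    rintro ⟨_, a, ha, x, hx, y, hy, rfl⟩ h
    simp only [LinearMap.domRestrict_apply, map_smul, smul_eq_zero] at h
    rcases h with rfl | h
    · simp
    · have : A.linear (x - y) = A x - A y := by
        simpa using A.linearMap_vsub x y
      rw [this, sub_eq_zero] at h
      simp [hA hx hy h]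
  obtain ⟨B, hB⟩ := LinearMap.exists_leftInverse_of_injective _ hker
  refine ⟨((V.subtype ∘ₗ B).toAffineMap.comp
    (AffineMap.id ℝ F - AffineMap.const ℝ F (A x₀))) + AffineMap.const ℝ F x₀, fun x hx => ?_⟩
  have hxV : x - x₀ ∈ V := ⟨1, zero_le_one, x, hx, x₀, hx₀, by simp⟩
  have h1 : A x - A x₀ = A.linear.domRestrict V ⟨x - x₀, hxV⟩ := by
    simpa using (A.linearMap_vsub x x₀).symm
  have h2 := congrArg (fun L => ((L ⟨x - x₀, hxV⟩ : V) : E)) hB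
  simp only [LinearMap.comp_apply, LinearMap.id_apply, ← h1] at h2
  rw [map_sub, Submodule.coe_sub] at h2
  simp [h2]

/-- A piecewise linear bijection onto `T` has a piecewise linear inverse. -/
theorem IsPLOn.isPLHomeo [FiniteDimensional ℝ F] {S : Set E} {T : Set F} {f : E → F}
    (hf : IsPLOn f S) (h : BijOn f S T) : IsPLHomeo f S T := by
  refine ⟨hf, h.mapsTo, Function.invFunOn f S, ?_, h.surjOn.mapsTo_invFunOn, h.invOn_invFunOn⟩
  obtain ⟨𝒞, h𝒞, hS, hC⟩ := hf
  refine ⟨image f '' 𝒞, h𝒞.image _, ?_, ?_⟩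
  · rw [← h.image_eq, hS]
    ext y
    simp only [mem_image, mem_sUnion, exists_exists_and_eq_and]
    exact ⟨fun ⟨x, ⟨C, hC, hx⟩, e⟩ => ⟨C, hC, x, hx, e⟩,
      fun ⟨C, hC, x, hx, e⟩ => ⟨x, ⟨C, hC, hx⟩, e⟩⟩
  · rintro _ ⟨C, hC', rfl⟩
    obtain ⟨hCp, A, hA⟩ := hC C hC'
    have hCS : C ⊆ S := fun x hx => hS ▸ ⟨C, hC', hx⟩
    obtain ⟨B, hB⟩ := exists_affine_leftInvOn hCp.convex A
      ((h.injOn.mono hCS).congr hA)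
    refine ⟨?_, B, ?_⟩
    -- With an affine left inverse `B` the image is described by pulling back the inequalities of
    -- `C` and requiring `A (B y) = y`, so no elimination of variables is needed.
    · have : f '' C = B ⁻¹' C ∩ (A.comp B - AffineMap.id ℝ F) ⁻¹' {0} := by
        ext y
        simp only [mem_image, mem_inter_iff, mem_preimage, mem_singleton_iff]
        constructor
        · rintro ⟨x, hx, rfl⟩
          rw [hA hx, hB hx]
          exact ⟨hx, by simp [hB hx]⟩
        · rintro ⟨h1, h2⟩
          exact ⟨B y, h1, by rw [hA h1]; simpa [sub_eq_zero] using h2⟩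
      rw [this]
      refine (hCp.preimage B).inter (IsConvexPolyhedron.preimage ?_ _)
      let b := Module.finBasis ℝ F
      have h0 : ({0} : Set F) = {y | ∀ i, b.coord i y = (0 : F →ₗ[ℝ] ℝ) y} := by
        ext y
        simp only [mem_singleton_iff, mem_ofPred_eq, LinearMap.zero_apply]
        exact (b.forall_coord_eq_zero_iff).symm
      rw [h0]
      exact IsConvexPolyhedron.forall fun i =>
        isConvexPolyhedron_eq (b.coord i).isLinear (0 : F →ₗ[ℝ] ℝ).isLinear
    · rintro _ ⟨x, hx, rfl⟩
      rw [h.injOn.leftInvOn_invFunOn (hCS hx), hA hx, hB hx]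

end PLTheory

/-- Local flatness at a point follows from a piecewise linear chart with values in an orthant. -/
theorem exists_flat_chart {E : Type*} [NormedAddCommGroup E] [NormedSpace ℝ E]
    [FiniteDimensional ℝ E] {q : ℕ} {X Y W : Set E} {B : Set (Fin q)} {f : E → Fin q → ℝ} {p : E}
    (hp : p ∈ X) (hf : IsPLOn f W) (hbij : BijOn f W {z | ∀ i ∈ B, -1 ≤ z i})
    (h1 : ∀ i, f p i < 1) (h2 : ∀ i, i ∉ B → -1 < f p i)
    (hX : ∀ᶠ x in 𝓝 p, x ∈ X ↔ x ∈ W)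
    (hY : ∀ᶠ x in 𝓝 p, x ∈ W → (x ∈ Y ↔ ∀ i : Fin q, i.val < 2 → f x i = 0)) :
    ∃ (N : Set E) (N' : Set (Fin q → ℝ)) (f : E → (Fin q → ℝ)),
    N ⊆ X ∧ N ∈ 𝓝[X] p ∧ N' ⊆ stdCube q ∧ N' ∈ 𝓝[stdCube q] (f p) ∧
    IsPLHomeo f N N' ∧ f '' (N ∩ Y) = N' ∩ stdSubcube q := by
  obtain ⟨-, -, g, hg, hgm, hgf⟩ := hf.isPLHomeo hbij
  have hpW : p ∈ W := hX.self_of_nhds.1 hp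
  set Z : Set (Fin q → ℝ) := {z | ∀ i ∈ B, -1 ≤ z i} with hZ
  -- Continuity of the PL inverse transfers what holds near `p` to a neighbourhood of `f p` in the
  -- orthant.
  have e1 : ∀ᶠ z in 𝓝[Z] (f p), g z ∈ {x | (x ∈ X ↔ x ∈ W) ∧
      (x ∈ W → (x ∈ Y ↔ ∀ i : Fin q, i.val < 2 → f x i = 0))} := by
    have := hg.continuousOn (f p) (hbij.mapsTo hpW)
    rw [ContinuousWithinAt, hgf.1 hpW] at this
    exact this (hX.and hY)
  have e2 : ∀ᶠ z in 𝓝 (f p), ∀ i, z i < 1 ∧ (i ∉ B → -1 < z i) := by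
    rw [eventually_all]
    intro i
    have hc : Tendsto (fun z : Fin q → ℝ => z i) (𝓝 (f p)) (𝓝 (f p i)) :=
      (continuous_apply i).continuousAt
    refine (hc.eventually (gt_mem_nhds (h1 i))).and ?_
    by_cases hi : i ∈ B
    · simp [hi]
    · filter_upwards [hc.eventually (lt_mem_nhds (h2 i hi))] with z hz _ using hz
  obtain ⟨ε, hε, hball⟩ := Metric.nhds_basis_closedBall.mem_iff.1
    ((eventually_nhdsWithin_iff.1 e1).and e2)
  -- Balls of the sup norm are cubes, so cutting down to one keeps everything piecewise linear.
  have hpoly : IsPolyhedral (Metric.closedBall (f p) ε) := by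
    have : Metric.closedBall (f p) ε = {z | ∀ i, z i ≤ f p i + ε ∧ -z i ≤ ε - f p i} := by
      ext z
      rw [Metric.mem_closedBall, dist_pi_le_iff hε.le]
      refine forall_congr' fun i => ?_
      rw [Real.dist_eq, abs_le]
      constructor <;> rintro ⟨_, _⟩ <;> constructor <;> linarith
    rw [this]
    exact (IsConvexPolyhedron.forall fun i =>
      (isConvexPolyhedron_le_const (LinearMap.proj (φ := fun _ => ℝ) i).isLinear _).and
      (isConvexPolyhedron_le_const (-LinearMap.proj (φ := fun _ => ℝ) i).isLinear _)).isPolyhedral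
  have hNX : ∀ x ∈ W ∩ f ⁻¹' Metric.closedBall (f p) ε, x ∈ X ∧
      (x ∈ Y ↔ ∀ i : Fin q, i.val < 2 → f x i = 0) := fun x hx => by
    have := (hball hx.2).1 (hbij.mapsTo hx.1)
    rw [hgf.1 hx.1] at this
    exact ⟨this.1.2 hx.1, this.2 hx.1⟩
  have hN' : Z ∩ Metric.closedBall (f p) ε ⊆ stdCube q := fun z hz i => by
    obtain ⟨ha, hb⟩ := (hball hz.2).2 i
    exact ⟨(em (i ∈ B)).elim (hz.1 i) fun hi => (hb hi).le, ha.le⟩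
  refine ⟨W ∩ f ⁻¹' Metric.closedBall (f p) ε, Z ∩ Metric.closedBall (f p) ε, f,
    fun x hx => (hNX x hx).1, ?_, hN', ?_, ?_, ?_⟩
  · have hXW : 𝓝[X] p = 𝓝[W] p := nhdsWithin_eq_iff_eventuallyEq.2
      (hX.mono fun x hx => propext hx)
    rw [hXW]
    exact inter_mem self_mem_nhdsWithin
      (hf.continuousOn p hpW (Metric.closedBall_mem_nhds _ hε))
  · filter_upwards [self_mem_nhdsWithin,
      mem_nhdsWithin_of_mem_nhds (Metric.closedBall_mem_nhds (f p) hε)] with z h1 h2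
    exact ⟨fun i _ => (h1 i).1, h2⟩
  · refine (hf.inter_preimage hpoly).isPLHomeo ⟨fun x hx => ⟨hbij.mapsTo hx.1, hx.2⟩,
      hbij.injOn.mono inter_subset_left, ?_⟩
    rintro z ⟨hz, hz'⟩
    obtain ⟨x, hx, rfl⟩ := hbij.surjOn hz
    exact ⟨x, ⟨hx, hz'⟩, rfl⟩
  · ext z
    constructor
    · rintro ⟨x, ⟨hx, hxY⟩, rfl⟩
      have hz : f x ∈ Z ∩ Metric.closedBall (f p) ε := ⟨hbij.mapsTo hx.1, hx.2⟩
      exact ⟨hz, hN' hz, (hNX x hx).2.1 hxY⟩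
    · rintro ⟨⟨hz, hz'⟩, -, h0⟩
      obtain ⟨x, hx, rfl⟩ := hbij.surjOn hz
      exact ⟨x, ⟨⟨hx, hz'⟩, (hNX x ⟨hx, hz'⟩).2.2 h0⟩, rfl⟩

/-! ### Coamoebas and half circles -/

/-- The points of the circle with arguments `θ i`, `i ∈ I`, lie in no open half circle. -/
def Surrounds {ι : Type*} (I : Finset ι) (θ : ι → ℝ) : Prop :=
  ∀ φ : ℝ, ∃ i ∈ I, Real.cos (θ i - φ) ≤ 0

theorem Surrounds.mono {ι : Type*} {I I' : Finset ι} {θ : ι → ℝ} (h : Surrounds I θ)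
    (hI : I ⊆ I') : Surrounds I' θ := fun φ =>
  let ⟨i, hi, h⟩ := h φ
  ⟨i, hI hi, h⟩

/-- Otherwise Hahn–Banach separates `0` strictly from the compact convex hull of the `e i`, giving a
functional positive on all of them. -/
theorem exists_convex_combination_eq_zero {ι : Type*} [Fintype ι] (e : ι → ℂ)
    (h : ∀ f : StrongDual ℝ ℂ, ∃ i, f (e i) ≤ 0) :
    ∃ c ∈ stdSimplex ℝ ι, ∑ i, c i • e i = 0 := by
  classical
  let L : (ι → ℝ) →ₗ[ℝ] ℂ := ∑ i, (LinearMap.proj i : (ι → ℝ) →ₗ[ℝ] ℝ).smulRight (e i)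
  have hL : ∀ c, L c = ∑ i, c i • e i := fun c => by simp [L]
  by_contra hcon
  have h0 : (0 : ℂ) ∉ L '' stdSimplex ℝ ι := by
    rintro ⟨c, hc, h⟩
    exact hcon ⟨c, hc, by rw [← hL, h]⟩
  obtain ⟨f, u, hu, hf⟩ := geometric_hahn_banach_point_closed
    ((convex_stdSimplex ℝ ι).linear_image L)
    ((isCompact_stdSimplex ℝ ι).image (LinearMap.continuous_of_finiteDimensional L)).isClosed h0
  obtain ⟨i, hi⟩ := h f
  have := hf (e i) ⟨Pi.single i 1, single_mem_stdSimplex ℝ i, by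
    rw [hL, Finset.sum_eq_single i] <;> simp +contextual⟩
  rw [map_zero] at hu
  linarith

/-- Polar form of a real functional on the plane; it translates half planes into half circles
centred at `φ`. -/
theorem exists_dual_eq_cos (f : StrongDual ℝ ℂ) :
    ∃ r φ : ℝ, 0 ≤ r ∧ ∀ θ : ℝ,
      f (Complex.cos θ + Complex.sin θ * Complex.I) = r * Real.cos (θ - φ) := by
  set c : ℂ := ⟨f 1, f Complex.I⟩ with hc
  refine ⟨‖c‖, c.arg, norm_nonneg _, fun θ => ?_⟩
  have h1 : ‖c‖ * Real.cos c.arg = f 1 := by rw [Complex.norm_mul_cos_arg]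
  have h2 : ‖c‖ * Real.sin c.arg = f Complex.I := by rw [Complex.norm_mul_sin_arg]
  have h3 : (Complex.cos θ + Complex.sin θ * Complex.I : ℂ) =
      Real.cos θ • (1 : ℂ) + Real.sin θ • Complex.I := by
    simp
  rw [h3, map_add, map_smul, map_smul, ← h1, ← h2, Real.cos_sub, smul_eq_mul, smul_eq_mul]
  ring

theorem continuous_torusMk {n : ℕ} : Continuous (Torus.mk : (Fin (n + 1) → Real.Angle) → Torus n) :=
  continuous_quot_mk

/-- A point lies in the partial coamoeba of `I` if and only if its arguments over `I` lie in no
open half circle. -/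
theorem mem_partialCoamoeba_iff {n : ℕ} {I : Finset (Fin (n + 1))} (hI : I.Nonempty)
    (θ : Fin (n + 1) → ℝ) :
    (Torus.mk fun i => (θ i : Real.Angle)) ∈ partialCoamoeba I ↔ Surrounds I θ := by
  classical
  constructor
  · intro h
    let S : Set (Fin (n + 1) → Real.Angle) :=
      {t | ∀ φ : ℝ, ∃ i ∈ I, Real.Angle.cos (t i - (φ : Real.Angle)) ≤ 0}
    have hS : IsClosed S := by
      have : S = ⋂ φ : ℝ, ⋃ i ∈ I, {t | Real.Angle.cos (t i - (φ : Real.Angle)) ≤ 0} := by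
        ext; simp [S]
      rw [this]
      refine isClosed_iInter fun φ => isClosed_biUnion_finset fun i _ => ?_
      exact isClosed_le (Real.Angle.continuous_cos.comp
        ((continuous_apply i).sub continuous_const)) continuous_const
    -- The quotient map is open, so the closure may be taken upstairs, where the half circle
    -- condition is visibly closed. It then suffices to treat arguments of an actual zero of the
    -- linear form.
    have h' : (fun i => (θ i : Real.Angle)) ∈ closure ((Torus.mk (n := n)) ⁻¹'
        {θ | ∃ z : Fin (n + 1) → ℂ, (∀ i, z i ≠ 0) ∧ ∑ i ∈ I, z i = 0 ∧
          θ = Torus.mk fun i => ((z i).arg : Real.Angle)}) := by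
      have hopen : IsOpenMap (Torus.mk : (Fin (n + 1) → Real.Angle) → Torus n) :=
        QuotientAddGroup.isOpenMap_coe
      rw [← hopen.preimage_closure_eq_closure_preimage continuous_torusMk]
      exact h
    have hmem := closure_minimal (fun t ht => ?_) hS h'
    · intro φ
      obtain ⟨i, hi, h⟩ := hmem φ
      refine ⟨i, hi, ?_⟩
      rwa [← Real.Angle.coe_sub, Real.Angle.cos_coe] at h
    · obtain ⟨z, hz, hsum, hzt⟩ := ht
      intro φ
      obtain ⟨a, ha⟩ := (QuotientAddGroup.eq.1 hzt : _ ∈ diagCircle n)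
      induction a using Real.Angle.induction_on with
      | _ a =>
      have hti : ∀ i, t i = ((z i).arg - a : ℝ) := fun i => by
        have := congrFun ha i
        simp only [Pi.constAddMonoidHom_apply, Function.const_apply, Pi.add_apply, Pi.neg_apply]
          at this
        rw [Real.Angle.coe_sub, this]
        abel
      by_contra hcon
      push Not at hcon
      -- This is the real part of the vanishing sum after rotation by `-(a + φ)`; in an open half
      -- circle every term would be positive.
      have hre : ∑ i ∈ I, ‖z i‖ * Real.cos ((z i).arg - (a + φ)) = 0 := by
        have h1 : ∀ i, ‖z i‖ * Real.cos ((z i).arg - (a + φ)) =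
            (z i).re * Real.cos (a + φ) + (z i).im * Real.sin (a + φ) := fun i => by
          rw [Real.cos_sub]
          linear_combination Real.cos (a + φ) * Complex.norm_mul_cos_arg (z i) +
            Real.sin (a + φ) * Complex.norm_mul_sin_arg (z i)
        simp only [h1, Finset.sum_add_distrib, ← Finset.sum_mul, ← Complex.re_sum,
          ← Complex.im_sum, hsum]
        simp
      refine hre.not_gt (Finset.sum_pos (fun i hi => mul_pos (norm_pos_iff.2 (hz i)) ?_) hI)
      have := hcon i hi
      rwa [hti, ← Real.Angle.coe_sub, Real.Angle.cos_coe, sub_sub] at this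
  · intro h
    let e : Fin (n + 1) → ℂ := fun i => Complex.cos (θ i) + Complex.sin (θ i) * Complex.I
    have he : ∀ i, e i ≠ 0 := fun i h0 => by
      have := congrArg (fun w : ℂ => ‖w‖) h0
      simp [e, Complex.norm_cos_add_sin_mul_I] at this
    have harg : ∀ i, ((e i).arg : Real.Angle) = θ i := fun i => by
      have := Complex.arg_cos_add_sin_mul_I_coe_angle (θ i : Real.Angle)
      rw [Real.Angle.cos_coe, Real.Angle.sin_coe] at this
      simpa [e] using this
    obtain ⟨c', ⟨hc0, hc1⟩, hsum⟩ := exists_convex_combination_eq_zero (fun i : I => e i)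
      fun f => by
        obtain ⟨r, φ, hr, hf⟩ := exists_dual_eq_cos f
        obtain ⟨i, hi, hcos⟩ := h φ
        exact ⟨⟨i, hi⟩, by
          simp only [e, hf]
          exact mul_nonpos_of_nonneg_of_nonpos hr hcos⟩
    let c : Fin (n + 1) → ℝ := fun i => if hi : i ∈ I then c' ⟨i, hi⟩ else 0
    have hcc : ∀ i : I, c i = c' i := fun i => by simp [c]
    have hc0' : ∀ i, 0 ≤ c i := fun i => by
      by_cases hi : i ∈ I
      · simpa [c, hi] using hc0 ⟨i, hi⟩
      · simp [c, hi]
    have hc1' : ∑ i ∈ I, c i = 1 := by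
      rw [← Finset.sum_coe_sort]; simpa only [hcc] using hc1
    have hsum' : ∑ i ∈ I, c i • e i = 0 := by
      rw [← Finset.sum_coe_sort]; simpa only [hcc] using hsum
    set P := I.filter fun i => c i ≠ 0 with hP
    set R : ℂ := ∑ i ∈ I.filter (fun i => ¬ c i ≠ 0), e i with hR
    have hPne : P.Nonempty := by
      rw [Finset.nonempty_iff_ne_empty]
      intro h0
      have : ∑ i ∈ I, c i = 0 := Finset.sum_eq_zero fun i hi => by
        by_contra hne
        have : i ∈ P := Finset.mem_filter.2 ⟨hi, hne⟩
        simp [h0] at this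
      linarith
    -- The convex combination may have zero coefficients, whereas a point of the hypersurface needs
    -- all coordinates nonzero. Give the missing vectors the weight `δ` and spread the compensation
    -- `-δ R` evenly over the others; as `δ` tends to `0` the arguments converge to `θ`.
    let z : ℝ → Fin (n + 1) → ℂ := fun δ i =>
      if i ∈ P then c i • e i - δ • ((P.card : ℝ)⁻¹ • R) else
        if i ∈ I then δ • e i else e i
    have hzP : ∀ i ∈ P, Tendsto (fun δ => z δ i) (𝓝[>] 0) (𝓝 (c i • e i)) := fun i hi => by
      have : Continuous fun δ : ℝ => c i • e i - δ • ((P.card : ℝ)⁻¹ • R) := by fun_prop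
      have := (this.tendsto 0).mono_left (nhdsWithin_le_nhds (s := Ioi 0))
      simpa [z, hi] using this
    have hne : ∀ i ∈ P, c i • e i ≠ 0 := fun i hi =>
      smul_ne_zero (Finset.mem_filter.1 hi).2 (he i)
    refine mem_closure_of_tendsto (f := fun δ : ℝ => Torus.mk fun i => ((z δ i).arg : Real.Angle))
      (b := 𝓝[>] 0) ?_ ?_
    · refine (continuous_torusMk.tendsto _).comp (tendsto_pi_nhds.2 fun i => ?_)
      by_cases hi : i ∈ P
      · have h1 : ((c i • e i).arg : Real.Angle) = θ i := by
          rw [← harg, Complex.real_smul, Complex.arg_real_mul _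
            (lt_of_le_of_ne (hc0' i) (Finset.mem_filter.1 hi).2.symm)]
        rw [← h1]
        exact (Complex.continuousAt_arg_coe_angle (hne i hi)).tendsto.comp (hzP i hi)
      · refine tendsto_const_nhds.congr' ?_
        filter_upwards [self_mem_nhdsWithin] with δ (hδ : 0 < δ)
        by_cases hiI : i ∈ I
        · simp only [z, hi, hiI, if_true, if_false]
          rw [Complex.real_smul, Complex.arg_real_mul _ hδ, harg]
        · simp only [z, hi, hiI, if_false, harg]
    · have hev : ∀ᶠ δ in 𝓝[>] (0 : ℝ), ∀ i, i ∈ P → z δ i ≠ 0 := by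
        rw [eventually_all]
        intro i
        by_cases hi : i ∈ P
        · filter_upwards [(hzP i hi).eventually_ne (hne i hi)] with δ h _ using h
        · simp [hi]
      filter_upwards [hev, self_mem_nhdsWithin] with δ hδ (hδ0 : 0 < δ)
      refine ⟨z δ, fun i => ?_, ?_, rfl⟩
      · by_cases hi : i ∈ P
        · exact hδ i hi
        · by_cases hiI : i ∈ I
          · simpa [z, hi, hiI, hδ0.ne'] using he i
          · simpa [z, hi, hiI] using he i
      · have hsplit := Finset.sum_filter_add_sum_filter_not I (fun i => c i ≠ 0) (fun i => c i • e i)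
        have h0 : ∑ i ∈ I.filter (fun i => ¬ c i ≠ 0), c i • e i = 0 :=
          Finset.sum_eq_zero fun i hi => by
            have := (Finset.mem_filter.1 hi).2
            push Not at this
            simp [this]
        rw [h0, add_zero, hsum'] at hsplit
        rw [← Finset.sum_filter_add_sum_filter_not I (fun i => c i ≠ 0)]
        have h1 : ∑ i ∈ I.filter (fun i => c i ≠ 0), z δ i =
            ∑ i ∈ P, (c i • e i - δ • ((P.card : ℝ)⁻¹ • R)) :=
          Finset.sum_congr rfl fun i hi => by
            have : i ∈ P := hi
            simp only [z, this, if_true]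
        have h2 : ∑ i ∈ I.filter (fun i => ¬ c i ≠ 0), z δ i = δ • R := by
          rw [hR, Finset.smul_sum]
          refine Finset.sum_congr rfl fun i hi => ?_
          have h3 := Finset.mem_filter.1 hi
          have h4 : i ∉ P := fun h => h3.2 (Finset.mem_filter.1 h).2
          simp only [z, h4, h3.1, if_true, if_false]
        have hcard : (P.card : ℝ) ≠ 0 := by exact_mod_cast hPne.card_pos.ne'
        rw [h1, h2, Finset.sum_sub_distrib, hsplit, Finset.sum_const, ← Nat.cast_smul_eq_nsmul ℝ,
          smul_smul, smul_smul, mul_right_comm, mul_inv_cancel₀ hcard]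
        simp

/-- Points whose arguments have lifts at pairwise distance less than `π` lie in an open half
circle. -/
theorem not_surrounds_of_lift {ι : Type*} {I : Finset ι} {θ l : ι → ℝ} (m : ι → ℤ)
    (hl : ∀ i ∈ I, l i = θ i + m i * (2 * Real.pi))
    (h : ∀ i ∈ I, ∀ j ∈ I, l i - l j < Real.pi) : ¬ Surrounds I θ := by
  rcases I.eq_empty_or_nonempty with rfl | hI
  · intro h
    obtain ⟨i, hi, -⟩ := h 0
    simp at hi
  obtain ⟨a, ha, hmax⟩ := I.exists_max_image l hI
  obtain ⟨b, hb, hmin⟩ := I.exists_min_image l hI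
  intro hs
  -- The half circle centred midway between the extreme lifts contains all the points.
  obtain ⟨i, hi, hcos⟩ := hs ((l a + l b) / 2)
  have h1 := hmax i hi
  have h2 := hmin i hi
  have h3 := h a ha b hb
  have h4 : 0 < Real.cos (l i - (l a + l b) / 2) :=
    Real.cos_pos_of_mem_Ioo ⟨by linarith, by linarith⟩
  rw [hl i hi, add_sub_right_comm, Real.cos_add_int_mul_two_pi] at h4
  linarith

theorem exists_int_abs_lt_of_cos_pos {x : ℝ} (h : 0 < Real.cos x) :
    ∃ m : ℤ, |x - m * (2 * Real.pi)| < Real.pi / 2 := by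
  have hpi := Real.pi_pos
  refine ⟨round (x / (2 * Real.pi)), ?_⟩
  set m := round (x / (2 * Real.pi))
  have h1 : |x - m * (2 * Real.pi)| ≤ Real.pi := by
    have h2 := abs_sub_round (x / (2 * Real.pi))
    have h3 : x - m * (2 * Real.pi) = (x / (2 * Real.pi) - m) * (2 * Real.pi) := by
      field_simp
    rw [h3, abs_mul, abs_of_pos (by positivity : 0 < 2 * Real.pi)]
    nlinarith
  by_contra hcon
  have h4 := Real.cos_nonpos_of_pi_div_two_le_of_le (not_lt.1 hcon) (by linarith)
  rw [Real.cos_abs, Real.cos_sub_int_mul_two_pi] at h4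
  linarith

/-- The half circle criterion for points lying in two arcs `U` and `Uᶜ` shorter than `π`. -/
theorem surrounds_iff_of_two_arcs {ι : Type*} {I : Finset ι} {U : Set ι} {θ l : ι → ℝ} (m : ι → ℤ)
    (hl : ∀ i, l i = θ i + m i * (2 * Real.pi))
    (hU : ∀ i ∈ U, ∀ j ∈ U, l i - l j < Real.pi)
    (hU' : ∀ i ∉ U, ∀ j ∉ U, l i - l j < Real.pi)
    (hle : ∀ i ∈ U, ∀ j ∉ U, l i ≤ l j) (hge : ∀ i ∈ U, ∀ j ∉ U, l j ≤ l i + 2 * Real.pi) :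
    Surrounds I θ ↔ (∃ i ∈ I, i ∈ U ∧ ∃ j ∈ I, j ∉ U ∧ Real.pi ≤ l j - l i) ∧
      (∃ i ∈ I, i ∈ U ∧ ∃ j ∈ I, j ∉ U ∧ l j - l i ≤ Real.pi) := by
  classical
  have hpi := Real.pi_pos
  constructor
  · intro hs
    constructor
    -- If every angle from `U` to its complement is below `π`, all the given lifts are within `π` of
    -- each other.
    · by_contra hcon
      push Not at hcon
      refine not_surrounds_of_lift m (fun i _ => hl i) (fun i hi j hj => ?_) hs
      by_cases hiU : i ∈ U <;> by_cases hjU : j ∈ U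
      · exact hU i hiU j hjU
      · linarith [hle i hiU j hjU]
      · exact hcon j hj hjU i hi hiU
      · exact hU' i hiU j hjU
    -- If every such angle exceeds `π`, raise the lifts over `U` by a full turn: the angles seen
    -- from the other side are then below `π`.
    · by_contra hcon
      push Not at hcon
      refine not_surrounds_of_lift (l := fun i => if i ∈ U then l i + 2 * Real.pi else l i)
        (fun i => if i ∈ U then m i + 1 else m i) (fun i _ => ?_) (fun i hi j hj => ?_) hs
      · by_cases hiU : i ∈ U
        · simp only [hiU, if_true, hl, Int.cast_add, Int.cast_one]; ring
        · simp only [hiU, if_false, hl]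
      · by_cases hiU : i ∈ U <;> by_cases hjU : j ∈ U <;> simp only [hiU, hjU, if_true, if_false]
        · linarith [hU i hiU j hjU]
        · linarith [hcon i hi hiU j hj hjU]
        · linarith [hge j hjU i hiU]
        · exact hU' i hiU j hjU
  · rintro ⟨⟨i, hi, hiU, j, hj, hjU, hij⟩, i', hi', hiU', j', hj', hjU', hij'⟩ φ
    by_contra hcon
    push Not at hcon
    have key : ∀ a ∈ I, ∃ m : ℤ, |l a - φ - m * (2 * Real.pi)| < Real.pi / 2 := fun a ha => by
      refine exists_int_abs_lt_of_cos_pos ?_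
      rw [hl, add_sub_right_comm, Real.cos_add_int_mul_two_pi]
      exact hcon a ha
    -- In an open half circle about `φ` each point has a well-defined turn number. The inequalities
    -- on the lifts give `q ≤ q' ≤ p' ≤ p`, while an angle of at least `π` from `i` to `j` forces `p
    -- < q`.
    have hsame : ∀ {a b : ℝ} {p q : ℤ}, |a - φ - p * (2 * Real.pi)| < Real.pi / 2 →
        |b - φ - q * (2 * Real.pi)| < Real.pi / 2 → a - b ≤ Real.pi → p ≤ q := by
      intro a b p q hp hq hab
      rw [abs_lt] at hp hq
      have h1 : (p : ℝ) < q + 1 := by nlinarith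
      exact Int.lt_add_one_iff.1 (by exact_mod_cast h1)
    obtain ⟨p, hp⟩ := key i hi
    obtain ⟨q, hq⟩ := key j hj
    obtain ⟨p', hp'⟩ := key i' hi'
    obtain ⟨q', hq'⟩ := key j' hj'
    have h1 := hsame hp' hp (hU _ hiU' _ hiU).le
    have h2 := hsame hq hq' (hU' _ hjU _ hjU').le
    have h3 := hsame hq' hp' hij'
    rw [abs_lt] at hp hq
    have h4 : (p : ℝ) < q := by nlinarith
    have h4' : p < q := by exact_mod_cast h4
    omega

/-- The indices in `K` at which `x` attains its maximum over `K`. -/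
def topSet {ι : Type*} (K : Finset ι) (x : ι → ℝ) : Finset ι :=
  open Classical in K.filter fun i => ∀ j ∈ K, x j ≤ x i

theorem mem_topSet {ι : Type*} {K : Finset ι} {x : ι → ℝ} {i : ι} :
    i ∈ topSet K x ↔ i ∈ K ∧ ∀ j ∈ K, x j ≤ x i := by
  simp [topSet]

/-- The argument of the part containing `i`, as a function of the gaps. -/
def CyclicPartition.angle {n k : ℕ} (σ : CyclicPartition n k) (α : Fin k → ℝ)
    (i : Fin (n + 1)) : ℝ :=
  ∑ r ∈ Finset.univ.filter (fun r => r < σ.part i), α r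

/-- Any `I` whose spine face contains `x` consists of maximal coordinates, and surrounding passes to
larger sets; hence the full set of maximal coordinates is the only `I` that needs testing. -/
theorem mem_pantsCell_iff {n k : ℕ} {σ : CyclicPartition n k} {J : Finset (Fin (n + 1))}
    {x : Fin (n + 1) → ℝ} {α : Fin k → ℝ} :
    (x, α) ∈ pantsCell σ J ↔
      (x, α) ∈ ambientCell k J ∧ Surrounds (topSet Finset.univ x) (σ.angle α) := by
  refine and_congr_right fun hx => ?_
  simp only [phaseTropicalPants, mem_iUnion, mem_prod]
  constructor
  · rintro ⟨I, J', hIJ, hI, ⟨hxs, h1, h2, h3⟩, hc⟩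
    have hIne : I.Nonempty := Finset.card_pos.1 (by omega)
    refine ((mem_partialCoamoeba_iff hIne _).1 hc).mono fun i hi => ?_
    refine mem_topSet.2 ⟨Finset.mem_univ _, fun j _ => ?_⟩
    by_cases hj : j ∈ I
    · exact (h1 j hj i hi).le
    · exact h2 i hi j hj
  · intro h
    have hne : (topSet Finset.univ x).Nonempty := let ⟨i, hi, _⟩ := h 0; ⟨i, hi⟩
    refine ⟨topSet Finset.univ x, J, fun i hi => ?_, ?_, ⟨hx.1.1, fun i hi j hj => ?_,
      fun i hi j _ => (mem_topSet.1 hi).2 j (Finset.mem_univ _), hx.1.2⟩,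
      (mem_partialCoamoeba_iff hne _).2 h⟩
    · by_contra hiJ
      have h0 := hx.1.2 i hiJ
      have h1 : ∑ j, x j ≤ 0 := Finset.sum_nonpos fun j hj => by
        rw [← h0]; exact (mem_topSet.1 hi).2 j hj
      linarith [hx.1.1.2]
    -- A single point lies in the open half circle centred at itself, so at least two indices are
    -- maximal.
    · by_contra hcard
      obtain ⟨i, hi⟩ := hne
      obtain ⟨j, hj, hcos⟩ := h (σ.angle α i)
      rw [Finset.card_le_one.1 (by omega) j hj i hi] at hcos
      simp at hcos
      linarith
    · exact le_antisymm ((mem_topSet.1 hj).2 i (Finset.mem_univ _))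
        ((mem_topSet.1 hi).2 j (Finset.mem_univ _))

/-! ### Local fans -/

section LocalFans

variable {n k : ℕ}

/-- The local fan of `Δ_J` at the barycenter of `Δ_K`. -/
def fanSimplex (J K : Finset (Fin (n + 1))) : Set (Fin (n + 1) → ℝ) :=
  {ξ | ∑ i, ξ i = 0 ∧ (∀ j, j ∉ K → 0 ≤ ξ j) ∧ ∀ j, j ∉ J → ξ j = 0}

/-- The local fan of `Δ_σ` at a point in the interior of the edge `s t`. -/
def gapFan (s t : Fin k) : Set (Fin k → ℝ) :=
  {β | ∑ r, β r = 0 ∧ ∀ r, r ≠ s → r ≠ t → 0 ≤ β r}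

/-- The local fan of `𝒫_{σ,J}` at the vertex `(baryc K, chordVertex s t)`, in coordinates. -/
def pantsCone (σ : CyclicPartition n k) (J K : Finset (Fin (n + 1))) (s t : Fin k) :
    Set ((Fin (n + 1) → ℝ) × (Fin k → ℝ)) :=
  {y | y ∈ fanSimplex J K ×ˢ gapFan s t ∧
    (∃ i ∈ topSet K y.1, i ∈ upperSide σ s t ∧ ∃ j ∈ topSet K y.1, j ∉ upperSide σ s t ∧
      0 ≤ σ.angle y.2 j - σ.angle y.2 i) ∧
    (∃ i ∈ topSet K y.1, i ∈ upperSide σ s t ∧ ∃ j ∈ topSet K y.1, j ∉ upperSide σ s t ∧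
      σ.angle y.2 j - σ.angle y.2 i ≤ 0)}

theorem mem_upperSide {σ : CyclicPartition n k} {s t : Fin k} {i : Fin (n + 1)} :
    i ∈ upperSide σ s t ↔ s < σ.part i ∧ σ.part i ≤ t := by
  simp [upperSide]

theorem CyclicPartition.angle_add (σ : CyclicPartition n k) (α β : Fin k → ℝ) (i : Fin (n + 1)) :
    σ.angle (α + β) i = σ.angle α i + σ.angle β i := by
  simp [CyclicPartition.angle, Finset.sum_add_distrib]

theorem CyclicPartition.angle_smul (σ : CyclicPartition n k) (c : ℝ) (β : Fin k → ℝ)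
    (i : Fin (n + 1)) : σ.angle (c • β) i = c * σ.angle β i := by
  simp [CyclicPartition.angle, Finset.mul_sum]

theorem CyclicPartition.isLinearMap_angle (σ : CyclicPartition n k) (i : Fin (n + 1)) :
    IsLinearMap ℝ fun β => σ.angle β i :=
  ⟨fun α β => σ.angle_add α β i, fun c β => σ.angle_smul c β i⟩

theorem CyclicPartition.angle_sub (σ : CyclicPartition n k) (α β : Fin k → ℝ) (i : Fin (n + 1)) :
    σ.angle (α - β) i = σ.angle α i - σ.angle β i :=
  (σ.isLinearMap_angle i).map_sub α β

theorem CyclicPartition.angle_single (σ : CyclicPartition n k) (s : Fin k) (a : ℝ)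
    (i : Fin (n + 1)) : σ.angle (Pi.single s a) i = if s < σ.part i then a else 0 := by
  simp [CyclicPartition.angle]

theorem CyclicPartition.angle_eq_sum (σ : CyclicPartition n k) (α : Fin k → ℝ)
    (i : Fin (n + 1)) : σ.angle α i = ∑ r, if r < σ.part i then α r else 0 := by
  rw [CyclicPartition.angle, Finset.sum_filter]

theorem chordVertex_eq {s t : Fin k} (hst : s < t) :
    chordVertex s t = Pi.single s Real.pi + Pi.single t Real.pi := by
  ext r
  by_cases hs : r = s
  · subst hs; simp [chordVertex, hst.ne]
  · by_cases ht : r = t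
    · subst ht; simp [chordVertex, hst.ne']
    · simp [chordVertex, hs, ht]

theorem sum_chordVertex {s t : Fin k} (hst : s < t) :
    ∑ r, chordVertex s t r = 2 * Real.pi := by
  rw [chordVertex_eq hst]
  simp [Finset.sum_add_distrib]
  ring

theorem sum_edgeVector (s t : Fin k) : ∑ r, edgeVector s t r = 0 := by
  simp [edgeVector, Finset.sum_sub_distrib]

theorem angle_edgeVector_sub {σ : CyclicPartition n k} {s t : Fin k} {i j : Fin (n + 1)}
    (hst : s < t) (hi : i ∈ upperSide σ s t) (hj : j ∉ upperSide σ s t) :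
    σ.angle (edgeVector s t) j - σ.angle (edgeVector s t) i = -1 := by
  rw [mem_upperSide] at hi hj
  rw [edgeVector, σ.angle_sub, σ.angle_sub]
  simp only [σ.angle_single]
  split_ifs <;> first | (exfalso; omega) | norm_num

/-- At the midpoint of the edge the two sides collapse to antipodal points. The extra full turn for
the parts up to `s` comes from cutting the circle at `s`. -/
theorem angle_chordVertex_sub {σ : CyclicPartition n k} {s t : Fin k} {i j : Fin (n + 1)}
    (hst : s < t) (hi : i ∈ upperSide σ s t) (hj : j ∉ upperSide σ s t) :
    (σ.angle (chordVertex s t) j + if σ.part j ≤ s then 2 * Real.pi else 0) -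
      σ.angle (chordVertex s t) i = Real.pi := by
  rw [mem_upperSide] at hi hj
  rw [chordVertex_eq hst, σ.angle_add, σ.angle_add]
  simp only [σ.angle_single]
  split_ifs <;> first | (exfalso; omega) | ring

/-- In the star of the vertex `chordVertex s t`, the half circle criterion is a pair of linear
inequalities. -/
theorem surrounds_angle_iff {σ : CyclicPartition n k} {s t : Fin k} (hst : s < t)
    {α : Fin k → ℝ} (hα : α ∈ gapSimplex k)
    (h1 : (∑ r, if s < r ∧ r < t then α r else 0) < Real.pi)
    (h2 : (∑ r, if r < s ∨ t < r then α r else 0) < Real.pi) (I : Finset (Fin (n + 1))) :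
    Surrounds I (σ.angle α) ↔
      (∃ i ∈ I, i ∈ upperSide σ s t ∧ ∃ j ∈ I, j ∉ upperSide σ s t ∧
        0 ≤ σ.angle (α - chordVertex s t) j - σ.angle (α - chordVertex s t) i) ∧
      (∃ i ∈ I, i ∈ upperSide σ s t ∧ ∃ j ∈ I, j ∉ upperSide σ s t ∧
        σ.angle (α - chordVertex s t) j - σ.angle (α - chordVertex s t) i ≤ 0) := by
  -- Lifts of the arguments to the circle cut open at the gap `s`: first the arc of `I_+`, then that
  -- of `I_-`. Writing the full turn as the sum of all gaps lets every comparison of lifts be made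
  -- gap by gap.
  let l : Fin (n + 1) → ℝ := fun i => σ.angle α i + if σ.part i ≤ s then 2 * Real.pi else 0
  have hl : ∀ i, l i = ∑ r, ((if r < σ.part i then α r else 0) +
      if σ.part i ≤ s then α r else 0) := fun i => by
    simp only [l, Finset.sum_add_distrib, ← σ.angle_eq_sum]
    split_ifs
    · rw [hα.2]
    · simp
  have hdiff : ∀ i ∈ upperSide σ s t, ∀ j, j ∉ upperSide σ s t →
      σ.angle (α - chordVertex s t) j - σ.angle (α - chordVertex s t) i = l j - l i - Real.pi := by
    intro i hi j hj
    have h3 := angle_chordVertex_sub hst hi hj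
    have h4 : ¬ σ.part i ≤ s := not_le.2 (mem_upperSide.1 hi).1
    simp only [l, h4, if_false, σ.angle_sub]
    linarith
  rw [surrounds_iff_of_two_arcs (U := (upperSide σ s t : Set (Fin (n + 1)))) (l := l)
    (fun i => if σ.part i ≤ s then 1 else 0)]
  · simp only [Finset.mem_coe]
    refine and_congr ?_ ?_
    · refine exists_congr fun i => and_congr_right fun _ => and_congr_right fun hi =>
        exists_congr fun j => and_congr_right fun _ => and_congr_right fun hj => ?_
      rw [hdiff i hi j hj]
      constructor <;> intro <;> linarith
    · refine exists_congr fun i => and_congr_right fun _ => and_congr_right fun hi =>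
        exists_congr fun j => and_congr_right fun _ => and_congr_right fun hj => ?_
      rw [hdiff i hi j hj]
      constructor <;> intro <;> linarith
  · intro i
    simp only [l]
    split_ifs <;> simp
  · intro i hi j hj
    rw [Finset.mem_coe, mem_upperSide] at hi hj
    refine lt_of_le_of_lt ?_ h1
    rw [hl, hl, ← Finset.sum_sub_distrib]
    refine Finset.sum_le_sum fun r _ => ?_
    have := hα.1 r
    split_ifs <;> first | linarith | omega
  · intro i hi j hj
    rw [Finset.mem_coe, mem_upperSide] at hi hj
    refine lt_of_le_of_lt ?_ h2
    rw [hl, hl, ← Finset.sum_sub_distrib]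
    refine Finset.sum_le_sum fun r _ => ?_
    have := hα.1 r
    split_ifs <;> first | linarith | omega
  · intro i hi j hj
    rw [Finset.mem_coe, mem_upperSide] at hi hj
    rw [hl, hl]
    refine Finset.sum_le_sum fun r _ => ?_
    have := hα.1 r
    split_ifs <;> first | linarith | omega
  · intro i hi j hj
    rw [Finset.mem_coe, mem_upperSide] at hi hj
    rw [hl, hl, ← hα.2, ← Finset.sum_add_distrib]
    refine Finset.sum_le_sum fun r _ => ?_
    have := hα.1 r
    split_ifs <;> first | linarith | omega

theorem mem_gapSimplex_iff {s t : Fin k} (hst : s < t) {α : Fin k → ℝ} (hs : 0 < α s)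
    (ht : 0 < α t) : α ∈ gapSimplex k ↔ α - chordVertex s t ∈ gapFan s t := by
  have hv : ∀ r, r ≠ s → r ≠ t → (α - chordVertex s t) r = α r := fun r h1 h2 => by
    simp [chordVertex, h1, h2]
  constructor
  · rintro ⟨h1, h2⟩
    refine ⟨?_, fun r hr hr' => by rw [hv r hr hr']; exact h1 r⟩
    simp only [Pi.sub_apply, Finset.sum_sub_distrib, h2, sum_chordVertex hst, sub_self]
  · rintro ⟨h1, h2⟩
    refine ⟨fun r => ?_, ?_⟩
    · by_cases hr : r = s
      · exact hr ▸ hs.le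
      · by_cases hr' : r = t
        · exact hr' ▸ ht.le
        · rw [← hv r hr hr']; exact h2 r hr hr'
    · simp only [Pi.sub_apply, Finset.sum_sub_distrib, sum_chordVertex hst] at h1
      linarith

theorem sum_baryc {K : Finset (Fin (n + 1))} (hK : K.Nonempty) : ∑ i, baryc K i = 1 := by
  have : (K.card : ℝ) ≠ 0 := by exact_mod_cast hK.card_pos.ne'
  simp [baryc, Finset.sum_ite_mem, this]

theorem mem_face_iff {J K : Finset (Fin (n + 1))} (hKJ : K ⊆ J) (hK : K.Nonempty)
    {x : Fin (n + 1) → ℝ} (hx : ∀ i ∈ K, 0 < x i) :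
    x ∈ face J ↔ x - baryc K ∈ fanSimplex J K := by
  have hv : ∀ j, j ∉ K → (x - baryc K) j = x j := fun j hj => by simp [baryc, hj]
  constructor
  · rintro ⟨⟨h1, h2⟩, h3⟩
    refine ⟨?_, fun j hj => by rw [hv j hj]; exact h1 j, fun j hj => ?_⟩
    · simp only [Pi.sub_apply, Finset.sum_sub_distrib, h2, sum_baryc hK, sub_self]
    · rw [hv j fun h => hj (hKJ h), h3 j hj]
  · rintro ⟨h1, h2, h3⟩
    refine ⟨⟨fun j => ?_, ?_⟩, fun j hj => ?_⟩
    · by_cases hj : j ∈ K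
      · exact (hx j hj).le
      · rw [← hv j hj]; exact h2 j hj
    · simp only [Pi.sub_apply, Finset.sum_sub_distrib, sum_baryc hK] at h1
      linarith
    · rw [← hv j fun h => hj (hKJ h), h3 j hj]

theorem topSet_sub_baryc (K : Finset (Fin (n + 1))) (x : Fin (n + 1) → ℝ) :
    topSet K (x - baryc K) = topSet K x := by
  ext i
  simp only [mem_topSet]
  refine and_congr_right fun hi => forall₂_congr fun j hj => ?_
  simp [baryc, hi, hj]

theorem topSet_univ_eq {K : Finset (Fin (n + 1))} (hK : K.Nonempty) {x : Fin (n + 1) → ℝ}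
    (hx : ∀ i ∈ K, ∀ j ∉ K, x j < x i) : topSet Finset.univ x = topSet K x := by
  ext i
  simp only [mem_topSet, Finset.mem_univ, true_and, forall_true_left]
  constructor
  · intro h
    refine ⟨?_, fun j _ => h j⟩
    by_contra hi
    obtain ⟨a, ha⟩ := hK
    exact (h a).not_gt (hx a ha i hi)
  · rintro ⟨hi, h⟩ j
    by_cases hj : j ∈ K
    · exact h j hj
    · exact (hx i hi j hj).le

/-- The cell and the stratum agree near `(x₀, α₀)` with their fans at the vertex
`(baryc K, chordVertex s t)`, if `(x₀, α₀)` lies in the star of this vertex. -/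
theorem eventually_mem_iff (σ : CyclicPartition n k) {J K : Finset (Fin (n + 1))} {s t : Fin k}
    (hst : s < t) (hKJ : K ⊆ J) (hK : K.Nonempty) {x₀ : Fin (n + 1) → ℝ} {α₀ : Fin k → ℝ}
    (hpos : ∀ i ∈ K, 0 < x₀ i) (hlt : ∀ i ∈ K, ∀ j ∉ K, x₀ j < x₀ i)
    (hs : 0 < α₀ s) (ht : 0 < α₀ t)
    (h1 : (∑ r, if s < r ∧ r < t then α₀ r else 0) < Real.pi)
    (h2 : (∑ r, if r < s ∨ t < r then α₀ r else 0) < Real.pi) :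
    ∀ᶠ y in 𝓝 (x₀, α₀),
      (y ∈ ambientCell k J ↔
        y - (baryc K, chordVertex s t) ∈ fanSimplex J K ×ˢ gapFan s t) ∧
      (y ∈ pantsCell σ J ↔ y - (baryc K, chordVertex s t) ∈ pantsCone σ J K s t) := by
  have c1 : ∀ i, Continuous fun y : (Fin (n + 1) → ℝ) × (Fin k → ℝ) => y.1 i := fun i => by fun_prop
  have c2 : ∀ r, Continuous fun y : (Fin (n + 1) → ℝ) × (Fin k → ℝ) => y.2 r := fun r => by fun_prop
  have c3 : ∀ p : Fin k → Prop, ∀ [DecidablePred p],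
      Continuous fun y : (Fin (n + 1) → ℝ) × (Fin k → ℝ) => ∑ r, if p r then y.2 r else 0 := by
    intro p _
    refine continuous_finsetSum _ fun r _ => ?_
    split_ifs
    · exact c2 r
    · exact continuous_const
  have e1 : ∀ᶠ y in 𝓝 (x₀, α₀), ∀ i, i ∈ K → 0 < y.1 i := eventually_all.2 fun i => by
    by_cases hi : i ∈ K
    · filter_upwards [(c1 i).continuousAt.eventually (lt_mem_nhds (hpos i hi))] with y hy _ using hy
    · simp [hi]
  have e2 : ∀ᶠ y in 𝓝 (x₀, α₀), ∀ i, i ∈ K → ∀ j, j ∉ K → y.1 j < y.1 i :=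
    eventually_all.2 fun i => by
      by_cases hi : i ∈ K
      · have : ∀ᶠ y in 𝓝 (x₀, α₀), ∀ j, j ∉ K → y.1 j < y.1 i := eventually_all.2 fun j => by
          by_cases hj : j ∈ K
          · simp [hj]
          · filter_upwards [(c1 j).continuousAt.eventually_lt (c1 i).continuousAt (hlt i hi j hj)]
              with y hy _ using hy
        filter_upwards [this] with y hy _ using hy
      · simp [hi]
  filter_upwards [e1, e2, (c2 s).continuousAt.eventually (lt_mem_nhds hs),
    (c2 t).continuousAt.eventually (lt_mem_nhds ht),
    (c3 _).continuousAt.eventually (gt_mem_nhds h1),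
    (c3 _).continuousAt.eventually (gt_mem_nhds h2)] with y y1 y2 y3 y4 y5 y6
  obtain ⟨x, α⟩ := y
  have ha : (x, α) ∈ ambientCell k J ↔
      (x, α) - (baryc K, chordVertex s t) ∈ fanSimplex J K ×ˢ gapFan s t :=
    and_congr (mem_face_iff hKJ hK y1) (mem_gapSimplex_iff hst y3 y4)
  refine ⟨ha, ?_⟩
  rw [mem_pantsCell_iff]
  simp only [pantsCone, mem_ofPred_eq, ← ha]
  refine and_congr_right fun h => ?_
  rw [surrounds_angle_iff hst h.2 y5 y6, topSet_univ_eq hK y2, Prod.fst_sub, topSet_sub_baryc]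
  rfl

/-- For a cone, membership of `ε • ξ` does not depend on `ε > 0`. -/
theorem localFan_eq_of_cone {E : Type*} [NormedAddCommGroup E] [NormedSpace ℝ E] {S C : Set E}
    {p : E} (h : ∀ᶠ y in 𝓝 p, y ∈ S ↔ y - p ∈ C)
    (hC : ∀ ε : ℝ, 0 < ε → ∀ ξ, ε • ξ ∈ C ↔ ξ ∈ C) : localFan S p = C := by
  ext ξ
  have hcont : Tendsto (fun ε : ℝ => p + ε • ξ) (𝓝[>] 0) (𝓝 p) := by
    have : Continuous fun ε : ℝ => p + ε • ξ := by fun_prop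
    have := (this.tendsto 0).mono_left (nhdsWithin_le_nhds (s := Ioi 0))
    simpa using this
  have h1 : ∀ᶠ ε in 𝓝[>] (0 : ℝ), p + ε • ξ ∈ S ↔ ξ ∈ C := by
    filter_upwards [hcont.eventually h, self_mem_nhdsWithin] with ε h1 (h2 : 0 < ε)
    rw [h1, add_sub_cancel_left, hC ε h2]
  rw [localFan, mem_ofPred_eq, eventually_congr h1, eventually_const]

theorem smul_mem_gapFan_iff {s t : Fin k} {ε : ℝ} (hε : 0 < ε) {β : Fin k → ℝ} :
    ε • β ∈ gapFan s t ↔ β ∈ gapFan s t := by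
  simp [gapFan, ← Finset.mul_sum, hε.ne', hε]

theorem smul_mem_fanSimplex_iff {J K : Finset (Fin (n + 1))} {ε : ℝ} (hε : 0 < ε)
    {ξ : Fin (n + 1) → ℝ} : ε • ξ ∈ fanSimplex J K ↔ ξ ∈ fanSimplex J K := by
  simp [fanSimplex, ← Finset.mul_sum, hε.ne', hε]

theorem topSet_smul {K : Finset (Fin (n + 1))} {ε : ℝ} (hε : 0 < ε)
    (ξ : Fin (n + 1) → ℝ) : topSet K (ε • ξ) = topSet K ξ := by
  ext i
  simp [mem_topSet, hε]

theorem smul_mem_pantsCone_iff {σ : CyclicPartition n k} {J K : Finset (Fin (n + 1))}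
    {s t : Fin k} {ε : ℝ} (hε : 0 < ε) (y : (Fin (n + 1) → ℝ) × (Fin k → ℝ)) :
    ε • y ∈ pantsCone σ J K s t ↔ y ∈ pantsCone σ J K s t := by
  have h : ∀ a : ℝ, ε * a ≤ 0 ↔ a ≤ 0 := fun a => by
    rw [← neg_nonneg, ← mul_neg, mul_nonneg_iff_of_pos_left hε, neg_nonneg]
  simp only [pantsCone, mem_ofPred_eq, mem_prod, Prod.smul_fst, Prod.smul_snd, topSet_smul hε,
    smul_mem_gapFan_iff hε, smul_mem_fanSimplex_iff hε, σ.angle_smul, ← mul_sub,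
    mul_nonneg_iff_of_pos_left hε, h]

theorem sum_ite_chordVertex_eq_zero {s t : Fin k} {p : Fin k → Prop} [DecidablePred p]
    (hs : ¬ p s) (ht : ¬ p t) : (∑ r, if p r then chordVertex s t r else 0) = 0 :=
  Finset.sum_eq_zero fun r _ => by
    split_ifs with h
    · have h1 : r ≠ s := fun e => hs (e ▸ h)
      have h2 : r ≠ t := fun e => ht (e ▸ h)
      simp [chordVertex, h1, h2]
    · rfl

theorem eventually_mem_iff_vertex (σ : CyclicPartition n k) {J K : Finset (Fin (n + 1))}
    {s t : Fin k} (hst : s < t) (hKJ : K ⊆ J) (hK : K.Nonempty) :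
    ∀ᶠ y in 𝓝 (baryc K, chordVertex s t),
      (y ∈ ambientCell k J ↔
        y - (baryc K, chordVertex s t) ∈ fanSimplex J K ×ˢ gapFan s t) ∧
      (y ∈ pantsCell σ J ↔ y - (baryc K, chordVertex s t) ∈ pantsCone σ J K s t) := by
  have hpi := Real.pi_pos
  have hcard : 0 < (K.card : ℝ) := by exact_mod_cast hK.card_pos
  refine eventually_mem_iff σ hst hKJ hK (fun i hi => ?_) (fun i hi j hj => ?_) ?_ ?_ ?_ ?_
  · simpa [baryc, hi] using hK
  · simpa [baryc, hi, hj] using hK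
  · simpa [chordVertex] using hpi
  · simpa [chordVertex] using hpi
  · rwa [sum_ite_chordVertex_eq_zero] <;> simp
  · rwa [sum_ite_chordVertex_eq_zero] <;> simp [hst.le]

theorem pantsFan_eq (σ : CyclicPartition n k) {J K : Finset (Fin (n + 1))} {s t : Fin k}
    (hst : s < t) (hKJ : K ⊆ J) (hK : K.Nonempty) :
    pantsFan σ J K s t = pantsCone σ J K s t :=
  localFan_eq_of_cone ((eventually_mem_iff_vertex σ hst hKJ hK).mono fun _ h => h.2)
    fun _ hε => smul_mem_pantsCone_iff hε

theorem localFan_gapSimplex {s t : Fin k} (hst : s < t) :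
    localFan (gapSimplex k) (chordVertex s t) = gapFan s t := by
  have hpi := Real.pi_pos
  refine localFan_eq_of_cone ?_ fun _ hε _ => smul_mem_gapFan_iff hε
  have hs : ∀ᶠ y in 𝓝 (chordVertex s t), 0 < y s :=
    (continuous_apply s).continuousAt.eventually (lt_mem_nhds (by simpa [chordVertex] using hpi))
  have ht : ∀ᶠ y in 𝓝 (chordVertex s t), 0 < y t :=
    (continuous_apply t).continuousAt.eventually (lt_mem_nhds (by simpa [chordVertex] using hpi))
  filter_upwards [hs, ht] with y hs ht using mem_gapSimplex_iff hst hs ht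

end LocalFans

/-! ### The product structure of the local fan -/

section Heights

variable {ι : Type*}

theorem topSet_nonempty {A : Finset ι} (hA : A.Nonempty) (x : ι → ℝ) : (topSet A x).Nonempty :=
  let ⟨i, hi, h⟩ := A.exists_max_image x hA
  ⟨i, mem_topSet.2 ⟨hi, h⟩⟩

theorem eq_of_mem_topSet {A : Finset ι} {x : ι → ℝ} {i j : ι} (hi : i ∈ topSet A x)
    (hj : j ∈ topSet A x) : x i = x j :=
  le_antisymm ((mem_topSet.1 hj).2 i (mem_topSet.1 hi).1)
    ((mem_topSet.1 hi).2 j (mem_topSet.1 hj).1)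

theorem topSet_congr_add {A : Finset ι} {x y : ι → ℝ} (c : ℝ) (h : ∀ i ∈ A, y i = x i + c) :
    topSet A y = topSet A x := by
  ext i
  simp only [mem_topSet]
  refine and_congr_right fun hi => forall₂_congr fun j hj => ?_
  rw [h i hi, h j hj, add_le_add_iff_right]

/-- For functions moving along `-lam`, the sum of `d` over the positions of the maxima on `A` and
on `B` balances `-τ` at exactly one time `τ`, if `d` is antitone in `lam` on `A` and on `B`. -/
theorem existsUnique_balanced_time {A B : Finset ι} (hA : A.Nonempty) (hB : B.Nonempty)
    (u lam d : ι → ℝ) (hdA : ∀ i ∈ A, ∀ j ∈ A, lam i ≤ lam j → d j ≤ d i)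
    (hdB : ∀ i ∈ B, ∀ j ∈ B, lam i ≤ lam j → d j ≤ d i) :
    ∃! τ : ℝ,
      (∃ i ∈ topSet A (u - τ • lam), ∃ j ∈ topSet B (u - τ • lam), 0 ≤ d j + d i + τ) ∧
      (∃ i ∈ topSet A (u - τ • lam), ∃ j ∈ topSet B (u - τ • lam), d j + d i + τ ≤ 0) := by
  -- As `τ` grows, `u - τ • lam` penalizes large `lam`, so a later maximum has no larger `lam` than
  -- an earlier one, hence no smaller `d`.
  have hmono : ∀ C : Finset ι, (∀ i ∈ C, ∀ j ∈ C, lam i ≤ lam j → d j ≤ d i) →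
      ∀ τ τ' : ℝ, τ < τ' → ∀ i ∈ topSet C (u - τ • lam), ∀ j ∈ topSet C (u - τ' • lam),
      d i ≤ d j := by
    intro C hC τ τ' hτ i hi j hj
    rw [mem_topSet] at hi hj
    refine hC j hj.1 i hi.1 ?_
    have h1 := hi.2 j hj.1
    have h2 := hj.2 i hi.1
    simp only [Pi.sub_apply, Pi.smul_apply, smul_eq_mul] at h1 h2
    by_contra hlt
    nlinarith
  have hclosed : ∀ C : Finset ι, ∀ i, IsClosed {τ : ℝ | i ∈ topSet C (u - τ • lam)} := by
    intro C i
    have : {τ : ℝ | i ∈ topSet C (u - τ • lam)} =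
        {τ : ℝ | i ∈ C} ∩ ⋂ j ∈ C, {τ : ℝ | (u - τ • lam) j ≤ (u - τ • lam) i} := by
      ext; simp [mem_topSet]
    rw [this]
    refine isClosed_const.inter (isClosed_biInter fun j _ => isClosed_le ?_ ?_) <;>
      simp only [Pi.sub_apply, Pi.smul_apply, smul_eq_mul] <;> fun_prop
  have hcl : ∀ p : ι → ι → ℝ → Prop, (∀ i j, IsClosed {τ | p i j τ}) →
      IsClosed {τ : ℝ | ∃ i ∈ topSet A (u - τ • lam), ∃ j ∈ topSet B (u - τ • lam), p i j τ} := by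
    intro p hp
    have : {τ : ℝ | ∃ i ∈ topSet A (u - τ • lam), ∃ j ∈ topSet B (u - τ • lam), p i j τ} =
        ⋃ i ∈ A, ⋃ j ∈ B, {τ : ℝ | i ∈ topSet A (u - τ • lam)} ∩
          ({τ : ℝ | j ∈ topSet B (u - τ • lam)} ∩ {τ | p i j τ}) := by
      ext τ
      simp only [mem_ofPred_eq, mem_iUnion, mem_inter_iff]
      constructor
      · rintro ⟨i, hi, j, hj, h⟩
        exact ⟨i, (mem_topSet.1 hi).1, j, (mem_topSet.1 hj).1, hi, hj, h⟩
      · rintro ⟨i, -, j, -, hi, hj, h⟩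
        exact ⟨i, hi, j, hj, h⟩
    rw [this]
    exact isClosed_biUnion_finset fun i _ => isClosed_biUnion_finset fun j _ =>
      (hclosed A i).inter ((hclosed B j).inter (hp i j))
  obtain ⟨M, hM⟩ : ∃ M : ℝ, ∀ i ∈ A, ∀ j ∈ B, |d j + d i| ≤ M := by
    refine ⟨∑ i ∈ A, |d i| + ∑ j ∈ B, |d j|, fun i hi j hj => (abs_add_le _ _).trans ?_⟩
    have h1 := Finset.single_le_sum (f := fun i => |d i|) (fun i _ => abs_nonneg _) hi
    have h2 := Finset.single_le_sum (f := fun i => |d i|) (fun i _ => abs_nonneg _) hj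
    linarith
  have hex : ∀ τ : ℝ, ∃ i ∈ topSet A (u - τ • lam), ∃ j ∈ topSet B (u - τ • lam),
      |d j + d i| ≤ M := fun τ => by
    obtain ⟨i, hi⟩ := topSet_nonempty hA (u - τ • lam)
    obtain ⟨j, hj⟩ := topSet_nonempty hB (u - τ • lam)
    exact ⟨i, hi, j, hj, hM i (mem_topSet.1 hi).1 j (mem_topSet.1 hj).1⟩
  refine existsUnique_of_exists_of_unique ?_ ?_
  -- The maxima jump, so the balance is only set-valued, but both sign conditions are closed in `τ`,
  -- cover the line, and hold somewhere (at `M` and `-M`). Connectedness plays the role of the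
  -- intermediate value theorem.
  · have hconn := isPreconnected_closed_iff.1 (isPreconnected_univ (α := ℝ)) _ _
      (hcl (fun i j τ => 0 ≤ d j + d i + τ) fun i j =>
        isClosed_le continuous_const (by fun_prop))
      (hcl (fun i j τ => d j + d i + τ ≤ 0) fun i j =>
        isClosed_le (by fun_prop) continuous_const) ?_ ?_ ?_
    · obtain ⟨τ, -, h⟩ := hconn
      exact ⟨τ, h⟩
    · intro τ _
      obtain ⟨i, hi, j, hj, -⟩ := hex τ
      rcases le_total 0 (d j + d i + τ) with h | h
      · exact Or.inl ⟨i, hi, j, hj, h⟩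
      · exact Or.inr ⟨i, hi, j, hj, h⟩
    · obtain ⟨i, hi, j, hj, h⟩ := hex M
      exact ⟨M, trivial, i, hi, j, hj, by linarith [(abs_le.1 h).1]⟩
    · obtain ⟨i, hi, j, hj, h⟩ := hex (-M)
      exact ⟨-M, trivial, i, hi, j, hj, by linarith [(abs_le.1 h).2]⟩
  -- Every value of `d j + d i + τ` at a later time strictly exceeds every value at an earlier one.
  · have key : ∀ τ τ' : ℝ,
        (∃ i ∈ topSet A (u - τ • lam), ∃ j ∈ topSet B (u - τ • lam), 0 ≤ d j + d i + τ) →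
        (∃ i ∈ topSet A (u - τ' • lam), ∃ j ∈ topSet B (u - τ' • lam), d j + d i + τ' ≤ 0) →
        τ' ≤ τ := by
      rintro τ τ' ⟨i, hi, j, hj, h⟩ ⟨i', hi', j', hj', h'⟩
      by_contra hlt
      have h1 := hmono A hdA τ τ' (not_le.1 hlt) i hi i' hi'
      have h2 := hmono B hdB τ τ' (not_le.1 hlt) j hj j' hj'
      linarith
    exact fun τ τ' h h' => le_antisymm (key τ' τ h'.1 h.2) (key τ τ' h.1 h'.2)

end Heights

/-! ### Centering and height gap as coordinates on the fan of `Δ_J`. -/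

section Centering

variable {n k : ℕ} {J K U : Finset (Fin (n + 1))}

/-- The difference of the maxima over `K ∩ U` and over `K \ U`. -/
def heightGap (K U : Finset (Fin (n + 1))) (x : Fin (n + 1) → ℝ) : ℝ :=
  sSup (x '' (K ∩ U : Finset _)) - sSup (x '' (K \ U : Finset _))

theorem heightGap_eq {x : Fin (n + 1) → ℝ} {i j : Fin (n + 1)} (hi : i ∈ topSet (K ∩ U) x)
    (hj : j ∈ topSet (K \ U) x) : heightGap K U x = x i - x j := by
  have h : ∀ {A : Finset (Fin (n + 1))} {i}, i ∈ topSet A x → sSup (x '' A) = x i := by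
    intro A i hi
    rw [mem_topSet] at hi
    exact IsGreatest.csSup_eq ⟨⟨i, hi.1, rfl⟩, by rintro _ ⟨j, hj, rfl⟩; exact hi.2 j hj⟩
  rw [heightGap, h hi, h hj]

/-- `u + a` on `K ∩ U`, `u + b` on `K \ U`, and `u` elsewhere. -/
def shift (K U : Finset (Fin (n + 1))) (u : Fin (n + 1) → ℝ) (a b : ℝ) : Fin (n + 1) → ℝ :=
  fun i => u i + if i ∈ K ∩ U then a else if i ∈ K \ U then b else 0

theorem shift_of_mem_inter {u : Fin (n + 1) → ℝ} {a b : ℝ} {i : Fin (n + 1)} (hi : i ∈ K ∩ U) :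
    shift K U u a b i = u i + a := by
  simp only [shift, hi, if_true]

theorem shift_of_mem_sdiff {u : Fin (n + 1) → ℝ} {a b : ℝ} {i : Fin (n + 1)} (hi : i ∈ K \ U) :
    shift K U u a b i = u i + b := by
  have : i ∉ K ∩ U := fun h => (Finset.mem_sdiff.1 hi).2 (Finset.mem_inter.1 h).2
  simp only [shift, hi, this, if_true, if_false]

theorem shift_of_notMem {u : Fin (n + 1) → ℝ} {a b : ℝ} {i : Fin (n + 1)} (hi : i ∉ K) :
    shift K U u a b i = u i := by
  simp [shift, hi]

theorem topSet_inter_shift (u : Fin (n + 1) → ℝ) (a b : ℝ) :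
    topSet (K ∩ U) (shift K U u a b) = topSet (K ∩ U) u :=
  topSet_congr_add a fun _ hi => shift_of_mem_inter hi

theorem topSet_sdiff_shift (u : Fin (n + 1) → ℝ) (a b : ℝ) :
    topSet (K \ U) (shift K U u a b) = topSet (K \ U) u :=
  topSet_congr_add b fun _ hi => shift_of_mem_sdiff hi

theorem heightGap_shift (hA : (K ∩ U).Nonempty) (hB : (K \ U).Nonempty) (u : Fin (n + 1) → ℝ)
    (a b : ℝ) : heightGap K U (shift K U u a b) = heightGap K U u + (a - b) := by
  obtain ⟨i, hi⟩ := topSet_nonempty hA u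
  obtain ⟨j, hj⟩ := topSet_nonempty hB u
  rw [heightGap_eq hi hj, heightGap_eq ((topSet_inter_shift u a b).symm ▸ hi)
    ((topSet_sdiff_shift u a b).symm ▸ hj), shift_of_mem_inter (mem_topSet.1 hi).1,
    shift_of_mem_sdiff (mem_topSet.1 hj).1]
  ring

theorem sum_eq_inter_add_sdiff_add_compl (f : Fin (n + 1) → ℝ) :
    ∑ i, f i = ∑ i ∈ K ∩ U, f i + ∑ i ∈ K \ U, f i + ∑ i ∈ Kᶜ, f i := by
  rw [Finset.sum_inter_add_sum_sdiff, Finset.sum_add_sum_compl]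

theorem sum_inter_shift (u : Fin (n + 1) → ℝ) (a b : ℝ) :
    ∑ i ∈ K ∩ U, shift K U u a b i = ∑ i ∈ K ∩ U, u i + (K ∩ U).card * a := by
  rw [Finset.sum_congr rfl fun i hi => shift_of_mem_inter hi, Finset.sum_add_distrib,
    Finset.sum_const, nsmul_eq_mul]

theorem sum_sdiff_shift (u : Fin (n + 1) → ℝ) (a b : ℝ) :
    ∑ i ∈ K \ U, shift K U u a b i = ∑ i ∈ K \ U, u i + (K \ U).card * b := by
  rw [Finset.sum_congr rfl fun i hi => shift_of_mem_sdiff hi, Finset.sum_add_distrib,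
    Finset.sum_const, nsmul_eq_mul]

theorem sum_shift (u : Fin (n + 1) → ℝ) (a b : ℝ) :
    ∑ i, shift K U u a b i = ∑ i, u i + (K ∩ U).card * a + (K \ U).card * b := by
  rw [sum_eq_inter_add_sdiff_add_compl (K := K) (U := U), sum_inter_shift, sum_sdiff_shift,
    sum_eq_inter_add_sdiff_add_compl (K := K) (U := U) u,
    Finset.sum_congr rfl fun i hi => shift_of_notMem (Finset.mem_compl.1 hi)]
  ring

theorem centering_eq_shift (ξ : Fin (n + 1) → ℝ) :
    centering K U ξ = shift K U ξ (-((∑ j ∈ K ∩ U, ξ j) / (K ∩ U).card))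
      (-((∑ j ∈ K \ U, ξ j) / (K \ U).card)) := by
  ext i
  simp only [centering, shift]
  split_ifs <;> ring

theorem centering_of_notMem {ξ : Fin (n + 1) → ℝ} {i : Fin (n + 1)} (hi : i ∉ K) :
    centering K U ξ i = ξ i := by
  rw [centering_eq_shift, shift_of_notMem hi]

theorem centering_mem (hA : (K ∩ U).Nonempty) (hB : (K \ U).Nonempty) (hKJ : K ⊆ J)
    {ξ : Fin (n + 1) → ℝ} (hξ : ξ ∈ fanSimplex J K) :
    centering K U ξ ∈ normalFanProduct J K U := by
  have h1 : ((K ∩ U).card : ℝ) ≠ 0 := by exact_mod_cast hA.card_pos.ne'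
  have h2 : ((K \ U).card : ℝ) ≠ 0 := by exact_mod_cast hB.card_pos.ne'
  refine ⟨?_, ?_, fun j hj => ?_, fun j hj => ?_⟩
  · rw [centering_eq_shift, sum_inter_shift]
    field_simp
    ring
  · rw [centering_eq_shift, sum_sdiff_shift]
    field_simp
    ring
  · rw [centering_of_notMem hj]
    exact hξ.2.1 j hj
  · rw [centering_of_notMem fun h => hj (hKJ h)]
    exact hξ.2.2 j hj

theorem centering_shift (hA : (K ∩ U).Nonempty) (hB : (K \ U).Nonempty)
    {u : Fin (n + 1) → ℝ} (hu : u ∈ normalFanProduct J K U) (a b : ℝ) :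
    centering K U (shift K U u a b) = u := by
  have h1 : ((K ∩ U).card : ℝ) ≠ 0 := by exact_mod_cast hA.card_pos.ne'
  have h2 : ((K \ U).card : ℝ) ≠ 0 := by exact_mod_cast hB.card_pos.ne'
  ext i
  rw [centering_eq_shift, sum_inter_shift, sum_sdiff_shift, hu.1, hu.2.1, zero_add, zero_add,
    mul_div_cancel_left₀ _ h1, mul_div_cancel_left₀ _ h2]
  by_cases hi : i ∈ K ∩ U
  · rw [shift_of_mem_inter hi, shift_of_mem_inter hi]; ring
  · by_cases hi' : i ∈ K \ U
    · rw [shift_of_mem_sdiff hi', shift_of_mem_sdiff hi']; ring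
    · have : i ∉ K := fun h => by
        by_cases hU : i ∈ U
        · exact hi (Finset.mem_inter.2 ⟨h, hU⟩)
        · exact hi' (Finset.mem_sdiff.2 ⟨h, hU⟩)
      rw [shift_of_notMem this, shift_of_notMem this]

theorem isLinearMap_centering (K U : Finset (Fin (n + 1))) : IsLinearMap ℝ (centering K U) := by
  constructor
  · intro x y
    ext i
    simp only [centering, Pi.add_apply, Finset.sum_add_distrib]
    split_ifs <;> ring
  · intro c x
    ext i
    simp only [centering, Pi.smul_apply, smul_eq_mul, ← Finset.mul_sum]
    split_ifs <;> ring

/-- A vector of the local fan of `Δ_J` is determined by its centering and its height gap. -/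
theorem eq_of_centering_eq (hA : (K ∩ U).Nonempty) (hB : (K \ U).Nonempty)
    {ξ ξ' : Fin (n + 1) → ℝ} (hξ : ∑ i, ξ i = 0) (hξ' : ∑ i, ξ' i = 0)
    (h : centering K U ξ = centering K U ξ') (hgap : heightGap K U ξ = heightGap K U ξ') :
    ξ = ξ' := by
  obtain ⟨a, b, hab⟩ : ∃ a b, ξ = shift K U ξ' a b := by
    refine ⟨(∑ j ∈ K ∩ U, ξ j) / (K ∩ U).card - (∑ j ∈ K ∩ U, ξ' j) / (K ∩ U).card,
      (∑ j ∈ K \ U, ξ j) / (K \ U).card - (∑ j ∈ K \ U, ξ' j) / (K \ U).card, ?_⟩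
    ext i
    have := congrFun h i
    simp only [centering] at this
    simp only [shift]
    split_ifs at this ⊢ <;> linarith
  rw [hab, heightGap_shift hA hB] at hgap
  rw [hab, sum_shift, hξ'] at hξ
  have h1 : 0 < ((K ∩ U).card : ℝ) := by exact_mod_cast hA.card_pos
  have h2 : 0 < ((K \ U).card : ℝ) := by exact_mod_cast hB.card_pos
  have h3 : a = b := by linarith
  subst h3
  have h4 : a = 0 := by
    have : (((K ∩ U).card : ℝ) + (K \ U).card) * a = 0 := by linarith
    exact (mul_eq_zero.1 this).resolve_left (by positivity)
  rw [hab]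
  ext i
  simp [shift, h4]

theorem exists_centering_eq (hA : (K ∩ U).Nonempty) (hB : (K \ U).Nonempty) (hKJ : K ⊆ J)
    {u : Fin (n + 1) → ℝ} (hu : u ∈ normalFanProduct J K U) (g : ℝ) :
    ∃ ξ ∈ fanSimplex J K, centering K U ξ = u ∧ heightGap K U ξ = g := by
  have h1 : 0 < ((K ∩ U).card : ℝ) := by exact_mod_cast hA.card_pos
  have h2 : 0 < ((K \ U).card : ℝ) := by exact_mod_cast hB.card_pos
  -- Of the two free constants, the difference `d` adjusts the height gap and `b` then makes the
  -- total sum zero.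
  set d := g - heightGap K U u
  set b := (-∑ i, u i - (K ∩ U).card * d) / ((K ∩ U).card + (K \ U).card : ℝ) with hb
  refine ⟨shift K U u (b + d) b, ⟨?_, fun j hj => ?_, fun j hj => ?_⟩, centering_shift hA hB hu _ _,
    ?_⟩
  · rw [sum_shift, hb]
    field_simp
    ring
  · rw [shift_of_notMem hj]; exact hu.2.2.1 j hj
  · rw [shift_of_notMem fun h => hj (hKJ h)]; exact hu.2.2.2 j hj
  · rw [heightGap_shift hA hB]
    ring

theorem topSet_inter_centering (ξ : Fin (n + 1) → ℝ) :
    topSet (K ∩ U) (centering K U ξ) = topSet (K ∩ U) ξ := by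
  rw [centering_eq_shift, topSet_inter_shift]

theorem topSet_sdiff_centering (ξ : Fin (n + 1) → ℝ) :
    topSet (K \ U) (centering K U ξ) = topSet (K \ U) ξ := by
  rw [centering_eq_shift, topSet_sdiff_shift]

/-- Equal maxima on the two sides are both maxima over `K`. In this form the condition is visibly
polyhedral. -/
theorem heightGap_eq_zero_iff (hA : (K ∩ U).Nonempty) (hB : (K \ U).Nonempty)
    (x : Fin (n + 1) → ℝ) :
    heightGap K U x = 0 ↔ (∃ i ∈ topSet K x, i ∈ U) ∧ ∃ j ∈ topSet K x, j ∉ U := by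
  constructor
  · intro h
    obtain ⟨i, hi⟩ := topSet_nonempty hA x
    obtain ⟨j, hj⟩ := topSet_nonempty hB x
    rw [heightGap_eq hi hj, sub_eq_zero] at h
    rw [mem_topSet] at hi hj
    obtain ⟨hiK, hiU⟩ := Finset.mem_inter.1 hi.1
    obtain ⟨hjK, hjU⟩ := Finset.mem_sdiff.1 hj.1
    have key : ∀ a ∈ K, x a ≤ x i := fun a ha => by
      by_cases haU : a ∈ U
      · exact hi.2 a (Finset.mem_inter.2 ⟨ha, haU⟩)
      · rw [h]; exact hj.2 a (Finset.mem_sdiff.2 ⟨ha, haU⟩)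
    exact ⟨⟨i, mem_topSet.2 ⟨hiK, key⟩, hiU⟩, j, mem_topSet.2 ⟨hjK, fun a ha => h ▸ key a ha⟩, hjU⟩
  · rintro ⟨⟨i, hi, hiU⟩, j, hj, hjU⟩
    have hij := eq_of_mem_topSet hi hj
    rw [mem_topSet] at hi hj
    rw [heightGap_eq (mem_topSet.2 ⟨Finset.mem_inter.2 ⟨hi.1, hiU⟩, fun a ha =>
      hi.2 a (Finset.mem_inter.1 ha).1⟩) (mem_topSet.2 ⟨Finset.mem_sdiff.2 ⟨hj.1, hjU⟩, fun a ha =>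
      hj.2 a (Finset.mem_sdiff.1 ha).1⟩), hij, sub_self]

theorem mem_topSet_inter_iff (hA : (K ∩ U).Nonempty) (hB : (K \ U).Nonempty)
    {x : Fin (n + 1) → ℝ} (h : heightGap K U x = 0) (i : Fin (n + 1)) :
    i ∈ topSet (K ∩ U) x ↔ i ∈ topSet K x ∧ i ∈ U := by
  obtain ⟨⟨a, ha, haU⟩, -⟩ := (heightGap_eq_zero_iff hA hB x).1 h
  rw [mem_topSet] at ha
  simp only [mem_topSet, Finset.mem_inter]
  constructor
  · rintro ⟨⟨hK, hU⟩, h⟩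
    exact ⟨⟨hK, fun j hj => (ha.2 j hj).trans (h a ⟨ha.1, haU⟩)⟩, hU⟩
  · rintro ⟨⟨hK, h⟩, hU⟩
    exact ⟨⟨hK, hU⟩, fun j hj => h j hj.1⟩

theorem mem_topSet_sdiff_iff (hA : (K ∩ U).Nonempty) (hB : (K \ U).Nonempty)
    {x : Fin (n + 1) → ℝ} (h : heightGap K U x = 0) (i : Fin (n + 1)) :
    i ∈ topSet (K \ U) x ↔ i ∈ topSet K x ∧ i ∉ U := by
  obtain ⟨-, a, ha, haU⟩ := (heightGap_eq_zero_iff hA hB x).1 h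
  rw [mem_topSet] at ha
  simp only [mem_topSet, Finset.mem_sdiff]
  constructor
  · rintro ⟨⟨hK, hU⟩, h⟩
    exact ⟨⟨hK, fun j hj => (ha.2 j hj).trans (h a ⟨ha.1, haU⟩)⟩, hU⟩
  · rintro ⟨⟨hK, h⟩, hU⟩
    exact ⟨⟨hK, hU⟩, fun j hj => h j hj.1⟩

end Centering

/-! ### The line direction `w + λ` in the fan of the stratum. -/

section Product

variable {n k : ℕ} {σ : CyclicPartition n k} {J K : Finset (Fin (n + 1))} {s t : Fin k}

/-- Decouples the two sides: beyond the height gap, the condition involves only maxima over `K_+`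
and over `K_-` separately, and these are unchanged by centering. -/
theorem mem_pantsCone_iff (hA : (K ∩ upperSide σ s t).Nonempty)
    (hB : (K \ upperSide σ s t).Nonempty) {ξ : Fin (n + 1) → ℝ} {β : Fin k → ℝ} :
    (ξ, β) ∈ pantsCone σ J K s t ↔
      ξ ∈ fanSimplex J K ∧ β ∈ gapFan s t ∧ heightGap K (upperSide σ s t) ξ = 0 ∧
      (∃ i ∈ topSet (K ∩ upperSide σ s t) ξ, ∃ j ∈ topSet (K \ upperSide σ s t) ξ,
        0 ≤ σ.angle β j - σ.angle β i) ∧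
      (∃ i ∈ topSet (K ∩ upperSide σ s t) ξ, ∃ j ∈ topSet (K \ upperSide σ s t) ξ,
        σ.angle β j - σ.angle β i ≤ 0) := by
  simp only [pantsCone, mem_ofPred_eq, mem_prod]
  rw [and_assoc]
  refine and_congr_right fun _ => and_congr_right fun _ => ?_
  constructor
  · rintro ⟨⟨i, hi, hiU, j, hj, hjU, h⟩, i', hi', hiU', j', hj', hjU', h'⟩
    have h0 := (heightGap_eq_zero_iff hA hB ξ).2 ⟨⟨i, hi, hiU⟩, j, hj, hjU⟩
    simp only [mem_topSet_inter_iff hA hB h0, mem_topSet_sdiff_iff hA hB h0]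
    exact ⟨h0, ⟨i, ⟨hi, hiU⟩, j, ⟨hj, hjU⟩, h⟩, i', ⟨hi', hiU'⟩, j', ⟨hj', hjU'⟩, h'⟩
  · rintro ⟨h0, h⟩
    simp only [mem_topSet_inter_iff hA hB h0, mem_topSet_sdiff_iff hA hB h0] at h
    obtain ⟨⟨i, ⟨hi, hiU⟩, j, ⟨hj, hjU⟩, h⟩, i', ⟨hi', hiU'⟩, j', ⟨hj', hjU'⟩, h'⟩ := h
    exact ⟨⟨i, hi, hiU, j, hj, hjU, h⟩, i', hi', hiU', j', hj', hjU', h'⟩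

theorem zero_mem_gapFan : (0 : Fin k → ℝ) ∈ gapFan s t := by
  simp [gapFan]

/-- With `β = 0` all angle deviations vanish, so both sign conditions hold and only the height gap
constrains `ξ`. -/
theorem fst_image_pantsCone (hA : (K ∩ upperSide σ s t).Nonempty)
    (hB : (K \ upperSide σ s t).Nonempty) :
    Prod.fst '' pantsCone σ J K s t =
      {ξ | ξ ∈ fanSimplex J K ∧ heightGap K (upperSide σ s t) ξ = 0} := by
  ext ξ
  constructor
  · rintro ⟨⟨ξ, β⟩, h, rfl⟩
    rw [mem_pantsCone_iff hA hB] at h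
    exact ⟨h.1, h.2.2.1⟩
  · rintro ⟨h1, h2⟩
    obtain ⟨i, hi⟩ := topSet_nonempty hA ξ
    obtain ⟨j, hj⟩ := topSet_nonempty hB ξ
    have h0 : ∀ i, σ.angle 0 i = 0 := fun i => (σ.isLinearMap_angle i).map_zero
    exact ⟨(ξ, 0), (mem_pantsCone_iff hA hB).2 ⟨h1, zero_mem_gapFan, h2,
      ⟨i, hi, j, hj, by simp [h0]⟩, i, hi, j, hj, by simp [h0]⟩, rfl⟩

theorem bijOn_centering {U : Finset (Fin (n + 1))} (hA : (K ∩ U).Nonempty)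
    (hB : (K \ U).Nonempty) (hKJ : K ⊆ J) :
    BijOn (centering K U) {ξ | ξ ∈ fanSimplex J K ∧ heightGap K U ξ = 0}
      (normalFanProduct J K U) := by
  refine ⟨fun ξ hξ => centering_mem hA hB hKJ hξ.1, fun ξ hξ ξ' hξ' h =>
    eq_of_centering_eq hA hB hξ.1.1 hξ'.1.1 h (hξ.2.trans hξ'.2.symm), fun u hu => ?_⟩
  obtain ⟨ξ, h1, h2, h3⟩ := exists_centering_eq hA hB hKJ hu 0
  exact ⟨ξ, ⟨h1, h3⟩, h2⟩

theorem add_smul_edgeVector_mem {β : Fin k → ℝ} (hβ : β ∈ gapFan s t) (τ : ℝ) :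
    β + τ • edgeVector s t ∈ gapFan s t := by
  refine ⟨?_, fun r hr hr' => ?_⟩
  · simp only [Pi.add_apply, Pi.smul_apply, smul_eq_mul, Finset.sum_add_distrib,
      ← Finset.mul_sum, sum_edgeVector, hβ.1, mul_zero, add_zero]
  · simpa [edgeVector, hr, hr'] using hβ.2 r hr hr'

theorem add_smul_mem_normalFanProduct {U : Finset (Fin (n + 1))} (hKJ : K ⊆ J)
    {u lam : Fin (n + 1) → ℝ} (hu : u ∈ normalFanProduct J K U)
    (hlam : lam ∈ normalFanProduct K K U) (τ : ℝ) : u + τ • lam ∈ normalFanProduct J K U := by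
  refine ⟨?_, ?_, fun j hj => ?_, fun j hj => ?_⟩
  · simp only [Pi.add_apply, Pi.smul_apply, smul_eq_mul, Finset.sum_add_distrib,
      ← Finset.mul_sum, hu.1, hlam.1, mul_zero, add_zero]
  · simp only [Pi.add_apply, Pi.smul_apply, smul_eq_mul, Finset.sum_add_distrib,
      ← Finset.mul_sum, hu.2.1, hlam.2.1, mul_zero, add_zero]
  · simpa [hlam.2.2.2 j hj] using hu.2.2.1 j hj
  · simpa [hlam.2.2.2 j fun h => hj (hKJ h)] using hu.2.2.2 j hj

/-- The order on `lam` forces the part of `i` not to come after that of `j`; the angles then differ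
by a sum of `β r` with `s < r < t`, all nonnegative in the fan. -/
theorem angle_le_of_isOrderVector {lam : Fin (n + 1) → ℝ} (hlam : IsOrderVector σ K s t lam)
    {β : Fin k → ℝ} (hβ : β ∈ gapFan s t) {i j : Fin (n + 1)} (hi : i ∈ K ∩ upperSide σ s t)
    (hj : j ∈ K ∩ upperSide σ s t) (hij : lam i ≤ lam j) : σ.angle β i ≤ σ.angle β j := by
  have hpos : ¬ position s (σ.part j) < position s (σ.part i) :=
    fun h => (hlam.2.1 j hj i hi h).not_ge hij
  have hi' := mem_upperSide.1 (Finset.mem_inter.1 hi).2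
  have hj' := mem_upperSide.1 (Finset.mem_inter.1 hj).2
  simp only [position, not_le.2 hi'.1, not_le.2 hj'.1, if_false, Fin.val_fin_lt, not_lt] at hpos
  rw [σ.angle_eq_sum, σ.angle_eq_sum]
  refine Finset.sum_le_sum fun r _ => ?_
  split_ifs with h1 h2 h2
  · exact le_rfl
  · omega
  · exact hβ.2 r (by omega) (by omega)
  · exact le_rfl

/-- The mirror statement on `K_-`, where `lam` decreases along the circle; here the angle difference
is a sum of `β r` over gaps outside the interval from `s` to `t`. -/
theorem angle_ge_of_isOrderVector (hst : s < t) {lam : Fin (n + 1) → ℝ} (hlam : IsOrderVector σ K s t lam)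
    {β : Fin k → ℝ} (hβ : β ∈ gapFan s t) {i j : Fin (n + 1)} (hi : i ∈ K \ upperSide σ s t)
    (hj : j ∈ K \ upperSide σ s t) (hij : lam i ≤ lam j) : σ.angle β j ≤ σ.angle β i := by
  have hpos : ¬ position s (σ.part i) < position s (σ.part j) :=
    fun h => (hlam.2.2 i hi j hj h).not_ge hij
  have hi' := (Finset.mem_sdiff.1 hi).2
  have hj' := (Finset.mem_sdiff.1 hj).2
  rw [mem_upperSide] at hi' hj'
  -- The total of `β` is zero, so a full turn may be added for the parts up to `s` at no cost; in
  -- the circle cut at `s` the comparison becomes termwise.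
  have h0 : ∀ i, σ.angle β i = ∑ r, ((if r < σ.part i then β r else 0) +
      if σ.part i ≤ s then β r else 0) := fun i => by
    simp only [Finset.sum_add_distrib, ← σ.angle_eq_sum]
    split_ifs
    · rw [hβ.1, add_zero]
    · simp
  rw [h0, h0]
  refine Finset.sum_le_sum fun r _ => ?_
  have hr := hβ.2 r
  have hik := (σ.part i).isLt
  have hjk := (σ.part j).isLt
  simp only [position] at hpos
  split_ifs at hpos ⊢ <;> first | linarith | (exfalso; omega) | skip
  all_goals have := hr (by omega) (by omega); linarith

/-- Translation along `w + λ` exhibits `V × T_v` as the product of the local fan with a line. -/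
theorem bijOn_product (hst : s < t) (hKJ : K ⊆ J) (hA : (K ∩ upperSide σ s t).Nonempty)
    (hB : (K \ upperSide σ s t).Nonempty) {lam : Fin (n + 1) → ℝ}
    (hlam : IsOrderVector σ K s t lam) :
    BijOn (fun y : ((Fin (n + 1) → ℝ) × (Fin k → ℝ)) × ℝ =>
        (centering K (upperSide σ s t) y.1.1 + y.2 • lam, y.1.2 + y.2 • edgeVector s t))
      (pantsCone σ J K s t ×ˢ (univ : Set ℝ))
      (normalFanProduct J K (upperSide σ s t) ×ˢ gapFan s t) := by
  set U := upperSide σ s t with hU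
  have htime : ∀ u : Fin (n + 1) → ℝ, ∀ β ∈ gapFan s t, ∃! τ : ℝ,
      (∃ i ∈ topSet (K ∩ U) (u - τ • lam), ∃ j ∈ topSet (K \ U) (u - τ • lam),
        0 ≤ σ.angle (β - τ • edgeVector s t) j - σ.angle (β - τ • edgeVector s t) i) ∧
      (∃ i ∈ topSet (K ∩ U) (u - τ • lam), ∃ j ∈ topSet (K \ U) (u - τ • lam),
        σ.angle (β - τ • edgeVector s t) j - σ.angle (β - τ • edgeVector s t) i ≤ 0) := by
    intro u β hβ
    have h := existsUnique_balanced_time hA hB u lam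
      -- With this sign the deviation for a pair `(i, j)` is `d j + d i`, and `d` is antitone in
      -- `lam` on both sides. Subtracting `τ • w` adds exactly `τ`.
      (fun i => if i ∈ U then -σ.angle β i else σ.angle β i)
      (fun i hi j hj hij => by
        simp only [(Finset.mem_inter.1 hi).2, (Finset.mem_inter.1 hj).2, if_true]
        exact neg_le_neg (angle_le_of_isOrderVector hlam hβ hi hj hij))
      (fun i hi j hj hij => by
        simp only [(Finset.mem_sdiff.1 hi).2, (Finset.mem_sdiff.1 hj).2, if_false]
        exact angle_ge_of_isOrderVector hst hlam hβ hi hj hij)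
    convert h using 2 with τ
    have key : ∀ i ∈ topSet (K ∩ U) (u - τ • lam), ∀ j ∈ topSet (K \ U) (u - τ • lam),
        σ.angle (β - τ • edgeVector s t) j - σ.angle (β - τ • edgeVector s t) i =
        (if j ∈ U then -σ.angle β j else σ.angle β j) +
          (if i ∈ U then -σ.angle β i else σ.angle β i) + τ := by
      intro i hi j hj
      have hi' := (Finset.mem_inter.1 (mem_topSet.1 hi).1).2
      have hj' := (Finset.mem_sdiff.1 (mem_topSet.1 hj).1).2
      have := angle_edgeVector_sub hst hi' hj'
      simp only [hi', hj', if_true, if_false, σ.angle_sub, σ.angle_smul]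
      linear_combination (-τ) * this
    refine and_congr ?_ ?_ <;>
    · refine exists_congr fun i => and_congr_right fun hi => exists_congr fun j =>
        and_congr_right fun hj => ?_
      rw [key i hi j hj]
  -- The time used to leave the cone is a balanced time for the endpoint, so by uniqueness the
  -- endpoint determines it.
  have hback : ∀ {ξ β} {τ : ℝ}, (ξ, β) ∈ pantsCone σ J K s t →
      (∃ i ∈ topSet (K ∩ U) (centering K U ξ + τ • lam - τ • lam),
        ∃ j ∈ topSet (K \ U) (centering K U ξ + τ • lam - τ • lam),
        0 ≤ σ.angle (β + τ • edgeVector s t - τ • edgeVector s t) j -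
          σ.angle (β + τ • edgeVector s t - τ • edgeVector s t) i) ∧
      (∃ i ∈ topSet (K ∩ U) (centering K U ξ + τ • lam - τ • lam),
        ∃ j ∈ topSet (K \ U) (centering K U ξ + τ • lam - τ • lam),
        σ.angle (β + τ • edgeVector s t - τ • edgeVector s t) j -
          σ.angle (β + τ • edgeVector s t - τ • edgeVector s t) i ≤ 0) := by
    intro ξ β τ h
    rw [add_sub_cancel_right, add_sub_cancel_right, topSet_inter_centering, topSet_sdiff_centering]
    exact ((mem_pantsCone_iff hA hB).1 h).2.2.2
  refine ⟨?_, ?_, ?_⟩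
  · rintro ⟨⟨ξ, β⟩, τ⟩ ⟨h, -⟩
    have h' := (mem_pantsCone_iff hA hB).1 h
    exact ⟨add_smul_mem_normalFanProduct hKJ (centering_mem hA hB hKJ h'.1) hlam.1 τ,
      add_smul_edgeVector_mem h'.2.1 τ⟩
  · rintro ⟨⟨ξ, β⟩, τ⟩ ⟨h, -⟩ ⟨⟨ξ', β'⟩, τ'⟩ ⟨h', -⟩ heq
    simp only [Prod.mk.injEq] at heq
    have g := (mem_pantsCone_iff hA hB).1 h
    have g' := (mem_pantsCone_iff hA hB).1 h'
    have h2 := hback (τ := τ') h'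
    rw [← heq.1, ← heq.2] at h2
    have hτ : τ = τ' := (htime _ _ (add_smul_edgeVector_mem g.2.1 τ)).unique (hback h) h2
    subst hτ
    have h3 := add_right_cancel heq.1
    have h4 := add_right_cancel heq.2
    rw [h4, eq_of_centering_eq hA hB g.1.1 g'.1.1 h3 (g.2.2.1.trans g'.2.2.1.symm)]
  · rintro ⟨u, β⟩ ⟨hu, hβ⟩
    obtain ⟨τ, hτ, -⟩ := htime u β hβ
    have hu' : u - τ • lam ∈ normalFanProduct J K U := by
      have := add_smul_mem_normalFanProduct hKJ hu hlam.1 (-τ)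
      rwa [neg_smul, ← sub_eq_add_neg] at this
    have hβ' : β - τ • edgeVector s t ∈ gapFan s t := by
      have := add_smul_edgeVector_mem hβ (-τ)
      rwa [neg_smul, ← sub_eq_add_neg] at this
    obtain ⟨ξ, h1, h2, h3⟩ := exists_centering_eq hA hB hKJ hu' 0
    refine ⟨((ξ, β - τ • edgeVector s t), τ), ⟨(mem_pantsCone_iff hA hB).2 ⟨h1, hβ', h3, ?_⟩,
      trivial⟩, ?_⟩
    · have ha := topSet_inter_centering (K := K) (U := U) ξ
      have hb := topSet_sdiff_centering (K := K) (U := U) ξ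
      rw [← hU, ← ha, ← hb, h2]
      exact hτ
    · simp [h2]

end Product

/-! ### Polyhedrality -/

section Polyhedral

theorem IsConvexPolyhedron.prod {E F : Type*} [AddCommGroup E] [Module ℝ E] [AddCommGroup F]
    [Module ℝ F] {C : Set E} {D : Set F} (hC : IsConvexPolyhedron C)
    (hD : IsConvexPolyhedron D) : IsConvexPolyhedron (C ×ˢ D) :=
  (hC.preimage (LinearMap.fst ℝ E F).toAffineMap).inter
    (hD.preimage (LinearMap.snd ℝ E F).toAffineMap)

theorem IsPolyhedral.prod_univ {E F : Type*} [AddCommGroup E] [Module ℝ E] [AddCommGroup F]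
    [Module ℝ F] {S : Set E} (hS : IsPolyhedral S) : IsPolyhedral (S ×ˢ (univ : Set F)) := by
  rw [Set.prod_univ]
  exact hS.preimage (LinearMap.fst ℝ E F).toAffineMap

theorem isPolyhedral_const {E : Type*} [AddCommGroup E] [Module ℝ E] (p : Prop) :
    IsPolyhedral {_x : E | p} := by
  by_cases hp : p
  · simpa [hp] using isConvexPolyhedron_univ.isPolyhedral
  · simpa [hp] using isConvexPolyhedron_empty.isPolyhedral

theorem isLinearMap_sum {ι : Type*} [Fintype ι] : IsLinearMap ℝ fun x : ι → ℝ => ∑ i, x i :=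
  ⟨fun _ _ => by simp [Finset.sum_add_distrib], fun _ _ => by simp [Finset.mul_sum]⟩

theorem isLinearMap_apply {ι : Type*} (i : ι) : IsLinearMap ℝ fun x : ι → ℝ => x i :=
  ⟨fun _ _ => rfl, fun _ _ => rfl⟩

theorem isLinearMap_zero {E : Type*} [AddCommGroup E] [Module ℝ E] :
    IsLinearMap ℝ fun _ : E => (0 : ℝ) :=
  ⟨fun _ _ => by simp, fun _ _ => by simp⟩

variable {n k : ℕ}

theorem isConvexPolyhedron_fanSimplex (J K : Finset (Fin (n + 1))) :
    IsConvexPolyhedron (fanSimplex J K) :=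
  (isConvexPolyhedron_eq isLinearMap_sum isLinearMap_zero).and <|
    (IsConvexPolyhedron.forall fun j => .imp fun _ =>
      isConvexPolyhedron_le isLinearMap_zero (isLinearMap_apply j)).and <|
    IsConvexPolyhedron.forall fun j => .imp fun _ =>
      isConvexPolyhedron_eq (isLinearMap_apply j) isLinearMap_zero

theorem isConvexPolyhedron_gapFan (s t : Fin k) : IsConvexPolyhedron (gapFan s t) :=
  (isConvexPolyhedron_eq isLinearMap_sum isLinearMap_zero).and <|
    IsConvexPolyhedron.forall fun r => .imp fun _ => .imp fun _ =>
      isConvexPolyhedron_le isLinearMap_zero (isLinearMap_apply r)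

theorem isPolyhedral_mem_topSet {ι : Type*} [Finite ι] (K : Finset ι) (i : ι) :
    IsPolyhedral {x : ι → ℝ | i ∈ topSet K x} := by
  simp only [mem_topSet]
  exact (isPolyhedral_const _).and (IsConvexPolyhedron.isPolyhedral <|
    IsConvexPolyhedron.forall fun j => .imp fun _ =>
      isConvexPolyhedron_le (isLinearMap_apply j) (isLinearMap_apply i))

theorem isPolyhedral_pantsCone (σ : CyclicPartition n k) (J K : Finset (Fin (n + 1)))
    (s t : Fin k) : IsPolyhedral (pantsCone σ J K s t) := by
  have htop : ∀ i, IsPolyhedral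
      {y : (Fin (n + 1) → ℝ) × (Fin k → ℝ) | i ∈ topSet K y.1} := fun i =>
    (isPolyhedral_mem_topSet K i).preimage (LinearMap.fst ℝ (Fin (n + 1) → ℝ) (Fin k → ℝ)).toAffineMap
  have hlin : ∀ i j, IsLinearMap ℝ fun y : (Fin (n + 1) → ℝ) × (Fin k → ℝ) =>
      σ.angle y.2 j - σ.angle y.2 i := fun i j =>
    (((σ.isLinearMap_angle j).mk' - (σ.isLinearMap_angle i).mk') ∘ₗ
      LinearMap.snd ℝ (Fin (n + 1) → ℝ) (Fin k → ℝ)).isLinear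
  exact ((isConvexPolyhedron_fanSimplex J K).prod
    (isConvexPolyhedron_gapFan s t)).isPolyhedral.and <|
    (IsPolyhedral.exists fun i => (htop i).and <| (isPolyhedral_const _).and <|
      IsPolyhedral.exists fun j => (htop j).and <| (isPolyhedral_const _).and <|
        (isConvexPolyhedron_le isLinearMap_zero (hlin i j)).isPolyhedral).and <|
    (IsPolyhedral.exists fun i => (htop i).and <| (isPolyhedral_const _).and <|
      IsPolyhedral.exists fun j => (htop j).and <| (isPolyhedral_const _).and <|
        (isConvexPolyhedron_le (hlin i j) isLinearMap_zero).isPolyhedral)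

theorem isPolyhedral_heightGap_eq_zero {J K U : Finset (Fin (n + 1))} (hA : (K ∩ U).Nonempty)
    (hB : (K \ U).Nonempty) :
    IsPolyhedral {ξ | ξ ∈ fanSimplex J K ∧ heightGap K U ξ = 0} := by
  simp only [heightGap_eq_zero_iff hA hB]
  exact (isConvexPolyhedron_fanSimplex J K).isPolyhedral.and <|
    (IsPolyhedral.exists fun i =>
      (isPolyhedral_mem_topSet K i).and (isPolyhedral_const (i ∈ U))).and <|
    (IsPolyhedral.exists fun i =>
      (isPolyhedral_mem_topSet K i).and (isPolyhedral_const (i ∉ U)))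

theorem isPLOn_heightGap {K U : Finset (Fin (n + 1))} (hA : (K ∩ U).Nonempty)
    (hB : (K \ U).Nonempty) : IsPLOn (heightGap K U) univ := by
  have hpoly : ∀ (A : Finset (Fin (n + 1))), ∀ i ∈ A,
      IsConvexPolyhedron {x : Fin (n + 1) → ℝ | i ∈ topSet A x} := fun A i hi => by
    simp only [mem_topSet, hi, true_and]
    exact IsConvexPolyhedron.forall fun j => .imp fun _ =>
      isConvexPolyhedron_le (isLinearMap_apply j) (isLinearMap_apply i)
  refine ⟨image2 (fun i j => {x | i ∈ topSet (K ∩ U) x} ∩ {x | j ∈ topSet (K \ U) x})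
    (K ∩ U : Finset _) (K \ U : Finset _),
    (Finset.finite_toSet _).image2 _ (Finset.finite_toSet _), ?_, ?_⟩
  · refine (eq_univ_of_forall fun x => ?_).symm
    obtain ⟨i, hi⟩ := topSet_nonempty hA x
    obtain ⟨j, hj⟩ := topSet_nonempty hB x
    exact ⟨_, ⟨i, (mem_topSet.1 hi).1, j, (mem_topSet.1 hj).1, rfl⟩, hi, hj⟩
  · rintro _ ⟨i, hi, j, hj, rfl⟩
    refine ⟨(hpoly _ i hi).inter (hpoly _ j hj), ((isLinearMap_apply i).mk' -
      (isLinearMap_apply j).mk' : (Fin (n + 1) → ℝ) →ₗ[ℝ] ℝ).toAffineMap, fun x hx => ?_⟩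
    rw [heightGap_eq hx.1 hx.2]
    rfl

end Polyhedral

/-! ### Every point of the stratum lies in the star of a vertex; existence of order vectors;
closedness. -/

section Star

variable {n k : ℕ} {σ : CyclicPartition n k}

/-- If the gap `α s` exceeds `π`, cutting the circle there leaves all points in an arc of length `2π
- α s < π`. -/
theorem gap_le_pi_of_surrounds {α : Fin k → ℝ} (hα : α ∈ gapSimplex k)
    {I : Finset (Fin (n + 1))} (h : Surrounds I (σ.angle α)) (s : Fin k) : α s ≤ Real.pi := by
  by_contra hlt
  let l : Fin (n + 1) → ℝ := fun i => σ.angle α i + if σ.part i ≤ s then 2 * Real.pi else 0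
  have hl : ∀ i, l i = ∑ r, ((if r < σ.part i then α r else 0) +
      if σ.part i ≤ s then α r else 0) := fun i => by
    simp only [l, Finset.sum_add_distrib, ← σ.angle_eq_sum]
    split_ifs
    · rw [hα.2]
    · simp
  have hsum : (∑ r, if r = s then 0 else α r) = 2 * Real.pi - α s := by
    rw [← hα.2, ← Finset.add_sum_erase _ _ (Finset.mem_univ s),
      ← Finset.add_sum_erase _ _ (Finset.mem_univ s), if_pos rfl]
    have : ∑ r ∈ Finset.univ.erase s, (if r = s then 0 else α r) =
        ∑ r ∈ Finset.univ.erase s, α r :=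
      Finset.sum_congr rfl fun r hr => if_neg (Finset.ne_of_mem_erase hr)
    rw [this]
    ring
  refine not_surrounds_of_lift (l := l) (fun i => if σ.part i ≤ s then 1 else 0) (fun i _ => ?_)
    (fun i _ j _ => ?_) h
  · simp only [l]
    split_ifs <;> simp
  · refine lt_of_le_of_lt (b := ∑ r, if r = s then 0 else α r) ?_ (by linarith)
    rw [hl, hl, ← Finset.sum_sub_distrib]
    refine Finset.sum_le_sum fun r _ => ?_
    have := hα.1 r
    split_ifs <;> first | linarith | (exfalso; omega)

/-- If no gap exceeds `π`, then the gaps lie in the star of the midpoint of an edge. -/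
theorem exists_star {α : Fin k → ℝ} (hα : α ∈ gapSimplex k) (hle : ∀ r, α r ≤ Real.pi) :
    ∃ s t : Fin k, s < t ∧ 0 < α s ∧ 0 < α t ∧
      (∑ r, if s < r ∧ r < t then α r else 0) < Real.pi ∧
      (∑ r, if r < s ∨ t < r then α r else 0) < Real.pi := by
  have hpi := Real.pi_pos
  have hex : ∃ s, 0 < α s := by
    by_contra hcon
    push Not at hcon
    have := Finset.sum_nonpos fun r (_ : r ∈ Finset.univ) => hcon r
    rw [hα.2] at this
    linarith
  -- Choose `s` as the first positive gap and `t` as the gap during which the partial sum passes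
  -- `π`.
  obtain ⟨s, hs, hsmin⟩ : ∃ s, 0 < α s ∧ ∀ r < s, α r = 0 := by
    obtain ⟨s, hs⟩ := (Finset.univ.filter fun s => 0 < α s).exists_minimal
      (by obtain ⟨s, hs⟩ := hex; exact ⟨s, by simpa using hs⟩)
    simp only [Minimal, Finset.mem_filter, Finset.mem_univ, true_and] at hs
    refine ⟨s, hs.1, fun r hr => ?_⟩
    by_contra hne
    exact (hs.2 (lt_of_le_of_ne (hα.1 r) (Ne.symm hne)) hr.le).not_gt hr
  obtain ⟨t, ht, ht'⟩ : ∃ t, (∑ r, if r < t then α r else 0) ≤ Real.pi ∧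
      Real.pi < ∑ r, if r ≤ t then α r else 0 := by
    obtain ⟨t, ht⟩ := (Finset.univ.filter
      fun t : Fin k => (∑ r, if r < t then α r else 0) ≤ Real.pi).exists_maximal
      ⟨⟨0, s.pos⟩, by
        rw [Finset.mem_filter]
        refine ⟨Finset.mem_univ _, ?_⟩
        rw [Finset.sum_eq_zero fun r _ => if_neg (by simp [Fin.lt_def])]
        exact hpi.le⟩
    simp only [Maximal, Finset.mem_filter, Finset.mem_univ, true_and] at ht
    refine ⟨t, ht.1, ?_⟩
    by_cases hlast : t.val + 1 < k
    · by_contra hcon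
      have h1 : (∑ r : Fin k, if r < ⟨t.val + 1, hlast⟩ then α r else 0) =
          ∑ r, if r ≤ t then α r else 0 :=
        Finset.sum_congr rfl fun r _ => if_congr (by rw [Fin.lt_def, Fin.le_def]; exact Nat.lt_succ_iff)
          rfl rfl
      have h2 := ht.2 (h1.trans_le (not_lt.1 hcon)) (by rw [Fin.le_def]; simp)
      rw [Fin.le_def] at h2
      simp at h2
    · have : (∑ r, if r ≤ t then α r else 0) = ∑ r, α r :=
        Finset.sum_congr rfl fun r _ => if_pos (by rw [Fin.le_def]; omega)
      rw [this, hα.2]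
      linarith
  have hsingle : ∀ a : Fin k, (∑ r, if r = a then α r else 0) = α a := fun a => by simp
  -- If `t ≤ s`, the partial sum through `t` would be at most `α s`, hence at most `π`.
  have hst : s < t := by
    by_contra hcon
    have : (∑ r, if r ≤ t then α r else 0) ≤ ∑ r, if r = s then α r else 0 := by
      refine Finset.sum_le_sum fun r _ => ?_
      by_cases hr : r = s
      · simp only [hr, if_true]
        split_ifs
        · exact le_rfl
        · exact hs.le
      · rw [if_neg hr]
        split_ifs with h
        · exact (hsmin r (lt_of_le_of_ne (h.trans (not_lt.1 hcon)) hr)).le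
        · exact le_rfl
    rw [hsingle] at this
    linarith [hle s]
  refine ⟨s, t, hst, hs, ?_, ?_, ?_⟩
  · have : (∑ r, if r ≤ t then α r else 0) =
        (∑ r, if r < t then α r else 0) + ∑ r, if r = t then α r else 0 := by
      rw [← Finset.sum_add_distrib]
      refine Finset.sum_congr rfl fun r _ => ?_
      split_ifs <;> first | (exfalso; omega) | simp
    rw [hsingle] at this
    linarith
  · have : (∑ r, if r = s then α r else 0) + (∑ r, if s < r ∧ r < t then α r else 0) ≤
        ∑ r, if r < t then α r else 0 := by
      rw [← Finset.sum_add_distrib]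
      refine Finset.sum_le_sum fun r _ => ?_
      have := hα.1 r
      split_ifs <;> first | linarith | (exfalso; omega)
    rw [hsingle] at this
    linarith
  · have : (∑ r, if r < s ∨ t < r then α r else 0) + (∑ r, if r ≤ t then α r else 0) ≤
        ∑ r, α r := by
      rw [← Finset.sum_add_distrib]
      refine Finset.sum_le_sum fun r _ => ?_
      have h1 := hα.1 r
      by_cases hr : r < s
      · simp [hsmin r hr]
      · split_ifs <;> first | linarith | (exfalso; omega)
    rw [hα.2] at this
    linarith

/-- The position itself on `K_+` and its negative on `K_-`, recentred. -/
theorem exists_isOrderVector (σ : CyclicPartition n k) {K : Finset (Fin (n + 1))} {s t : Fin k}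
    (hA : (K ∩ upperSide σ s t).Nonempty) (hB : (K \ upperSide σ s t).Nonempty) :
    ∃ lam, IsOrderVector σ K s t lam := by
  classical
  set U := upperSide σ s t
  let x : Fin (n + 1) → ℝ := fun i =>
    if i ∈ U then (position s (σ.part i) : ℝ) else -(position s (σ.part i) : ℝ)
  let y : Fin (n + 1) → ℝ := fun i => if i ∈ K then x i else 0
  have hshift := centering_eq_shift (K := K) (U := U) y
  have h1 : ((K ∩ U).card : ℝ) ≠ 0 := by exact_mod_cast hA.card_pos.ne'
  have h2 : ((K \ U).card : ℝ) ≠ 0 := by exact_mod_cast hB.card_pos.ne'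
  refine ⟨centering K U y, ⟨?_, ?_, fun j hj => ?_, fun j hj => ?_⟩, fun i hi j hj h => ?_,
    fun i hi j hj h => ?_⟩
  · rw [hshift, sum_inter_shift]
    field_simp
    ring
  · rw [hshift, sum_sdiff_shift]
    field_simp
    ring
  · rw [centering_of_notMem hj]; simp [y, hj]
  · rw [centering_of_notMem hj]; simp [y, hj]
  · rw [hshift, shift_of_mem_inter hi, shift_of_mem_inter hj]
    obtain ⟨hiK, hiU : i ∈ U⟩ := Finset.mem_inter.1 hi
    obtain ⟨hjK, hjU : j ∈ U⟩ := Finset.mem_inter.1 hj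
    simpa [y, x, hiK, hiU, hjK, hjU] using h
  · rw [hshift, shift_of_mem_sdiff hi, shift_of_mem_sdiff hj]
    obtain ⟨hiK, hiU : i ∉ U⟩ := Finset.mem_sdiff.1 hi
    obtain ⟨hjK, hjU : j ∉ U⟩ := Finset.mem_sdiff.1 hj
    simpa [y, x, hiK, hiU, hjK, hjU] using h

/-- Used for points off the stratum, which therefore have a neighbourhood missing it. -/
theorem isClosed_surrounds (σ : CyclicPartition n k) :
    IsClosed {y : (Fin (n + 1) → ℝ) × (Fin k → ℝ) |
      Surrounds (topSet Finset.univ y.1) (σ.angle y.2)} := by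
  have : {y : (Fin (n + 1) → ℝ) × (Fin k → ℝ) |
      Surrounds (topSet Finset.univ y.1) (σ.angle y.2)} =
      ⋂ φ : ℝ, ⋃ i, (⋂ j, {y | y.1 j ≤ y.1 i}) ∩ {y | Real.cos (σ.angle y.2 i - φ) ≤ 0} := by
    ext
    simp [Surrounds, mem_topSet]
  rw [this]
  refine isClosed_iInter fun φ => isClosed_iUnion_of_finite fun i => IsClosed.inter
    (isClosed_iInter fun j => isClosed_le (by fun_prop) (by fun_prop)) (isClosed_le ?_ (by fun_prop))
  simp only [CyclicPartition.angle]
  fun_prop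

end Star

/-! ### Local flatness -/

section Charts

/-- A piecewise linear identification of a neighbourhood with an orthant gives a flat chart; the
coordinates in `B`, which are bounded below, are normalized to have lower bound `-1`. -/
theorem exists_flat_chart_of_cone {E κ : Type*} [NormedAddCommGroup E] [NormedSpace ℝ E]
    [FiniteDimensional ℝ E] [Finite κ] {q : ℕ} (e : Fin q ≃ κ) {X Y C : Set E} {B : Set κ}
    [DecidablePred (· ∈ B)] {F : E → κ → ℝ} {p v : E} (hp : p ∈ X) (hF : IsPLOn F C)
    (hbij : BijOn F C {z | ∀ i ∈ B, 0 ≤ z i}) (hB : ∀ i ∈ B, F (p - v) i < 8)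
    (hX : ∀ᶠ x in 𝓝 p, x ∈ X ↔ x - v ∈ C)
    (hY : ∀ᶠ x in 𝓝 p, x - v ∈ C → (x ∈ Y ↔ ∀ i : Fin q, i.val < 2 →
      (if e i ∈ B then F (x - v) (e i) / 8 - 1 else F (x - v) (e i) - F (p - v) (e i)) = 0)) :
    ∃ (N : Set E) (N' : Set (Fin q → ℝ)) (f : E → (Fin q → ℝ)),
    N ⊆ X ∧ N ∈ 𝓝[X] p ∧ N' ⊆ stdCube q ∧ N' ∈ 𝓝[stdCube q] (f p) ∧
    IsPLHomeo f N N' ∧ f '' (N ∩ Y) = N' ∩ stdSubcube q := by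
  -- A coordinate bounded below by `0` is rescaled so that its wall sits at `-1`; by `hB` its value
  -- at `p` stays negative. The other coordinates are translated so that `p` goes to `0`.
  let f : E → Fin q → ℝ := fun x i =>
    if e i ∈ B then F (x - v) (e i) / 8 - 1 else F (x - v) (e i) - F (p - v) (e i)
  let T : E →ᵃ[ℝ] E := AffineMap.id ℝ E - AffineMap.const ℝ E v
  have hW : IsPolyhedral {x | x - v ∈ C} := hF.isPolyhedral.preimage T
  have hf : IsPLOn f {x | x - v ∈ C} := by
    have h1 : IsPLOn (F ∘ T) {x | x - v ∈ C} := hF.comp (hW.isPLOn T) fun x hx => hx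
    let L : (κ → ℝ) →ₗ[ℝ] (Fin q → ℝ) := LinearMap.pi fun i =>
      (if e i ∈ B then (1 / 8 : ℝ) else 1) • LinearMap.proj (e i)
    convert h1.affine_comp (L.toAffineMap + AffineMap.const ℝ (κ → ℝ)
      (fun i => if e i ∈ B then (-1 : ℝ) else -F (p - v) (e i))) using 1
    ext x i
    by_cases hi : e i ∈ B
    · simp only [f, hi, if_true, L, T, AffineMap.coe_add, Pi.add_apply, LinearMap.coe_toAffineMap,
        LinearMap.pi_apply, LinearMap.smul_apply, LinearMap.proj_apply, AffineMap.coe_const,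
        Function.const_apply, Function.comp_apply, AffineMap.coe_sub, Pi.sub_apply,
        AffineMap.coe_id, id_eq, smul_eq_mul]
      ring
    · simp only [f, hi, if_false, L, T, AffineMap.coe_add, Pi.add_apply, LinearMap.coe_toAffineMap,
        LinearMap.pi_apply, LinearMap.smul_apply, LinearMap.proj_apply, AffineMap.coe_const,
        Function.const_apply, Function.comp_apply, AffineMap.coe_sub, Pi.sub_apply,
        AffineMap.coe_id, id_eq, smul_eq_mul]
      ring
  refine exists_flat_chart (B := {i | e i ∈ B}) hp hf ⟨?_, ?_, ?_⟩ (fun i => ?_) (fun i hi => ?_)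
    hX hY
  · intro x hx i (hi : e i ∈ B)
    have := hbij.mapsTo hx (e i) hi
    simp only [f, hi, if_true]
    linarith
  · intro x hx y hy hxy
    have : F (x - v) = F (y - v) := by
      ext a
      obtain ⟨i, rfl⟩ := e.surjective a
      have := congrFun hxy i
      simp only [f] at this
      split_ifs at this <;> linarith
    exact sub_left_injective (hbij.injOn hx hy this)
  · intro z hz
    obtain ⟨y, hy, hyz⟩ := hbij.surjOn (a := fun a =>
      if a ∈ B then 8 * (z (e.symm a) + 1) else z (e.symm a) + F (p - v) a) (fun a ha => by
        have := hz (e.symm a) (by simpa using ha)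
        simp only [ha, if_true]
        linarith)
    refine ⟨y + v, by simpa using hy, ?_⟩
    ext i
    have := congrFun hyz (e i)
    simp only [f, add_sub_cancel_right, this, Equiv.symm_apply_apply]
    split_ifs <;> ring
  · simp only [f]
    split_ifs with h
    · linarith [hB _ h]
    · simp
  · have : e i ∉ B := hi
    simp [f, this]

/-- The subcube kills the coordinates of index below two, so the two transverse coordinates must be
numbered first. -/
theorem exists_equiv_fin_two_sum {κ : Type*} [Fintype κ] {q : ℕ} (h : q = 2 + Fintype.card κ) :
    ∃ e : Fin q ≃ Fin 2 ⊕ κ, (∀ i : Fin q, i.val < 2 → ∃ a, e i = Sum.inl a) ∧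
      ∀ a, ∃ i : Fin q, i.val < 2 ∧ e i = Sum.inl a := by
  subst h
  refine ⟨finSumFinEquiv.symm.trans (Equiv.sumCongr (Equiv.refl _) (Fintype.equivFin κ).symm),
    fun i hi => ⟨⟨i, hi⟩, ?_⟩, fun a => ⟨Fin.castAdd _ a, a.isLt, by simp⟩⟩
  exact congrArg _ (finSumFinEquiv_symm_apply_castAdd (⟨i, hi⟩ : Fin 2))

variable {n k : ℕ} {σ : CyclicPartition n k} {J K : Finset (Fin (n + 1))} {s t : Fin k}

theorem isLinearMap_product (K U : Finset (Fin (n + 1))) (lam : Fin (n + 1) → ℝ) (w : Fin k → ℝ) :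
    IsLinearMap ℝ fun y : ((Fin (n + 1) → ℝ) × (Fin k → ℝ)) × ℝ =>
      (centering K U y.1.1 + y.2 • lam, y.1.2 + y.2 • w) := by
  constructor
  · intro x y
    simp only [Prod.fst_add, Prod.snd_add, (isLinearMap_centering K U).map_add, add_smul,
      Prod.mk_add_mk]
    congr 1 <;> abel
  · intro c x
    simp only [Prod.smul_fst, Prod.smul_snd, (isLinearMap_centering K U).map_smul, smul_add,
      smul_eq_mul, mul_smul, Prod.smul_mk]

/-- The time coordinate of the product decomposition of `V × T_v`. -/
theorem exists_time (hst : s < t) (hKJ : K ⊆ J) (hA : (K ∩ upperSide σ s t).Nonempty)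
    (hB : (K \ upperSide σ s t).Nonempty) {lam : Fin (n + 1) → ℝ}
    (hlam : IsOrderVector σ K s t lam) :
    ∃ τ : (Fin (n + 1) → ℝ) × (Fin k → ℝ) → ℝ,
      IsPLOn τ (normalFanProduct J K (upperSide σ s t) ×ˢ gapFan s t) ∧
      (∀ u ∈ normalFanProduct J K (upperSide σ s t), ∀ β ∈ gapFan s t, ∀ a : ℝ,
        τ (u + a • lam, β + a • edgeVector s t) = τ (u, β) + a) ∧
      ∀ ξ ∈ fanSimplex J K, ∀ β ∈ gapFan s t, (ξ, β) ∈ pantsCone σ J K s t ↔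
        heightGap K (upperSide σ s t) ξ = 0 ∧ τ (centering K (upperSide σ s t) ξ, β) = 0 := by
  have hbij := bijOn_product hst hKJ hA hB hlam
  set U := upperSide σ s t with hU
  set Φ := fun y : ((Fin (n + 1) → ℝ) × (Fin k → ℝ)) × ℝ =>
        (centering K U y.1.1 + y.2 • lam, y.1.2 + y.2 • edgeVector s t) with hΦ
  have hlin : IsLinearMap ℝ Φ := isLinearMap_product K U lam (edgeVector s t)
  obtain ⟨-, -, g, hg, hgm, hgl, hgr⟩ :=
    ((isPolyhedral_pantsCone σ J K s t).prod_univ.isPLOn_of_isLinearMap hlin).isPLHomeo hbij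
  refine ⟨fun z => (g z).2, hg.affine_comp (LinearMap.snd ℝ ((Fin (n + 1) → ℝ) × (Fin k → ℝ))
    ℝ).toAffineMap, fun u hu β hβ a => ?_, fun ξ hξ β hβ => ?_⟩
  · have h1 := hgr (show (u, β) ∈ _ from ⟨hu, hβ⟩)
    have h2 := hgm (show (u, β) ∈ _ from ⟨hu, hβ⟩)
    -- Flowing for an additional time `a` keeps the base point in the cone; injectivity of `Φ` then
    -- reads off the new time.
    have h3 : Φ ((g (u, β)).1, (g (u, β)).2 + a) = (u + a • lam, β + a • edgeVector s t) := by
      have h4 : (u, β) + a • (lam, edgeVector s t) = (u + a • lam, β + a • edgeVector s t) := rfl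
      have h5 : ∀ y b, Φ (y, b + a) = Φ (y, b) + a • (lam, edgeVector s t) := fun y b => by
        simp only [hΦ, add_smul, Prod.smul_mk, Prod.mk_add_mk, add_assoc]
      rw [← h4, h5]
      exact congrArg (· + a • (lam, edgeVector s t)) h1
    have h4 := hgl (show ((g (u, β)).1, (g (u, β)).2 + a) ∈ _ from ⟨h2.1, trivial⟩)
    rw [h3] at h4
    simp only [h4]
  · have hz : (centering K U ξ, β) ∈ normalFanProduct J K U ×ˢ gapFan s t :=
      ⟨centering_mem hA hB hKJ hξ, hβ⟩
    constructor
    · intro h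
      refine ⟨((mem_pantsCone_iff hA hB).1 h).2.2.1, ?_⟩
      have h1 := hgl (show ((ξ, β), (0 : ℝ)) ∈ _ from ⟨h, trivial⟩)
      have h2 : Φ ((ξ, β), 0) = (centering K U ξ, β) := by simp [hΦ]
      rw [h2] at h1
      simp only [h1]
    · rintro ⟨h1, h2 : (g (centering K U ξ, β)).2 = 0⟩
      have h3 := hgr hz
      have h4 := (hgm hz).1
      obtain ⟨⟨⟨ξ', β'⟩, τ⟩, hy⟩ : ∃ y, g (centering K U ξ, β) = y := ⟨_, rfl⟩
      rw [hy] at h2 h3 h4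
      simp only at h2
      subst h2
      simp only [hΦ, zero_smul, add_zero, Prod.mk.injEq] at h3
      have h5 := (mem_pantsCone_iff hA hB).1 h4
      have h6 : ξ' = ξ := eq_of_centering_eq hA hB h5.1.1 hξ.1 h3.1 (h5.2.2.1.trans h1.symm)
      rw [← h6, ← h3.2]
      exact h4

/-- Dropping one coordinate on each side gives linear coordinates on `V`, since each side has sum
zero. -/
theorem eq_of_mem_normalFanProduct {U : Finset (Fin (n + 1))} {u u' : Fin (n + 1) → ℝ}
    (hu : u ∈ normalFanProduct J K U) (hu' : u' ∈ normalFanProduct J K U) {a b : Fin (n + 1)}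
    (ha : a ∈ K ∩ U) (hb : b ∈ K \ U)
    (h : ∀ i ∈ J, i ≠ a → i ≠ b → u i = u' i) : u = u' := by
  have h' : ∀ i, i ≠ a → i ≠ b → u i = u' i := fun i hia hib => by
    by_cases hi : i ∈ J
    · exact h i hi hia hib
    · rw [hu.2.2.2 i hi, hu'.2.2.2 i hi]
  have key : ∀ {A : Finset (Fin (n + 1))} {a}, a ∈ A → ∑ i ∈ A, u i = 0 → ∑ i ∈ A, u' i = 0 →
      (∀ i ∈ A.erase a, u i = u' i) → u a = u' a := by
    intro A a ha h1 h2 h3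
    rw [← Finset.add_sum_erase _ _ ha] at h1 h2
    rw [Finset.sum_congr rfl h3] at h1
    linarith
  ext i
  by_cases hia : i = a
  · subst hia
    refine key ha hu.1 hu'.1 fun j hj => h' j (Finset.ne_of_mem_erase hj) ?_
    rintro rfl
    exact (Finset.mem_sdiff.1 hb).2 (Finset.mem_inter.1 (Finset.mem_of_mem_erase hj)).2
  · by_cases hib : i = b
    · subst hib
      refine key hb hu.2.1 hu'.2.1 fun j hj => h' j ?_ (Finset.ne_of_mem_erase hj)
      rintro rfl
      exact (Finset.mem_sdiff.1 (Finset.mem_of_mem_erase hj)).2 (Finset.mem_inter.1 ha).2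
    · exact h' i hia hib

theorem exists_mem_normalFanProduct {U : Finset (Fin (n + 1))} (hKJ : K ⊆ J) {a b : Fin (n + 1)}
    (ha : a ∈ K ∩ U) (hb : b ∈ K \ U) {z : Fin (n + 1) → ℝ} (hz : ∀ i ∈ J, i ∉ K → 0 ≤ z i) :
    ∃ u ∈ normalFanProduct J K U, ∀ i ∈ J, i ≠ a → i ≠ b → u i = z i := by
  have haU := Finset.mem_inter.1 ha
  have hbU := Finset.mem_sdiff.1 hb
  let u : Fin (n + 1) → ℝ := fun i =>
    if i = a then -∑ j ∈ (K ∩ U).erase a, z j else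
      if i = b then -∑ j ∈ (K \ U).erase b, z j else if i ∈ J then z i else 0
  have hu : ∀ i ∈ J, i ≠ a → i ≠ b → u i = z i := fun i hi h1 h2 => by simp [u, hi, h1, h2]
  have hab : b ≠ a := by rintro rfl; exact hbU.2 haU.2
  have hK : ∀ i, i ∉ K → i ≠ a ∧ i ≠ b := fun i hi =>
    ⟨fun h => hi (h ▸ haU.1), fun h => hi (h ▸ hbU.1)⟩
  refine ⟨u, ⟨?_, ?_, fun i hi => ?_, fun i hi => ?_⟩, hu⟩
  · rw [← Finset.add_sum_erase _ _ ha, Finset.sum_congr rfl fun i hi => hu i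
      (hKJ (Finset.mem_inter.1 (Finset.mem_of_mem_erase hi)).1) (Finset.ne_of_mem_erase hi) ?_]
    · simp [u]
    · rintro rfl
      exact hbU.2 (Finset.mem_inter.1 (Finset.mem_of_mem_erase hi)).2
  · rw [← Finset.add_sum_erase _ _ hb, Finset.sum_congr rfl fun i hi => hu i
      (hKJ (Finset.mem_sdiff.1 (Finset.mem_of_mem_erase hi)).1) ?_ (Finset.ne_of_mem_erase hi)]
    · simp [u, hab]
    · rintro rfl
      exact (Finset.mem_sdiff.1 (Finset.mem_of_mem_erase hi)).2 haU.2
  · by_cases hiJ : i ∈ J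
    · rw [hu i hiJ (hK i hi).1 (hK i hi).2]; exact hz i hiJ hi
    · simp [u, hK i hi, hiJ]
  · have := hK i fun h => hi (hKJ h)
    simp [u, this, hi]

theorem eq_of_mem_gapFan {β β' : Fin k → ℝ} (hβ : β ∈ gapFan s t) (hβ' : β' ∈ gapFan s t)
    (h : ∀ r, r ≠ t → β r = β' r) : β = β' := by
  ext r
  by_cases hr : r = t
  · have h1 := hβ.1
    have h2 := hβ'.1
    rw [← Finset.add_sum_erase _ _ (Finset.mem_univ t)] at h1 h2
    rw [Finset.sum_congr rfl fun i hi => h i (Finset.ne_of_mem_erase hi)] at h1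
    rw [hr]
    linarith
  · exact h r hr

theorem exists_mem_gapFan (z : Fin k → ℝ) (hz : ∀ r, r ≠ s → r ≠ t → 0 ≤ z r) :
    ∃ β ∈ gapFan s t, ∀ r, r ≠ t → β r = z r := by
  refine ⟨Function.update z t (-∑ r ∈ Finset.univ.erase t, z r), ⟨?_, fun r hr hr' => ?_⟩,
    fun r hr => Function.update_of_ne hr _ _⟩
  · rw [← Finset.add_sum_erase _ _ (Finset.mem_univ t), Finset.sum_congr rfl fun i hi =>
      Function.update_of_ne (Finset.ne_of_mem_erase hi) _ _]
    simp
  · rw [Function.update_of_ne hr']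
    exact hz r hr hr'

end Charts

/-! ### Charts on and off the stratum. -/

section FlatCharts

variable {n k : ℕ} {σ : CyclicPartition n k} {J K : Finset (Fin (n + 1))} {s t : Fin k}

/-- Coordinates of the fan of `Δ_J × Δ_σ` at a vertex in which the fan of the stratum is the
vanishing locus of the two coordinates in `Fin 2`. -/
def flatCoords (J : Finset (Fin (n + 1))) (K U : Finset (Fin (n + 1))) (s t : Fin k)
    (lam : Fin (n + 1) → ℝ) (τ : (Fin (n + 1) → ℝ) × (Fin k → ℝ) → ℝ) (a b : Fin (n + 1))
    (y : (Fin (n + 1) → ℝ) × (Fin k → ℝ)) :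
    Fin 2 ⊕ ({i // i ∈ (J.erase a).erase b} ⊕ {r : Fin k // r ∈ (Finset.univ.erase s).erase t}) →
      ℝ :=
  Sum.elim ![heightGap K U y.1, τ (centering K U y.1, y.2)]
    -- Since `w` has entry `1` at `s` and vanishes off `s` and `t`, these functions are constant
    -- along `w + λ`: they name the line, and the time coordinate locates the point on it.
    (Sum.elim (fun i => centering K U y.1 i - y.2 s * lam i) fun r => y.2 r)

/-- The coordinates which are bounded below on the fan of `Δ_J × Δ_σ`. -/
def boundaryCoords (J K : Finset (Fin (n + 1))) (s t : Fin k) (a b : Fin (n + 1)) :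
    Set (Fin 2 ⊕
      ({i // i ∈ (J.erase a).erase b} ⊕ {r : Fin k // r ∈ (Finset.univ.erase s).erase t})) :=
  {x | Sum.elim (fun _ => False) (Sum.elim (fun i => i.1 ∉ K) fun _ => True) x}

theorem forall_mem_boundaryCoords {a b : Fin (n + 1)} {p : Fin 2 ⊕
      ({i // i ∈ (J.erase a).erase b} ⊕ {r : Fin k // r ∈ (Finset.univ.erase s).erase t}) → Prop} :
    (∀ x ∈ boundaryCoords J K s t a b, p x) ↔
      (∀ i (hi : i ∈ (J.erase a).erase b), i ∉ K → p (Sum.inr (Sum.inl ⟨i, hi⟩))) ∧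
      ∀ r (hr : r ∈ (Finset.univ.erase s).erase t), p (Sum.inr (Sum.inr ⟨r, hr⟩)) := by
  simp [boundaryCoords]

theorem isPLOn_flatCoords {U : Finset (Fin (n + 1))} (hKJ : K ⊆ J) (hA : (K ∩ U).Nonempty)
    (hB : (K \ U).Nonempty) (lam : Fin (n + 1) → ℝ)
    {τ : (Fin (n + 1) → ℝ) × (Fin k → ℝ) → ℝ}
    (hτ : IsPLOn τ (normalFanProduct J K U ×ˢ gapFan s t)) (a b : Fin (n + 1)) :
    IsPLOn (flatCoords J K U s t lam τ a b) (fanSimplex J K ×ˢ gapFan s t) := by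
  have hS : IsPolyhedral (fanSimplex J K ×ˢ gapFan s t) :=
    ((isConvexPolyhedron_fanSimplex J K).prod (isConvexPolyhedron_gapFan s t)).isPolyhedral
  have h1 : IsPLOn (fun y : (Fin (n + 1) → ℝ) × (Fin k → ℝ) => heightGap K U y.1)
      (fanSimplex J K ×ˢ gapFan s t) :=
    (isPLOn_heightGap hA hB).comp (hS.isPLOn (LinearMap.fst ℝ (Fin (n + 1) → ℝ)
      (Fin k → ℝ)).toAffineMap) (mapsTo_univ _ _)
  have hc : IsLinearMap ℝ fun y : (Fin (n + 1) → ℝ) × (Fin k → ℝ) => (centering K U y.1, y.2) :=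
    ⟨fun x y => by simp [(isLinearMap_centering K U).map_add],
      fun c x => by simp [(isLinearMap_centering K U).map_smul]⟩
  have h2 := hτ.comp (hS.isPLOn_of_isLinearMap hc) fun y hy =>
    ⟨centering_mem hA hB hKJ hy.1, hy.2⟩
  have hL : IsLinearMap ℝ fun p : ((Fin (n + 1) → ℝ) × (Fin k → ℝ)) × ℝ × ℝ =>
      (Sum.elim ![p.2.1, p.2.2]
        (Sum.elim (fun i => centering K U p.1.1 i - p.1.2 s * lam i) fun r => p.1.2 r) :
        Fin 2 ⊕ ({i // i ∈ (J.erase a).erase b} ⊕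
          {r : Fin k // r ∈ (Finset.univ.erase s).erase t}) → ℝ) := by
    constructor
    · intro p p'
      ext (i | i | r)
      · fin_cases i <;> simp
      · simp only [Prod.fst_add, Prod.snd_add, (isLinearMap_centering K U).map_add, Sum.elim_inr,
          Sum.elim_inl, Pi.add_apply]
        ring
      · simp
    · intro c p
      ext (i | i | r)
      · fin_cases i <;> simp
      · simp only [Prod.smul_fst, Prod.smul_snd, (isLinearMap_centering K U).map_smul, Sum.elim_inr,
          Sum.elim_inl, Pi.smul_apply, smul_eq_mul]
        ring
      · simp
  exact ((hS.isPLOn (AffineMap.id ℝ _)).prodMk (h1.prodMk h2)).affine_comp hL.mk'.toAffineMap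

/-- Each line in the direction `w + λ` meets the slice where the `s`-entry is zero exactly once, and
the slice carries free coordinates. Along the line the time is a translation coordinate, and the
height gap restores what centering forgets. -/
theorem bijOn_flatCoords {U : Finset (Fin (n + 1))} (hst : s < t) (hKJ : K ⊆ J)
    {lam : Fin (n + 1) → ℝ} (hlam : lam ∈ normalFanProduct K K U)
    {τ : (Fin (n + 1) → ℝ) × (Fin k → ℝ) → ℝ}
    (hτ : ∀ u ∈ normalFanProduct J K U, ∀ β ∈ gapFan s t, ∀ c : ℝ,
        τ (u + c • lam, β + c • edgeVector s t) = τ (u, β) + c)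
    {a b : Fin (n + 1)} (ha : a ∈ K ∩ U) (hb : b ∈ K \ U) :
    BijOn (flatCoords J K U s t lam τ a b) (fanSimplex J K ×ˢ gapFan s t)
      {z | ∀ x ∈ boundaryCoords J K s t a b, 0 ≤ z x} := by
  have hA : (K ∩ U).Nonempty := ⟨a, ha⟩
  have hB : (K \ U).Nonempty := ⟨b, hb⟩
  have hws : edgeVector s t s = 1 := by simp [edgeVector, hst.ne']
  have hw : ∀ r, r ≠ s → r ≠ t → edgeVector s t r = 0 := fun r h h' => by
    simp [edgeVector, h, h']
  refine ⟨?_, ?_, ?_⟩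
  · rintro ⟨ξ, β⟩ ⟨hξ, hβ⟩
    refine forall_mem_boundaryCoords.2 ⟨fun i hi hiK => ?_, fun r hr => ?_⟩
    · simp only [flatCoords, Sum.elim_inr, Sum.elim_inl, centering_of_notMem hiK,
        hlam.2.2.2 i hiK, mul_zero, sub_zero]
      exact hξ.2.1 i hiK
    · simp only [Finset.mem_erase] at hr
      exact hβ.2 r hr.2.1 hr.1
  · rintro ⟨ξ, β⟩ ⟨hξ : ξ ∈ _, hβ : β ∈ _⟩ ⟨ξ', β'⟩ ⟨hξ' : ξ' ∈ _, hβ' : β' ∈ _⟩ heq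
    have e1 : heightGap K U ξ = heightGap K U ξ' := congrFun heq (Sum.inl 0)
    have e2 : τ (centering K U ξ, β) = τ (centering K U ξ', β') := congrFun heq (Sum.inl 1)
    have e3 : ∀ i ∈ J, i ≠ a → i ≠ b →
        centering K U ξ i - β s * lam i = centering K U ξ' i - β' s * lam i := fun i hi h h' =>
      congrFun heq (Sum.inr (Sum.inl ⟨i, by simp [hi, h, h']⟩))
    have e4 : ∀ r, r ≠ s → r ≠ t → β r = β' r := fun r h h' =>
      congrFun heq (Sum.inr (Sum.inr ⟨r, by simp [h, h']⟩))
    -- Both points are moved along their lines to the slice with zero `s`-entry, where the remaining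
    -- coordinates determine them.
    have hu := add_smul_mem_normalFanProduct hKJ (centering_mem hA hB hKJ hξ) hlam (-β s)
    have hu' := add_smul_mem_normalFanProduct hKJ (centering_mem hA hB hKJ hξ') hlam (-β' s)
    have hg := add_smul_edgeVector_mem hβ (-β s)
    have hg' := add_smul_edgeVector_mem hβ' (-β' s)
    have huu := eq_of_mem_normalFanProduct hu hu' ha hb fun i hi h h' => by
      have := e3 i hi h h'
      simp only [Pi.add_apply, Pi.smul_apply, smul_eq_mul]
      linarith
    have hgg := eq_of_mem_gapFan hg hg' fun r hr => by
      simp only [Pi.add_apply, Pi.smul_apply, smul_eq_mul]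
      by_cases hrs : r = s
      · subst hrs; rw [hws]; ring
      · rw [hw r hrs hr, e4 r hrs hr]; ring
    have h1 := hτ _ hu _ hg (β s)
    have h2 := hτ _ hu' _ hg' (β' s)
    simp only [neg_smul, neg_add_cancel_right] at h1 h2
    rw [← neg_smul, ← neg_smul, huu, hgg, e2, h2] at h1
    have hs : β s = β' s := by
      simp only [neg_smul] at h1
      linarith
    rw [hs] at huu hgg
    rw [add_right_cancel hgg, eq_of_centering_eq hA hB hξ.1 hξ'.1 (add_right_cancel huu) e1]
  · intro z hz
    have hz' := forall_mem_boundaryCoords.1 hz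
    obtain ⟨u, hu, huz⟩ := exists_mem_normalFanProduct (J := J) hKJ ha hb
      (z := fun i => if hi : i ∈ (J.erase a).erase b then z (Sum.inr (Sum.inl ⟨i, hi⟩)) else 0)
      fun i hi hiK => by
        by_cases hi' : i ∈ (J.erase a).erase b
        · simp only [hi', dif_pos]; exact hz'.1 i hi' hiK
        · simp only [hi', dif_neg, not_false_eq_true, le_refl]
    obtain ⟨β, hβ, hβz⟩ := exists_mem_gapFan (s := s) (t := t)
      (fun r => if hr : r ∈ (Finset.univ.erase s).erase t then z (Sum.inr (Sum.inr ⟨r, hr⟩)) else 0)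
      fun r hr hr' => by
        have : r ∈ (Finset.univ.erase s).erase t := by simp [hr, hr']
        simp only [this, dif_pos]; exact hz'.2 r this
    -- The point `(u, β)` lies in the slice, as `β s = 0`; `c` is how far to flow to reach the
    -- prescribed time.
    set c := z (Sum.inl 1) - τ (u, β) with hc
    obtain ⟨ξ, hξ, h1, h2⟩ := exists_centering_eq hA hB hKJ
      (add_smul_mem_normalFanProduct hKJ hu hlam c) (z (Sum.inl 0))
    have hβs : (β + c • edgeVector s t) s = c := by
      simp only [Pi.add_apply, Pi.smul_apply, smul_eq_mul, hws, hβz s hst.ne]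
      simp
    refine ⟨(ξ, β + c • edgeVector s t), ⟨hξ, add_smul_edgeVector_mem hβ c⟩, ?_⟩
    ext (i | ⟨i, hi⟩ | ⟨r, hr⟩)
    · fin_cases i
      · simpa [flatCoords] using h2
      · simp only [flatCoords, h1, hτ u hu β hβ c]
        simp [hc]
    · have hi' := hi
      simp only [Finset.mem_erase] at hi'
      simp only [flatCoords, Sum.elim_inr, Sum.elim_inl, h1, hβs, Pi.add_apply, Pi.smul_apply,
        smul_eq_mul, huz i hi'.2.2 hi'.2.1 hi'.1, hi, dif_pos]
      ring
    · have hr' := hr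
      simp only [Finset.mem_erase] at hr'
      simp only [flatCoords, Sum.elim_inr, Pi.add_apply, Pi.smul_apply, smul_eq_mul,
        hw r hr'.2.1 hr'.1, hβz r hr'.1, hr, dif_pos, mul_zero, add_zero]

theorem le_one_of_mem_face {x : Fin (n + 1) → ℝ} (hx : x ∈ face J) (i : Fin (n + 1)) : x i ≤ 1 := by
  rw [← hx.1.2]
  exact Finset.single_le_sum (fun j _ => hx.1.1 j) (Finset.mem_univ i)

theorem lt_eight_of_mem_gapSimplex {α : Fin k → ℝ} (hα : α ∈ gapSimplex k) (r : Fin k) :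
    α r < 8 := by
  have h1 : α r ≤ 2 * Real.pi := by
    rw [← hα.2]
    exact Finset.single_le_sum (fun j _ => hα.1 j) (Finset.mem_univ r)
  linarith [Real.pi_lt_four]

/-- Local flatness at the points of the stratum. -/
theorem exists_flat_chart_of_mem (σ : CyclicPartition n k)
    {p : (Fin (n + 1) → ℝ) × (Fin k → ℝ)} (hp : p ∈ pantsCell σ J) :
    ∃ (N : Set ((Fin (n + 1) → ℝ) × (Fin k → ℝ))) (N' : Set (Fin ((J.card - 1) + (k - 1)) → ℝ))
      (f : (Fin (n + 1) → ℝ) × (Fin k → ℝ) → (Fin ((J.card - 1) + (k - 1)) → ℝ)),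
    N ⊆ ambientCell k J ∧ N ∈ 𝓝[ambientCell k J] p ∧ N' ⊆ stdCube _ ∧ N' ∈ 𝓝[stdCube _] (f p) ∧
    IsPLHomeo f N N' ∧ f '' (N ∩ pantsCell σ J) = N' ∩ stdSubcube _ := by
  classical
  obtain ⟨x, α⟩ := p
  obtain ⟨hamb, hsur⟩ := mem_pantsCell_iff.1 hp
  obtain ⟨s, t, hst, hs, ht, h1, h2⟩ := exists_star hamb.2 (gap_le_pi_of_surrounds hamb.2 hsur)
  have hsplit := (surrounds_angle_iff hst hamb.2 h1 h2 _).1 hsur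
  -- Taking `K` to be all maximal coordinates puts `x` in the star of `baryc K`; the half circle
  -- criterion shows that `K` meets both sides.
  obtain ⟨K, hK⟩ : ∃ K, K = topSet Finset.univ x := ⟨_, rfl⟩
  rw [← hK] at hsplit
  obtain ⟨⟨a, haK, haU, b, hbK, hbU, -⟩, -⟩ := hsplit
  have ha : a ∈ K ∩ upperSide σ s t := Finset.mem_inter.2 ⟨haK, haU⟩
  have hb : b ∈ K \ upperSide σ s t := Finset.mem_sdiff.2 ⟨hbK, hbU⟩
  have hKne : K.Nonempty := ⟨a, haK⟩
  have hpos : ∀ i ∈ K, 0 < x i := fun i hi => by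
    rw [hK, mem_topSet] at hi
    by_contra hle
    have := Finset.sum_nonpos fun j (hj : j ∈ Finset.univ) => (hi.2 j hj).trans (not_lt.1 hle)
    rw [hamb.1.1.2] at this
    linarith
  have hKJ : K ⊆ J := fun i hi => by
    by_contra hiJ
    exact (hpos i hi).ne' (hamb.1.2 i hiJ)
  have hlt : ∀ i ∈ K, ∀ j ∉ K, x j < x i := fun i hi j hj => by
    rw [hK, mem_topSet] at hi hj
    by_contra hle
    exact hj ⟨Finset.mem_univ _, fun l hl => (hi.2 l hl).trans (not_lt.1 hle)⟩
  obtain ⟨lam, hlam⟩ := exists_isOrderVector σ ⟨a, ha⟩ ⟨b, hb⟩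
  obtain ⟨τ, hτ1, hτ2, hτ3⟩ := exists_time (J := J) hst hKJ ⟨a, ha⟩ ⟨b, hb⟩ hlam
  have hev := eventually_mem_iff σ hst hKJ hKne hpos hlt hs ht h1 h2
  set v := (baryc K, chordVertex s t) with hv
  obtain ⟨e, he1, he2⟩ := exists_equiv_fin_two_sum (q := (J.card - 1) + (k - 1))
    (κ := {i // i ∈ (J.erase a).erase b} ⊕ {r : Fin k // r ∈ (Finset.univ.erase s).erase t}) (by
      have hba : b ∈ J.erase a := Finset.mem_erase.2
        ⟨fun h => hbU (h ▸ haU), hKJ hbK⟩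
      have hts : t ∈ Finset.univ.erase s := Finset.mem_erase.2 ⟨hst.ne', Finset.mem_univ t⟩
      have c1 := Finset.card_erase_add_one (hKJ haK)
      have c2 := Finset.card_erase_add_one hba
      have c3 := Finset.card_erase_add_one (Finset.mem_univ s)
      have c4 := Finset.card_erase_add_one hts
      rw [Finset.card_univ, Fintype.card_fin] at c3
      rw [Fintype.card_sum, Fintype.card_coe, Fintype.card_coe]
      omega)
  have hzero : ∀ y, y - v ∈ fanSimplex J K ×ˢ gapFan s t → (y - v ∈ pantsCone σ J K s t ↔
      ∀ c : Fin 2, flatCoords J K (upperSide σ s t) s t lam τ a b (y - v) (Sum.inl c) = 0) := by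
    intro y hy
    rw [Fin.forall_fin_two]
    exact hτ3 _ hy.1 _ hy.2
  have hpW : (x, α) - v ∈ fanSimplex J K ×ˢ gapFan s t := hev.self_of_nhds.1.1 hamb
  have hp0 := (hzero _ hpW).1 (hev.self_of_nhds.2.1 hp)
  refine exists_flat_chart_of_cone e (B := boundaryCoords J K s t a b) (v := v) hamb
    (isPLOn_flatCoords hKJ ⟨a, ha⟩ ⟨b, hb⟩ lam hτ1 a b)
    (bijOn_flatCoords hst hKJ hlam.1 hτ2 ha hb) ?_ (hev.mono fun y hy => hy.1) ?_
  · refine forall_mem_boundaryCoords.2 ⟨fun i hi hiK => ?_, fun r hr => ?_⟩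
    · simp only [flatCoords, Sum.elim_inr, Sum.elim_inl, centering_of_notMem hiK,
        hlam.1.2.2.2 i hiK, mul_zero, sub_zero]
      have : ((x, α) - v).1 i = x i := by simp [hv, baryc, hiK]
      rw [this]
      linarith [le_one_of_mem_face hamb.1 i]
    · simp only [Finset.mem_erase] at hr
      have : ((x, α) - v).2 r = α r := by simp [hv, chordVertex, hr.1, hr.2.1]
      simp only [flatCoords, Sum.elim_inr, this]
      exact lt_eight_of_mem_gapSimplex hamb.2 r
  · filter_upwards [hev] with y hy hyW
    rw [hy.2, hzero y hyW]
    constructor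
    · intro h i hi
      obtain ⟨c, hc⟩ := he1 i hi
      have hcB : (Sum.inl c : Fin 2 ⊕ ({i // i ∈ (J.erase a).erase b} ⊕
        {r : Fin k // r ∈ (Finset.univ.erase s).erase t})) ∉ boundaryCoords J K s t a b := by
        simp [boundaryCoords]
      rw [hc, if_neg hcB, h, hp0, sub_zero]
    · intro h c
      obtain ⟨i, hi, hc⟩ := he2 c
      have hcB : (Sum.inl c : Fin 2 ⊕ ({i // i ∈ (J.erase a).erase b} ⊕
        {r : Fin k // r ∈ (Finset.univ.erase s).erase t})) ∉ boundaryCoords J K s t a b := by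
        simp [boundaryCoords]
      have := h i hi
      rwa [hc, if_neg hcB, hp0, sub_zero] at this

/-- Near a vertex a simplex is an orthant in the other coordinates. With equal indices `gapFan r₀
r₀` is the tangent cone of `Δ_σ` at the vertex `r₀`. -/
theorem bijOn_cornerCoords {a : Fin (n + 1)} (ha : a ∈ J) (r₀ : Fin k) :
    BijOn (fun y : (Fin (n + 1) → ℝ) × (Fin k → ℝ) =>
      (Sum.elim (fun i => y.1 i) fun r => y.2 r :
        {i // i ∈ J.erase a} ⊕ {r : Fin k // r ∈ Finset.univ.erase r₀} → ℝ))
      (fanSimplex J {a} ×ˢ gapFan r₀ r₀) {z | ∀ x ∈ univ, 0 ≤ z x} := by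
  refine ⟨?_, ?_, ?_⟩
  · rintro ⟨ξ, β⟩ ⟨hξ, hβ⟩ (⟨i, hi⟩ | ⟨r, hr⟩) -
    · exact hξ.2.1 i (by simpa using Finset.ne_of_mem_erase hi)
    · exact hβ.2 r (Finset.ne_of_mem_erase hr) (Finset.ne_of_mem_erase hr)
  · rintro ⟨ξ, β⟩ ⟨hξ : ξ ∈ _, hβ : β ∈ _⟩ ⟨ξ', β'⟩ ⟨hξ' : ξ' ∈ _, hβ' : β' ∈ _⟩ heq
    have e1 : ∀ i, i ≠ a → ξ i = ξ' i := fun i hi => by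
      by_cases hiJ : i ∈ J
      · exact congrFun heq (Sum.inl ⟨i, Finset.mem_erase.2 ⟨hi, hiJ⟩⟩)
      · rw [hξ.2.2 i hiJ, hξ'.2.2 i hiJ]
    have e2 : ∀ r, r ≠ r₀ → β r = β' r := fun r hr =>
      congrFun heq (Sum.inr ⟨r, Finset.mem_erase.2 ⟨hr, Finset.mem_univ r⟩⟩)
    have hξa : ξ = ξ' := by
      have h1 := hξ.1
      have h2 := hξ'.1
      rw [← Finset.add_sum_erase _ _ (Finset.mem_univ a)] at h1 h2
      rw [Finset.sum_congr rfl fun i hi => e1 i (Finset.ne_of_mem_erase hi)] at h1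
      ext i
      by_cases hi : i = a
      · rw [hi]; linarith
      · exact e1 i hi
    rw [hξa, eq_of_mem_gapFan hβ hβ' e2]
  · intro z hz
    obtain ⟨β, hβ, hβz⟩ := exists_mem_gapFan (s := r₀) (t := r₀)
      (fun r => if hr : r ∈ Finset.univ.erase r₀ then z (Sum.inr ⟨r, hr⟩) else 0)
      fun r hr _ => by
        have : r ∈ Finset.univ.erase r₀ := by simp [hr]
        simp only [this, dif_pos]; exact hz _ trivial
    let x : Fin (n + 1) → ℝ := fun i => if hi : i ∈ J.erase a then z (Sum.inl ⟨i, hi⟩) else 0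
    have hx : ∀ i, i ≠ a → Function.update x a (-∑ j ∈ Finset.univ.erase a, x j) i = x i :=
      fun i hi => Function.update_of_ne hi _ _
    refine ⟨(Function.update x a (-∑ j ∈ Finset.univ.erase a, x j), β),
      ⟨⟨?_, fun i hi => ?_, fun i hi => ?_⟩, hβ⟩, ?_⟩
    · rw [← Finset.add_sum_erase _ _ (Finset.mem_univ a),
        Finset.sum_congr rfl fun i hi => hx i (Finset.ne_of_mem_erase hi)]
      simp
    · show 0 ≤ Function.update x a _ i
      rw [hx i (by simpa using hi)]
      by_cases hi' : i ∈ J.erase a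
      · simp only [x, hi', dif_pos]; exact hz _ trivial
      · simp only [x, hi', dif_neg, not_false_eq_true, le_refl]
    · show Function.update x a _ i = 0
      rw [hx i (by rintro rfl; exact hi ha)]
      simp [x, hi]
    · ext (⟨i, hi⟩ | ⟨r, hr⟩)
      · simp only [Sum.elim_inl]
        rw [hx i (Finset.ne_of_mem_erase hi)]
        simp only [x, hi, dif_pos]
      · simp only [Sum.elim_inr]
        rw [hβz r (Finset.ne_of_mem_erase hr)]
        simp only [hr, dif_pos]

theorem mem_gapSimplex_iff_single {r₀ : Fin k} {α : Fin k → ℝ} (h : 0 < α r₀) :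
    α ∈ gapSimplex k ↔ α - Pi.single r₀ (2 * Real.pi) ∈ gapFan r₀ r₀ := by
  have hv : ∀ r, r ≠ r₀ → (α - Pi.single r₀ (2 * Real.pi) : Fin k → ℝ) r = α r := fun r hr => by simp [hr]
  have hsum : ∑ r, (α - Pi.single r₀ (2 * Real.pi) : Fin k → ℝ) r = ∑ r, α r - 2 * Real.pi := by
    simp [Finset.sum_sub_distrib]
  constructor
  · rintro ⟨h1, h2⟩
    exact ⟨by rw [hsum, h2, sub_self], fun r hr _ => by rw [hv r hr]; exact h1 r⟩
  · rintro ⟨h1, h2⟩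
    refine ⟨fun r => ?_, by linarith⟩
    by_cases hr : r = r₀
    · exact hr ▸ h.le
    · rw [← hv r hr]; exact h2 r hr hr

/-- Local flatness at the points of the cell outside the stratum. -/
theorem exists_flat_chart_of_notMem (σ : CyclicPartition n k) (hJ : σ.Divides J)
    {p : (Fin (n + 1) → ℝ) × (Fin k → ℝ)} (hamb : p ∈ ambientCell k J) (hp : p ∉ pantsCell σ J) :
    ∃ (N : Set ((Fin (n + 1) → ℝ) × (Fin k → ℝ))) (N' : Set (Fin ((J.card - 1) + (k - 1)) → ℝ))
      (f : (Fin (n + 1) → ℝ) × (Fin k → ℝ) → (Fin ((J.card - 1) + (k - 1)) → ℝ)),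
    N ⊆ ambientCell k J ∧ N ∈ 𝓝[ambientCell k J] p ∧ N' ⊆ stdCube _ ∧ N' ∈ 𝓝[stdCube _] (f p) ∧
    IsPLHomeo f N N' ∧ f '' (N ∩ pantsCell σ J) = N' ∩ stdSubcube _ := by
  classical
  obtain ⟨x, α⟩ := p
  have hpi := Real.pi_pos
  -- Where `x a` and `α r₀` are positive the opposite facets are away, so the cell coincides locally
  -- with its corner at that pair of vertices.
  obtain ⟨a, ha⟩ : ∃ a, 0 < x a := by
    by_contra hcon
    push Not at hcon
    have := Finset.sum_nonpos fun r (_ : r ∈ Finset.univ) => hcon r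
    rw [hamb.1.1.2] at this
    linarith
  obtain ⟨r₀, hr₀⟩ : ∃ r, 0 < α r := by
    by_contra hcon
    push Not at hcon
    have := Finset.sum_nonpos fun r (_ : r ∈ Finset.univ) => hcon r
    rw [hamb.2.2] at this
    linarith
  have haJ : a ∈ J := by
    by_contra haJ
    exact ha.ne' (hamb.1.2 a haJ)
  have hq : 2 ≤ (J.card - 1) + (k - 1) := by
    obtain ⟨i, hi, j, hj, hij⟩ := hJ
    have h1 : 1 < J.card := Finset.one_lt_card.2 ⟨i, hi, j, hj, fun h => hij (by rw [h])⟩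
    have h2 : 1 < k := by
      have h3 := (σ.part i).isLt
      have h4 := (σ.part j).isLt
      have h5 : (σ.part i).val ≠ (σ.part j).val := fun h => hij (Fin.ext h)
      omega
    omega
  have hcard : Nat.card (Fin ((J.card - 1) + (k - 1))) =
      Nat.card ({i // i ∈ J.erase a} ⊕ {r : Fin k // r ∈ Finset.univ.erase r₀}) := by
    rw [Nat.card_sum, Nat.card_eq_finsetCard, Nat.card_eq_finsetCard, Nat.card_fin,
      Finset.card_erase_of_mem haJ, Finset.card_erase_of_mem (Finset.mem_univ r₀),
      Finset.card_univ, Fintype.card_fin]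
  obtain ⟨e⟩ := Finite.card_eq.1 hcard
  set v : (Fin (n + 1) → ℝ) × (Fin k → ℝ) := (baryc {a}, Pi.single r₀ (2 * Real.pi)) with hv
  let F := fun y : (Fin (n + 1) → ℝ) × (Fin k → ℝ) =>
      (Sum.elim (fun i => y.1 i) fun r => y.2 r :
        {i // i ∈ J.erase a} ⊕ {r : Fin k // r ∈ Finset.univ.erase r₀} → ℝ)
  have hF : IsLinearMap ℝ F :=
    ⟨fun y z => by ext (i | r) <;> rfl, fun c y => by ext (i | r) <;> rfl⟩
  have hF8 : ∀ i, F ((x, α) - v) i < 8 := by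
    rintro (⟨i, hi⟩ | ⟨r, hr⟩)
    · have : F ((x, α) - v) (Sum.inl ⟨i, hi⟩) = x i := by
        simp [F, hv, baryc, Finset.ne_of_mem_erase hi]
      rw [this]
      linarith [le_one_of_mem_face hamb.1 i]
    · have : F ((x, α) - v) (Sum.inr ⟨r, hr⟩) = α r := by
        simp [F, hv, Finset.ne_of_mem_erase hr]
      rw [this]
      exact lt_eight_of_mem_gapSimplex hamb.2 r
  have c1 : Continuous fun y : (Fin (n + 1) → ℝ) × (Fin k → ℝ) => y.1 a := by fun_prop
  have c2 : Continuous fun y : (Fin (n + 1) → ℝ) × (Fin k → ℝ) => y.2 r₀ := by fun_prop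
  refine exists_flat_chart_of_cone e (B := univ) (v := v) (F := F) hamb
    (((isConvexPolyhedron_fanSimplex J {a}).prod
      (isConvexPolyhedron_gapFan r₀ r₀)).isPolyhedral.isPLOn_of_isLinearMap hF)
    (bijOn_cornerCoords haJ r₀) (fun i _ => hF8 i) ?_ ?_
  · filter_upwards [c1.continuousAt.eventually (lt_mem_nhds ha),
      c2.continuousAt.eventually (lt_mem_nhds hr₀)] with y h1 h2
    exact and_congr (mem_face_iff (by simpa using haJ) (Finset.singleton_nonempty a)
      (by simpa using h1)) (mem_gapSimplex_iff_single h2)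
  · have hnot : ∀ᶠ y in 𝓝 (x, α), y ∉ pantsCell σ J := by
      have h1 : (x, α) ∉ {y : (Fin (n + 1) → ℝ) × (Fin k → ℝ) |
          Surrounds (topSet Finset.univ y.1) (σ.angle y.2)} := fun h =>
        hp (mem_pantsCell_iff.2 ⟨hamb, h⟩)
      filter_upwards [(isClosed_surrounds σ).isOpen_compl.mem_nhds h1] with y hy hy'
      exact hy (mem_pantsCell_iff.1 hy').2
    -- Every corner coordinate is rescaled to be negative near the point, so already the first one
    -- keeps the chart off the subcube. That a first one exists uses that `σ` divides `J`.
    let i₀ : Fin ((J.card - 1) + (k - 1)) := ⟨0, by omega⟩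
    have hcont : Continuous fun y => F (y - v) (e i₀) := by
      rcases e i₀ with i | r <;> simp only [F, Sum.elim_inl, Sum.elim_inr] <;> fun_prop
    filter_upwards [hnot, hcont.continuousAt.eventually (gt_mem_nhds (hF8 (e i₀)))] with y h1 h2 _
    refine iff_of_false h1 fun h => ?_
    have := h i₀ (by simp [i₀])
    rw [if_pos (mem_univ _)] at this
    linarith

end FlatCharts

end PhaseTropical

end

open PhaseTropical
theorem mainTheorem4 (n k : ℕ) (σ : CyclicPartition n k) (J : Finset (Fin (n + 1)))
    (hJ : σ.Divides J) :
    IsLocallyFlat ((J.card - 1) + (k - 1)) (ambientCell k J) (pantsCell σ J) ∧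
    ∀ (K : Finset (Fin (n + 1))) (s t : Fin k), K ⊆ J → s < t →
      (K ∩ upperSide σ s t).Nonempty → (K \ upperSide σ s t).Nonempty →
      (baryc K, chordVertex s t) ∈ pantsCell σ J ∧
      pantsFan σ J K s t ⊆ spineFan σ J K s t ×ˢ localFan (gapSimplex k) (chordVertex s t) ∧
      IsPLHomeo (centering K (upperSide σ s t)) (spineFan σ J K s t)
        (normalFanProduct J K (upperSide σ s t)) ∧
      ∀ lam : Fin (n + 1) → ℝ, IsOrderVector σ K s t lam →
        IsPLHomeo
          (fun y : ((Fin (n + 1) → ℝ) × (Fin k → ℝ)) × ℝ =>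
            (centering K (upperSide σ s t) y.1.1 + y.2 • lam, y.1.2 + y.2 • edgeVector s t))
          (pantsFan σ J K s t ×ˢ (univ : Set ℝ))
          (normalFanProduct J K (upperSide σ s t) ×ˢ
            localFan (gapSimplex k) (chordVertex s t)) := by
  refine ⟨fun p hp => ?_, fun K s t hKJ hst hA hB => ?_⟩
  · by_cases h : p ∈ pantsCell σ J
    · exact exists_flat_chart_of_mem σ h
    · exact exists_flat_chart_of_notMem σ hJ hp h
  have hK : K.Nonempty := hA.mono Finset.inter_subset_left
  rw [spineFan, pantsFan_eq σ hst hKJ hK, localFan_gapSimplex hst, fst_image_pantsCone hA hB]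
  refine ⟨?_, ?_, ?_, fun lam hlam => ?_⟩
  -- The vertex is the apex of the cone: there all of `K` is maximal and all deviations are zero.
  · rw [(eventually_mem_iff_vertex σ hst hKJ hK).self_of_nhds.2, sub_self]
    obtain ⟨i, hi⟩ := hA
    obtain ⟨j, hj⟩ := hB
    obtain ⟨hiK, hiU⟩ := Finset.mem_inter.1 hi
    obtain ⟨hjK, hjU⟩ := Finset.mem_sdiff.1 hj
    have h0 : ∀ i, σ.angle 0 i = 0 := fun i => (σ.isLinearMap_angle i).map_zero
    have htop : ∀ l ∈ K, l ∈ topSet K (0 : Fin (n + 1) → ℝ) := fun l hl =>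
      mem_topSet.2 ⟨hl, fun _ _ => le_rfl⟩
    exact ⟨⟨by simp [fanSimplex], zero_mem_gapFan⟩,
      ⟨i, htop i hiK, hiU, j, htop j hjK, hjU, by simp [h0]⟩,
      i, htop i hiK, hiU, j, htop j hjK, hjU, by simp [h0]⟩
  · rintro ⟨ξ, β⟩ h
    have h' := (mem_pantsCone_iff hA hB).1 h
    exact ⟨⟨h'.1, h'.2.2.1⟩, h'.2.1⟩
  · exact ((isPolyhedral_heightGap_eq_zero hA hB).isPLOn_of_isLinearMap
      (isLinearMap_centering _ _)).isPLHomeo (bijOn_centering hA hB hKJ)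
  · exact ((isPolyhedral_pantsCone σ J K s t).prod_univ.isPLOn_of_isLinearMap
      (isLinearMap_product _ _ _ _)).isPLHomeo (bijOn_product hst hKJ hA hB hlam)
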